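/- **Conventions.** A *signature* over a set $O$ (of types) is a set $A$ of function symbols, each $a\in A$ having an arity $|a|\in\mathbb N$, an output type $\partial_a(0)\in O$ and input types $\partial_a(1),\dots,\partial_a(|a|)\in O$. A morphism $(f,\sigma,u)$ from $A$ (over $O$) to $B$ (over $Q$) in $\mathbf{Sig}_a$ consists of functions $f:A\to B$, $u:O\to Q$ and, for each $a\in A$, a permutation $\sigma_a$ of $\{1,\dots,|a|\}$ (the *amalgamation permutations*), such that $|f(a)|=|a|$, $\partial_{f(a)}(0)=u(\partial_a(0))$ and $\partial_{f(a)}(\sigma_a(i))=u(\partial_a(i))$. It is *strict* if all $\sigma_a$ are identities. For $A,B$ over $O$, $A\otimes B$ has as symbols the formal composites $\langle a,b_1,\dots,b_{|a|}\rangle$ with $\partial_{b_i}(0)=\partial_a(i)$, of output type $\partial_a(0)$ and with the input types of the $b_i$ concatenated in order; on morphisms, $(f\otimes g)\langle a,b_i\rangle=\langle f(a),g(b_{\sigma_a^{-1}(j)})\rangle_j$, with permutations moving the $i$-th block to the $\sigma_a(i)$-th place and acting inside it by the permutation of $b_i$. The unit $I_\otimes$ has one unary symbol of constant type $o$ for each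 $o\in O$, and the coherence isomorphisms are the evident strict ones. A *monoid* in $\mathbf{Sig}_a$ is a monoid for $\otimes$ in some fibre; homomorphisms and isomorphisms of monoids may change the set of types. A monoid has *standard amalgamation* if its multiplication is strict. Let $M$ be a monoid over $O$ with multiplication $\mu^M$ and unit $e$, and let $\gamma$ denote the amalgamation permutations of $\mu^M$. For a signature $A$ over the set of symbols of $M$ write $\check a\in M$ for the output type of $a\in A$. For such $A,B$, the symbols of $A\odot B$ are the $\dot\langle a,b_1,\dots,b_k\dot\rangle$ for which $\langle\check a,\check b_1,\dots,\check b_k\rangle\in M\otimes M$; the output type is $\mu^M\langle\check a,\check b_i\rangle$ and the inputs are those of $a,b_1,\dots,b_k$ in this order. The unit $I_\odot$ has one nullary symbol of output type $e(o)$ for each $o\in O$. The unit isomorphisms of $\odot$ are the evident strict ones, and the associativity isomorphism sends $\dot\langle a,\dot\langle b_i,c_{i,j}\dot\rangle\dot\rangle$ to $\dot\langle\dot\langle a,b_i\dot\rangle,c_{\gamma^{-1}(i,j)}\dot\rangle$, with $\gamma=\gamma_{\langle\check a,\check b_i\rangle}$, moving the block of inputs of each symbol to the block of the same symbol. Let $\varphi:(A\otimes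 X)\odot(B\otimes X)\to(A\odot B)\otimes X$ be the strict isomorphism $\dot\langle\langle a,x_{0,j}\rangle,\langle b_i,x_{i,j}\rangle\dot\rangle\mapsto\langle\dot\langle a,b_i\dot\rangle,x_{0,1},\dots,x_{k,l_k}\rangle$. The *web monoid* $\mathcal W(M)$ is the free $\odot$-monoid $(\mathcal W,\mu)$ on $I_\otimes$ (over the symbols of $M$), considered with the unique $\otimes$-monoid structure whose unit is the universal morphism $I_\otimes\to\mathcal W$ and whose multiplication $\nu$ satisfies $\mu\circ(\nu\odot\nu)=\nu\circ(\mu\otimes 1)\circ\varphi$. It is thus a monoid in $\mathbf{Sig}_a$ whose set of types is the set of symbols of $M$; it is determined up to isomorphism. An *opetopic set* consists of sets $X_n$ ($n\ge0$), signature structures over $X_n$ on $X_{n+1}$, monoids $\mathbf S_n$ over $X_n$ (the *pasting diagram monoids*), strict morphisms $\vartheta_n:X_{n+1}\to\mathbf S_n$ over $X_n$, and prone (cartesian) homomorphisms of monoids $\mathbf S_0\to\mathbf 1$ over $X_0\to\{*\}$ and $\mathbf S_{n+1}\to\mathcal W(\mathbf S_n)$ over $\vartheta_n$, where $\mathbf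 1=I_\otimes$ is the monoid over $\{*\}$ with a single, unary symbol. **Theorem.** (1) Let $O=\{\text{circle},\text{square},\text{triangle}\}$, and let $M$ be the signature over $O$ with one binary symbol $b$, whose typing $\partial_b:\{0,1,2\}\to O$ is an arbitrary injective function, and, for each $x\in O$, two unary symbols $u_x,1_x$ of input and output type $x$ (so $M$ has three unary symbols $u_x$ besides the three identities $1_x$). Then $M$ carries a monoid structure in $\mathbf{Sig}_a$ with identities $1_x$. Every monoid structure on $M$ has standard amalgamation, its web monoid $\mathcal W(M)$ exists, and $\mathcal W(M)$ is not isomorphic to any monoid in $\mathbf{Sig}_a$ with standard amalgamation. (2) There are an opetopic set $X$ and an $n\in\mathbb N$ such that the pasting diagram monoid $\mathbf S_n$ of $X$ is not isomorphic to any monoid in $\mathbf{Sig}_a$ with standard amalgamation. -/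

import Mathlib

namespace Web

/-! ### Signatures with amalgamation -/

/-- The set `O†` of finite lists in `O` with one additional element (the output type). -/
structure Dagger (O : Type) where
  ar : ℕ
  out : O
  inp : Fin ar → O

/-- A signature over `O`: a set of function symbols with a typing function to `O†`. -/
structure Sig (O : Type) where
  Sym : Type
  typ : Sym → Dagger O

namespace Sig

abbrev ar {O : Type} (A : Sig O) (a : A.Sym) : ℕ := (A.typ a).ar

abbrev out {O : Type} (A : Sig O) (a : A.Sym) : O := (A.typ a).out

abbrev inp {O : Type} (A : Sig O) (a : A.Sym) (i : Fin (A.ar a)) : O := (A.typ a).inp i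

end Sig

/-- A morphism `(f, σ, u)` of signatures with amalgamation over the function `u` on types.
The permutation `σ_a` is an equivalence `Fin |a| ≃ Fin |f a|`; in particular `|f a| = |a|`. -/
structure Hom {O Q : Type} (u : O → Q) (A : Sig O) (B : Sig Q) where
  toFun : A.Sym → B.Sym
  perm : ∀ a : A.Sym, Fin (A.ar a) ≃ Fin (B.ar (toFun a))
  out_eq : ∀ a : A.Sym, B.out (toFun a) = u (A.out a)
  inp_eq : ∀ (a : A.Sym) (i : Fin (A.ar a)), B.inp (toFun a) (perm a i) = u (A.inp a i)

/-- Morphisms in the fibre over `O`. -/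
abbrev VHom {O : Type} (A B : Sig O) : Type := Hom (id : O → O) A B

namespace Hom

/-- Trivial amalgamation: all the permutations are identities. -/
def Strict {O Q : Type} {u : O → Q} {A : Sig O} {B : Sig Q} (f : Hom u A B) : Prop :=
  ∀ (a : A.Sym) (i : Fin (A.ar a)), (f.perm a i : ℕ) = (i : ℕ)

/-- A morphism given by a family `perm`, with the typing condition stated for the inverses. -/
def ofSymm {O Q : Type} {u : O → Q} {A : Sig O} {B : Sig Q} (f : A.Sym → B.Sym)
    (perm : ∀ a : A.Sym, Fin (A.ar a) ≃ Fin (B.ar (f a)))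
    (out_eq : ∀ a : A.Sym, B.out (f a) = u (A.out a))
    (inp_eq : ∀ (a : A.Sym) (k : Fin (B.ar (f a))),
      B.inp (f a) k = u (A.inp a ((perm a).symm k))) : Hom u A B where
  toFun := f
  perm := perm
  out_eq := out_eq
  inp_eq := fun a i => by rw [inp_eq, Equiv.symm_apply_apply]

/-- A morphism whose permutations are given as bijections `θ` between sets of positions `P`, `P'`,
which are enumerated by `e` and `e'`. -/
def ofPos {O Q : Type} {u : O → Q} {A : Sig O} {B : Sig Q} (f : A.Sym → B.Sym)
    {P P' : A.Sym → Type} (e : ∀ a, P a ≃ Fin (A.ar a)) (e' : ∀ a, P' a ≃ Fin (B.ar (f a)))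
    (θ : ∀ a, P a ≃ P' a)
    (out_eq : ∀ a : A.Sym, B.out (f a) = u (A.out a))
    (inp_eq : ∀ (a : A.Sym) (x : P' a),
      B.inp (f a) (e' a x) = u (A.inp a (e a ((θ a).symm x)))) : Hom u A B :=
  ofSymm f (fun a => (e a).symm.trans ((θ a).trans (e' a))) out_eq
    (fun a k => by
      obtain ⟨x, rfl⟩ := (e' a).surjective k
      rw [inp_eq]
      simp)

theorem inp_symm {O Q : Type} {u : O → Q} {A : Sig O} {B : Sig Q} (f : Hom u A B) (a : A.Sym)
    (k : Fin (B.ar (f.toFun a))) :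
    B.inp (f.toFun a) k = u (A.inp a ((f.perm a).symm k)) := by
  rw [← f.inp_eq, Equiv.apply_symm_apply]

def ident {O : Type} (A : Sig O) : VHom A A where
  toFun := id
  perm := fun _ => Equiv.refl _
  out_eq := fun _ => rfl
  inp_eq := fun _ _ => rfl

/-- `g.comp f` is `g ∘ f`, with permutations `τ_{f a} ∘ σ_a`. -/
def comp {O Q R : Type} {v : Q → R} {u : O → Q} {A : Sig O} {B : Sig Q} {C : Sig R}
    (g : Hom v B C) (f : Hom u A B) : Hom (v ∘ u) A C where
  toFun := fun a => g.toFun (f.toFun a)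
  perm := fun a => (f.perm a).trans (g.perm (f.toFun a))
  out_eq := fun a => by rw [g.out_eq, f.out_eq]; rfl
  inp_eq := fun a i => by
    rw [Equiv.trans_apply, g.inp_eq, f.inp_eq]; rfl

end Hom

/-- Composition in the fibre over `O`. -/
def VHom.comp {O : Type} {A B C : Sig O} (g : VHom B C) (f : VHom A B) : VHom A C :=
  Hom.comp g f

/-! ### The tensor product `⊗` -/

/-- Formal composites `⟨a, b_i⟩` with `out b_i = inp a i`. -/
structure Comp {O : Type} (A B : Sig O) where
  head : A.Sym
  arg : Fin (A.ar head) → B.Sym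
  typed : ∀ i, B.out (arg i) = A.inp head i

/-- The composition `σ ∗ (ρ_1, …, ρ_m)` of the operad of symmetries in double index notation:
`(i, j) ↦ (σ i, ρ_i j)`. The family `ρ` is indexed here by the target blocks `k = σ i`. -/
def block {m m' : ℕ} (σ : Fin m ≃ Fin m') (n : Fin m → ℕ) (n' : Fin m' → ℕ)
    (ρ : ∀ k, Fin (n (σ.symm k)) ≃ Fin (n' k)) :
    (Σ i, Fin (n i)) ≃ (Σ k, Fin (n' k)) :=
  ((Equiv.sigmaCongrRight fun k => (ρ k).symm).trans
    (Equiv.sigmaCongrLeft (β := fun i => Fin (n i)) σ.symm)).symm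

/-- `A ⊗ B`. The inputs of `⟨a, b_i⟩` are those of the `b_i` side by side (`finSigmaFinEquiv` is
the lexicographic enumeration of the pairs `(i, j)`). -/
abbrev tensor {O : Type} (A B : Sig O) : Sig O where
  Sym := Comp A B
  typ := fun p =>
    { ar := ∑ i, B.ar (p.arg i)
      out := A.out p.head
      inp := fun k =>
        B.inp (p.arg (finSigmaFinEquiv.symm k).1) (finSigmaFinEquiv.symm k).2 }

theorem tensor_inp {O : Type} (A B : Sig O) (p : Comp A B) (q : Σ i, Fin (B.ar (p.arg i))) :
    (tensor A B).inp p (finSigmaFinEquiv q) = B.inp (p.arg q.1) q.2 :=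
  congrArg (fun r : (Σ i, Fin (B.ar (p.arg i))) => B.inp (p.arg r.1) r.2)
    (Equiv.symm_apply_apply finSigmaFinEquiv q)

/-- `f ⊗_u g`, sending `⟨a, b_i⟩` to `⟨f a, g (b_{σ⁻¹ j})⟩`, with permutations
`σ_a ∗ (τ_{b_1}, …, τ_{b_n})`. -/
def tensorHom {O Q : Type} {u : O → Q} {A B : Sig O} {A' B' : Sig Q}
    (f : Hom u A A') (g : Hom u B B') : Hom u (tensor A B) (tensor A' B') :=
  Hom.ofSymm
    (fun p =>
      { head := f.toFun p.head
        arg := fun k => g.toFun (p.arg ((f.perm p.head).symm k))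
        typed := fun k => by
          rw [g.out_eq, p.typed, ← f.inp_eq, Equiv.apply_symm_apply] })
    (fun p =>
      finSigmaFinEquiv.symm.trans <|
      (block (f.perm p.head) (fun i => B.ar (p.arg i))
        (fun k => B'.ar (g.toFun (p.arg ((f.perm p.head).symm k))))
        (fun k => g.perm (p.arg ((f.perm p.head).symm k)))).trans
      finSigmaFinEquiv)
    (fun p => f.out_eq p.head)
    (fun p k => by
      let i := (f.perm p.head).symm (finSigmaFinEquiv.symm k).1
      exact (g.inp_symm (p.arg i) (finSigmaFinEquiv.symm k).2).trans
        (congrArg u (tensor_inp A B p ⟨i, _⟩)).symm)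

/-- The unit `I_O` of `⊗`: one unary symbol of constant type `o` for every `o : O`. -/
abbrev unit (O : Type) : Sig O where
  Sym := O
  typ := fun o => { ar := 1, out := o, inp := fun _ => o }

/-- `I_u : I_O → I_Q`. -/
def unitHom {O Q : Type} (u : O → Q) : Hom u (unit O) (unit Q) where
  toFun := u
  perm := fun _ => Equiv.refl _
  out_eq := fun _ => rfl
  inp_eq := fun _ _ => rfl

/-- `α : A ⊗ (B ⊗ C) → (A ⊗ B) ⊗ C`. The permutation `(i, (j, k)) ↦ ((i, j), k)` preserves the
lexicographic order, so it is the identity. -/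
def assocHom {O : Type} (A B C : Sig O) :
    VHom (tensor A (tensor B C)) (tensor (tensor A B) C) :=
  Hom.ofSymm
    (fun p =>
      { head :=
          { head := p.head
            arg := fun i => (p.arg i).head
            typed := p.typed }
        arg := fun k =>
          (p.arg (finSigmaFinEquiv.symm k).1).arg (finSigmaFinEquiv.symm k).2
        typed := fun k => (p.arg _).typed _ })
    (fun p =>
      finSigmaFinEquiv.symm.trans <|
      (Equiv.sigmaCongrRight fun _ => finSigmaFinEquiv.symm).trans <|
      (Equiv.sigmaAssoc fun i j => Fin (C.ar ((p.arg i).arg j))).symm.trans <|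
      (Equiv.sigmaCongrLeft
        (β := fun q : (Σ i, Fin (B.ar (p.arg i).head)) => Fin (C.ar ((p.arg q.1).arg q.2)))
        finSigmaFinEquiv.symm).symm.trans
      finSigmaFinEquiv)
    (fun _ => rfl)
    (fun p k => by
      let q := finSigmaFinEquiv.symm (finSigmaFinEquiv.symm k).1
      let l : Fin (C.ar ((p.arg q.1).arg q.2)) := (finSigmaFinEquiv.symm k).2
      exact ((tensor_inp A (tensor B C) p ⟨q.1, finSigmaFinEquiv ⟨q.2, l⟩⟩).trans
        (tensor_inp B C (p.arg q.1) ⟨q.2, l⟩)).symm)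

/-- `λ : I ⊗ A → A`, `⟨1, a⟩ ↦ a`. -/
def leftUnitor {O : Type} (A : Sig O) : VHom (tensor (unit O) A) A :=
  Hom.ofSymm
    (fun p => p.arg (0 : Fin 1))
    (fun p =>
      finSigmaFinEquiv.symm.trans (Equiv.uniqueSigma fun i : Fin 1 => Fin (A.ar (p.arg i))))
    (fun p => p.typed (0 : Fin 1))
    (fun p k => (tensor_inp (unit O) A p ⟨(0 : Fin 1), k⟩).symm)

/-- `ρ : A → A ⊗ I`, `a ↦ ⟨a, 1, …, 1⟩`. -/
def rightUnitor {O : Type} (A : Sig O) : VHom A (tensor A (unit O)) :=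
  Hom.ofSymm
    (fun a =>
      { head := a
        arg := fun i => A.inp a i
        typed := fun _ => rfl })
    (fun a => (Equiv.sigmaUnique (Fin (A.ar a)) fun _ => Fin 1).symm.trans finSigmaFinEquiv)
    (fun _ => rfl)
    (fun _ _ => rfl)

/-! ### Monoids -/

/-- A monoid structure (for `⊗`) on a signature over `O`. -/
structure MonStr {O : Type} (A : Sig O) where
  mul : VHom (tensor A A) A
  one : VHom (unit O) A
  one_mul : mul.comp (tensorHom one (Hom.ident A)) = leftUnitor A
  mul_one : (mul.comp (tensorHom (Hom.ident A) one)).comp (rightUnitor A) = Hom.ident A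
  assoc : (mul.comp (tensorHom mul (Hom.ident A))).comp (assocHom A A A) =
    mul.comp (tensorHom (Hom.ident A) mul)

/-- Standard amalgamation: the multiplication is strict. -/
def MonStr.Standard {O : Type} {A : Sig O} (m : MonStr A) : Prop := m.mul.Strict

/-- Homomorphisms of monoids over a function `u` on types. -/
structure IsMonHom {O Q : Type} {A : Sig O} {B : Sig Q} (m : MonStr A) (n : MonStr B)
    {u : O → Q} (f : Hom u A B) : Prop where
  mul : (Hom.comp f m.mul : Hom u (tensor A A) B) = Hom.comp n.mul (tensorHom f f)
  one : (Hom.comp f m.one : Hom u (unit O) B) = Hom.comp n.one (unitHom u)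

/-- Isomorphism of monoids in the category of all signatures with amalgamation (over varying sets
of types): there are homomorphisms in both directions which are inverse to each other. -/
def MonIso {O Q : Type} {A : Sig O} {B : Sig Q} (m : MonStr A) (n : MonStr B) : Prop :=
  ∃ (u : O → Q) (v : Q → O) (f : Hom u A B) (g : Hom v B A),
    IsMonHom m n f ∧ IsMonHom n m g ∧
    (⟨v ∘ u, g.comp f⟩ : Σ w : O → O, Hom w A A) = ⟨id, Hom.ident A⟩ ∧
    (⟨u ∘ v, f.comp g⟩ : Σ w : Q → Q, Hom w B B) = ⟨id, Hom.ident B⟩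

/-- Prone (cartesian) homomorphisms, for the projection of monoids to their sets of types. -/
def IsProne {O Q : Type} {A : Sig O} {B : Sig Q} (m : MonStr A) (n : MonStr B)
    {u : O → Q} (f : Hom u A B) : Prop :=
  IsMonHom m n f ∧
  ∀ (R : Type) (C : Sig R) (l : MonStr C) (w : R → O) (g : Hom (u ∘ w) C B),
    IsMonHom l n g → ∃! h : Hom w C A, IsMonHom l m h ∧ f.comp h = g

theorem hom_unit_eq {O Q : Type} {u : O → Q} {A : Sig O} (f g : Hom u A (unit Q)) : f = g := by
  obtain ⟨f, s, hf, hf'⟩ := f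
  obtain ⟨g, t, hg, hg'⟩ := g
  obtain rfl : f = g := funext fun a => (hf a).trans (hg a).symm
  obtain rfl : s = t := by
    funext a
    refine Equiv.ext fun i => ?_
    exact Subsingleton.elim (α := Fin 1) (s a i) (t a i)
  rfl

/-- The monoid structure on the unit `I_O`. -/
def unitMon (O : Type) : MonStr (unit O) where
  mul := leftUnitor (unit O)
  one := Hom.ident (unit O)
  one_mul := hom_unit_eq _ _
  mul_one := hom_unit_eq _ _
  assoc := hom_unit_eq _ _

/-! ### The second tensor product `⊙`

Here `S` is a signature over `O` with a monoid structure `m`. The objects of the fibre over the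
monoid are the signatures over the set `S.Sym`. -/

section Odot

variable {O : Type} {S : Sig O}

/-- The horizontal typing of `A`: that of its output types. -/
abbrev hor (A : Sig S.Sym) : Sig O where
  Sym := A.Sym
  typ := fun a => S.typ (A.out a)

/-- The composite `⟨out a, out b_i⟩` of the output types. -/
abbrev outComp {A B : Sig S.Sym} (p : Comp (hor A) (hor B)) : Comp S S where
  head := A.out p.head
  arg := fun i => B.out (p.arg i)
  typed := p.typed

/-- The enumeration, in order, of one block of length `n` followed by blocks of lengths `k i`. -/
def hidx {r : ℕ} (n : ℕ) (k : Fin r → ℕ) : Fin n ⊕ (Σ i, Fin (k i)) ≃ Fin (n + ∑ i, k i) :=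
  (Equiv.sumCongr (Equiv.refl _) finSigmaFinEquiv).trans finSumFinEquiv

/-- `A ⊙ B`: formal composites with respect to the horizontal typing, the vertical inputs being
those of `a, b_1, …, b_k` in this order. -/
abbrev odot (m : MonStr S) (A B : Sig S.Sym) : Sig S.Sym where
  Sym := Comp (hor A) (hor B)
  typ := fun p =>
    { ar := A.ar p.head + ∑ i, B.ar (p.arg i)
      out := m.mul.toFun (outComp p)
      inp := fun k =>
        Sum.elim (A.inp p.head) (fun q : (Σ i, Fin (B.ar (p.arg i))) => B.inp (p.arg q.1) q.2)
          ((hidx _ _).symm k) }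

theorem odot_inp (m : MonStr S) (A B : Sig S.Sym) (p : Comp (hor A) (hor B))
    (x : Fin (A.ar p.head) ⊕ (Σ i, Fin (B.ar (p.arg i)))) :
    (odot m A B).inp p (hidx _ _ x) =
      Sum.elim (A.inp p.head) (fun q : (Σ i, Fin (B.ar (p.arg i))) => B.inp (p.arg q.1) q.2) x :=
  congrArg _ (Equiv.symm_apply_apply (hidx _ _) x)

theorem inp_cast (x y : S.Sym) (h : x = y) (i : Fin (S.ar x)) :
    S.inp y (finCongr (congrArg S.ar h) i) = S.inp x i := by
  subst h; rfl

theorem comp_eq {A B : Sig O} (p q : Comp A B) (h : p.head = q.head)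
    (h' : ∀ i, p.arg i = q.arg (finCongr (congrArg A.ar h) i)) : p = q := by
  obtain ⟨a, b, t⟩ := p
  obtain ⟨a', b', t'⟩ := q
  obtain rfl : a = a' := h
  obtain rfl : b = b' := funext h'
  rfl

/-- A morphism in the fibre, as a morphism between the horizontal signatures. -/
def horHom {A B : Sig S.Sym} (f : VHom A B) : VHom (hor A) (hor B) where
  toFun := f.toFun
  perm := fun a => finCongr (congrArg S.ar (f.out_eq a).symm)
  out_eq := fun a => congrArg S.out (f.out_eq a)
  inp_eq := fun a i => inp_cast _ _ (f.out_eq a).symm i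

/-- `f ⊙ g`, with permutations `(τ_a, σ ∗ (τ'_{b_1}, …, τ'_{b_k}))`, where `σ` is the identity,
since we work over the identity of the monoid. -/
def odotHom (m : MonStr S) {A B A' B' : Sig S.Sym} (f : VHom A A') (g : VHom B B') :
    VHom (odot m A B) (odot m A' B') :=
  Hom.ofPos
    (tensorHom (horHom f) (horHom g)).toFun
    (fun _ => hidx _ _)
    (fun _ => hidx _ _)
    (fun p =>
      Equiv.sumCongr (f.perm p.head)
        (block ((horHom f).perm p.head) (fun i => B.ar (p.arg i))
          (fun k => B'.ar (g.toFun (p.arg (((horHom f).perm p.head).symm k))))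
          (fun k => g.perm (p.arg (((horHom f).perm p.head).symm k)))))
    (fun p => by
      refine congrArg m.mul.toFun (comp_eq _ _ (f.out_eq p.head) fun i => ?_)
      exact g.out_eq _)
    (fun p x => by
      refine (odot_inp m A' B' _ x).trans (Eq.trans ?_ (odot_inp m A B p _).symm)
      rcases x with x | ⟨i, j⟩
      · exact f.inp_symm p.head x
      · exact g.inp_symm _ j)

/-- The unit `I_⊙`: a symbol of output type `e o` without vertical inputs for every `o : O`. -/
abbrev odotUnit (m : MonStr S) : Sig S.Sym where
  Sym := O
  typ := fun o => { ar := 0, out := m.one.toFun o, inp := Fin.elim0 }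

/-- `λ^⊙ : I_⊙ ⊙ A → A`, `⟨1, a⟩ ↦ a`. -/
def odotLeftUnitor (m : MonStr S) (A : Sig S.Sym) : VHom (odot m (odotUnit m) A) A :=
  Hom.ofSymm
    (fun p => p.arg (m.one.perm p.head (0 : Fin 1)))
    (fun p =>
      (hidx _ _).symm.trans <|
      (Equiv.emptySum (Fin 0) _).trans <|
      (Equiv.sigmaCongrLeft (β := fun i => Fin (A.ar (p.arg i))) (m.one.perm p.head)).symm.trans
      (Equiv.uniqueSigma fun i : Fin 1 => Fin (A.ar (p.arg (m.one.perm p.head i)))))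
    (fun p => by
      have h := congrFun (congrArg Hom.toFun m.one_mul)
        { head := p.head
          arg := fun i : Fin 1 => A.out (p.arg (m.one.perm p.head i))
          typed := fun i => (p.typed _).trans (m.one.inp_eq p.head i) }
      refine h.symm.trans (congrArg m.mul.toFun (comp_eq _ _ rfl fun i => ?_))
      exact congrArg (fun j => A.out (p.arg j)) (Equiv.apply_symm_apply (m.one.perm p.head) i))
    (fun p k =>
      (odot_inp m (odotUnit m) A p (Sum.inr ⟨m.one.perm p.head (0 : Fin 1), k⟩)).symm)

/-- `ρ^⊙ : A → A ⊙ I_⊙`, `a ↦ ⟨a, 1, …, 1⟩`. -/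
def odotRightUnitor (m : MonStr S) (A : Sig S.Sym) : VHom A (odot m A (odotUnit m)) :=
  Hom.ofSymm
    (fun a =>
      { head := a
        arg := fun i => S.inp (A.out a) i
        typed := fun i => m.one.out_eq _ })
    (fun a =>
      haveI : IsEmpty (Σ _ : Fin (S.ar (A.out a)), Fin 0) := ⟨fun q => q.2.elim0⟩
      (Equiv.sumEmpty (Fin (A.ar a)) (Σ _ : Fin (S.ar (A.out a)), Fin 0)).symm.trans
      (hidx _ _))
    (fun a => congrFun (congrArg Hom.toFun m.mul_one) (A.out a))
    (fun a k => by
      obtain ⟨x, rfl⟩ := (hidx _ _).surjective k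
      rcases x with x | ⟨_, j⟩
      · refine (odot_inp m A (odotUnit m) _ (Sum.inl x)).trans ?_
        rw [Equiv.symm_trans_apply, Equiv.symm_apply_apply]
        rfl
      · exact Fin.elim0 j)

/-- The part `⟨a, b_i⟩` of `⟨a, ⟨b_i, c_{i,j}⟩⟩`. -/
abbrev assocHead (m : MonStr S) {A B C : Sig S.Sym} (p : Comp (hor A) (hor (odot m B C))) :
    Comp (hor A) (hor B) where
  head := p.head
  arg := fun i => (p.arg i).head
  typed := fun i => (m.mul.out_eq (outComp (p.arg i))).symm.trans (p.typed i)

/-- The map `γ⁻¹`, in double index notation, where `γ` is the amalgamation permutation of the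
multiplication at `⟨out a, out b_i⟩`. -/
def assocIdx (m : MonStr S) {A B C : Sig S.Sym} (p : Comp (hor A) (hor (odot m B C))) :
    Fin (S.ar (m.mul.toFun (outComp (assocHead m p)))) ≃
      (Σ i, Fin (S.ar (B.out (p.arg i).head))) :=
  (m.mul.perm (outComp (assocHead m p))).symm.trans finSigmaFinEquiv.symm

/-- `α^⊙ : A ⊙ (B ⊙ C) → (A ⊙ B) ⊙ C`, sending `⟨a, ⟨b_i, c_{i,j}⟩⟩` to
`⟨⟨a, b_i⟩, c_{γ⁻¹(i,j)}⟩`, and the block of vertical inputs of every symbol to the block of the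
same symbol. -/
def odotAssoc (m : MonStr S) (A B C : Sig S.Sym) :
    VHom (odot m A (odot m B C)) (odot m (odot m A B) C) :=
  Hom.ofPos
    (fun p =>
      { head := assocHead m p
        arg := fun k => (p.arg (assocIdx m p k).1).arg (assocIdx m p k).2
        typed := fun k => by
          have h := m.mul.inp_eq (outComp (assocHead m p))
            ((m.mul.perm (outComp (assocHead m p))).symm k)
          rw [Equiv.apply_symm_apply] at h
          exact ((p.arg _).typed _).trans h.symm })
    (fun _ => (Equiv.sumCongr (Equiv.refl _)
      (Equiv.sigmaCongrRight fun _ => hidx _ _)).trans (hidx _ _))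
    (fun _ => (Equiv.sumCongr (hidx _ _) (Equiv.refl _)).trans (hidx _ _))
    (fun p =>
      (Equiv.sumCongr (Equiv.refl _) <|
        (Equiv.sigmaSumDistrib (fun i => Fin (B.ar (p.arg i).head))
          (fun i => Σ j, Fin (C.ar ((p.arg i).arg j)))).trans <|
        Equiv.sumCongr (Equiv.refl _) <|
        (Equiv.sigmaAssoc fun i j => Fin (C.ar ((p.arg i).arg j))).symm.trans
        (Equiv.sigmaCongrLeft
          (β := fun q : (Σ i, Fin (S.ar (B.out (p.arg i).head))) =>
            Fin (C.ar ((p.arg q.1).arg q.2))) (assocIdx m p)).symm).trans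
      (Equiv.sumAssoc _ _ _).symm)
    (fun p =>
      congrFun (congrArg Hom.toFun m.assoc)
        { head := A.out p.head
          arg := fun i => outComp (p.arg i)
          typed := (assocHead m p).typed })
    (fun p x => by
      refine (odot_inp m (odot m A B) C _ _).trans (Eq.trans ?_ (odot_inp m A (odot m B C) p _).symm)
      rcases x with (x | ⟨i, j⟩) | ⟨k, l⟩
      · exact odot_inp m A B (assocHead m p) (Sum.inl x)
      · exact (odot_inp m A B (assocHead m p) (Sum.inr ⟨i, j⟩)).trans
          (odot_inp m B C (p.arg i) (Sum.inl j)).symm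
      · exact (odot_inp m B C (p.arg (assocIdx m p k).1)
          (Sum.inr ⟨(assocIdx m p k).2, l⟩)).symm)

/-! ### Distributivity of `⊗` over `⊙` -/

/-- The family `x_{0,j}, x_{i,j}` in `⟨⟨a, x_{0,j}⟩, ⟨b_i, x_{i,j}⟩⟩`. -/
def distribArg {A B X : Sig S.Sym} (p : Comp (hor (tensor A X)) (hor (tensor B X))) :
    Fin (A.ar p.head.head) ⊕ (Σ i, Fin (B.ar (p.arg i).head)) → X.Sym :=
  Sum.elim p.head.arg (fun q => (p.arg q.1).arg q.2)

/-- The vertical inputs of `⟨⟨a, x_{0,j}⟩, ⟨b_i, x_{i,j}⟩⟩`, as inputs of that family. -/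
def distribPos {A B X : Sig S.Sym} (p : Comp (hor (tensor A X)) (hor (tensor B X))) :
    (Σ j, Fin (X.ar (p.head.arg j))) ⊕ (Σ i, Σ j, Fin (X.ar ((p.arg i).arg j))) ≃
      (Σ x, Fin (X.ar (distribArg p x))) :=
  (Equiv.sumCongr (Equiv.refl _)
    (Equiv.sigmaAssoc fun i j => Fin (X.ar ((p.arg i).arg j))).symm).trans
  (Equiv.sumSigmaDistrib fun x => Fin (X.ar (distribArg p x))).symm

/-- `φ : (A ⊗ X) ⊙ (B ⊗ X) → (A ⊙ B) ⊗ X`, sending `⟨⟨a, x_{0,j}⟩, ⟨b_i, x_{i,j}⟩⟩` to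
`⟨⟨a, b_i⟩, x_{0,1}, …, x_{k,l_k}⟩`. The permutation preserves the order of the symbols `x_{i,j}`,
so it is the identity. -/
def distrib (m : MonStr S) (A B X : Sig S.Sym) :
    VHom (odot m (tensor A X) (tensor B X)) (tensor (odot m A B) X) :=
  Hom.ofPos
    (fun p =>
      { head :=
          { head := p.head.head
            arg := fun i => (p.arg i).head
            typed := p.typed }
        arg := fun k => distribArg p ((hidx _ _).symm k)
        typed := fun k => by
          obtain ⟨x, rfl⟩ := (hidx _ _).surjective k
          rw [Equiv.symm_apply_apply]
          refine Eq.trans ?_ (odot_inp m A B _ x).symm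
          rcases x with x | ⟨i, j⟩
          · exact p.head.typed x
          · exact (p.arg i).typed j })
    (fun _ => (Equiv.sumCongr finSigmaFinEquiv
      (Equiv.sigmaCongrRight fun _ => finSigmaFinEquiv)).trans (hidx _ _))
    (fun _ => finSigmaFinEquiv)
    (fun p => (distribPos p).trans
      (Equiv.sigmaCongrLeft (β := fun x => Fin (X.ar (distribArg p x))) (hidx _ _).symm).symm)
    (fun _ => rfl)
    (fun p x => by
      have key : ∀ y : (Σ x, Fin (X.ar (distribArg p x))),
          X.inp (distribArg p y.1) y.2 =
            (odot m (tensor A X) (tensor B X)).inp p (hidx _ _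
              (Sum.map finSigmaFinEquiv (Sigma.map id fun _ => finSigmaFinEquiv)
                ((distribPos p).symm y))) := by
        rintro ⟨y | ⟨i, j⟩, l⟩
        · exact ((odot_inp m (tensor A X) (tensor B X) p (Sum.inl (finSigmaFinEquiv ⟨y, l⟩))).trans
            (tensor_inp A X p.head ⟨y, l⟩)).symm
        · exact ((odot_inp m (tensor A X) (tensor B X) p
            (Sum.inr ⟨i, finSigmaFinEquiv ⟨j, l⟩⟩)).trans
            (tensor_inp B X (p.arg i) ⟨j, l⟩)).symm
      exact (tensor_inp (odot m A B) X _ x).trans (key ⟨(hidx _ _).symm x.1, x.2⟩))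

/-! ### Monoids for `⊙` and web monoids -/

/-- A `⊙`-monoid structure on `A`. -/
structure HMonStr (m : MonStr S) (A : Sig S.Sym) where
  mul : VHom (odot m A A) A
  one : VHom (odotUnit m) A
  one_mul : mul.comp (odotHom m one (Hom.ident A)) = odotLeftUnitor m A
  mul_one : (mul.comp (odotHom m (Hom.ident A) one)).comp (odotRightUnitor m A) = Hom.ident A
  assoc : (mul.comp (odotHom m mul (Hom.ident A))).comp (odotAssoc m A A A) =
    mul.comp (odotHom m (Hom.ident A) mul)

/-- Homomorphisms of `⊙`-monoids in the fibre. -/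
structure IsHMonHom (m : MonStr S) {A B : Sig S.Sym} (a : HMonStr m A) (b : HMonStr m B)
    (f : VHom A B) : Prop where
  mul : f.comp a.mul = b.mul.comp (odotHom m f f)
  one : f.comp a.one = b.one

/-- `(F, h)` is the free `⊙`-monoid on `X`, with universal morphism `η`. -/
def IsFreeHMon (m : MonStr S) {X F : Sig S.Sym} (h : HMonStr m F) (η : VHom X F) : Prop :=
  ∀ (B : Sig S.Sym) (b : HMonStr m B) (f : VHom X B),
    ∃! g : VHom F B, IsHMonHom m h b g ∧ g.comp η = f

/-- A web monoid of `m`: a free `⊙`-monoid `F` on the unit `I_⊗`, with a `⊗`-monoid structure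
whose unit is the universal morphism `I_⊗ → F` and whose multiplication `ν` makes the main diagram
`μ ∘ (ν ⊙ ν) = ν ∘ (μ ⊗ 1) ∘ φ` commute, where `μ` is the free multiplication. -/
structure WebMonoid (m : MonStr S) where
  F : Sig S.Sym
  free : HMonStr m F
  web : MonStr F
  isFree : IsFreeHMon m free web.one
  main : free.mul.comp (odotHom m web.mul web.mul) =
    (web.mul.comp (tensorHom free.mul (Hom.ident F))).comp (distrib m F F F)

end Odot

/-! ### Opetopic sets -/

/-- An opetopic set. The pasting diagram monoid `S_0` is a prone lift of the one-symbol monoid over a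
one-point set, and `S_{n+1}` is a prone lift of the web monoid of `S_n` along `ϑ_n`. -/
structure OpetopicSet where
  X : ℕ → Type
  typ : ∀ n, X (n + 1) → Dagger (X n)
  S : ∀ n, Sig (X n)
  mon : ∀ n, MonStr (S n)
  cell : ∀ n, VHom (⟨X (n + 1), typ n⟩ : Sig (X n)) (S n)
  cell_strict : ∀ n, (cell n).Strict
  W : ∀ n, WebMonoid (mon n)
  base : Hom (fun _ : X 0 => ()) (S 0) (unit Unit)
  base_prone : IsProne (mon 0) (unitMon Unit) base
  step : ∀ n, Hom ((cell n).toFun : X (n + 1) → (S n).Sym) (S (n + 1)) (W n).F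
  step_prone : ∀ n, IsProne (mon (n + 1)) (W n).web (step n)

/-! ### The example -/

inductive Shape
  | circle
  | square
  | triangle

/-- One binary symbol, and two unary symbols `x → x` for every type `x`, the second of which is
to be thought of as the identity. -/
inductive ExSym
  | binary
  | unary (x : Shape)
  | identity (x : Shape)

/-- The signature of the example. The binary symbol has output type `d 0` and input types
`d 1`, `d 2`. -/
def exSig (d : Fin 3 → Shape) : Sig Shape where
  Sym := ExSym
  typ := fun
    | .binary => { ar := 2, out := d 0, inp := fun i => d i.succ }
    | .unary x => { ar := 1, out := x, inp := fun _ => x }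
    | .identity x => { ar := 1, out := x, inp := fun _ => x }

end Web

/-! Existence. Symbols of `A` with inputs labelled in a set `Y` over the types form a functor of
`Y`. A morphism in a fibre is the same thing as a natural map of labelled symbols that preserves
output types and the multiset of labels (`VHom.ext_lab`, `exists_hom_lab`). In this language `⊗` is
composition of functors and a monoid is a monad. A `⊙`-monoid is a natural family of "operads": sets
over the symbols of `M` with horizontal composition. The amalgamation permutations disappear from
the calculations, being absorbed into the monad multiplication `mulT`. The free operad on `Y`
consists of trees with nodes labelled in `Y`, composed by grafting. It is natural in `Y`, so it
comes from a `⊙`-monoid, which is free on `I_⊗`. The web multiplication flattens trees of trees: it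
is the extension of the identity to an operad homomorphism. Its laws follow from uniqueness of
extensions, and the main diagram says that flattening is a homomorphism.

Obstruction. Let `b` be a symbol of `M` with two inputs `x`, `y` and output `z`, all three distinct.
In a web monoid take the generator of type `b` and compose it horizontally, at the place `c = x, y,
z`, with the generator of type `e c`. The result `t_c` has output type `b` and inputs `b`, `e c`.
Insertions at different places commute, so substituting `t_c` for `b` in `t_d` gives the same as
substituting `t_d` for `b` in `t_c`. Now let `f` be a homomorphism to a monoid with standard
amalgamation and compare the orders of the inputs in the images under `f`. If `b` were the first
input of both `t_c` and `t_d`, one substitution would put `e c` before `e d` and the other `e d`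
before `e c`; likewise if `b` were the last input of both. But `b` has only two possible places in
three symbols (`WebMonoid.not_isMonHom_of_standard`).

Examples. The signature of the first part becomes a monoid when a composite is given the maximal
rank of its components. Distinctness of the types of `b` forces every multiplication to be strict.
For the second part let `S_0` be the category with exactly one morphism between any two of three
objects, and let all pasting diagrams be cells. Then `S_1 = W(S_0)` contains a path of length two,
which is a binary symbol with three distinct types, so the obstruction applies to `S_2 = W(S_1)`. -/

namespace Web

/-! ### Labelled symbols -/

/-- Symbols of `A` with inputs labelled by elements of a set `Y` over the set of types. -/
structure Lab {O Y : Type} (A : Sig O) (τ : Y → O) where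
  head : A.Sym
  arg : Fin (A.ar head) → Y
  typed : ∀ i, τ (arg i) = A.inp head i

namespace Lab

variable {O Y Z : Type} {A B C : Sig O} {τ : Y → O} {σ : Z → O}

theorem ext {p q : Lab A τ} (h : p.head = q.head)
    (h' : ∀ i, p.arg i = q.arg (finCongr (congrArg A.ar h) i)) : p = q := by
  obtain ⟨a, b, t⟩ := p
  obtain ⟨a', b', t'⟩ := q
  obtain rfl : a = a' := h
  obtain rfl : b = b' := funext h'
  rfl

/-- The output type of a labelled symbol. -/
abbrev out (p : Lab A τ) : O := A.out p.head

/-- Change of labels. -/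
def map (g : Y → Z) (hg : ∀ y, σ (g y) = τ y) (p : Lab A τ) : Lab A σ where
  head := p.head
  arg := fun i => g (p.arg i)
  typed := fun i => (hg _).trans (p.typed i)

theorem map_id {g : Y → Y} (h : ∀ y, g y = y) (hg : ∀ y, τ (g y) = τ y) (p : Lab A τ) :
    p.map g hg = p := ext rfl fun i => h (p.arg i)

/-- The sum of the weights of the labels. -/
def sum (w : Y → ℕ) (p : Lab A τ) : ℕ := ∑ i, w (p.arg i)

theorem sum_map (g : Y → Z) (hg : ∀ y, σ (g y) = τ y) (w : Z → ℕ) (p : Lab A τ) :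
    (p.map g hg).sum w = p.sum fun y => w (g y) := rfl

/-- The symbol `a`, every input being its own label. -/
def gen (A : Sig O) (a : A.Sym) : Lab A (A.inp a) := ⟨a, id, fun _ => rfl⟩

end Lab

section

variable {O Y Z : Type} {A B C : Sig O} {τ : Y → O} {σ : Z → O}

/-- The action of a morphism on labelled symbols. -/
def Hom.lab (f : VHom A B) (p : Lab A τ) : Lab B τ where
  head := f.toFun p.head
  arg := fun k => p.arg ((f.perm p.head).symm k)
  typed := fun k => (p.typed _).trans (f.inp_symm p.head k).symm

theorem Hom.lab_out (f : VHom A B) (p : Lab A τ) : (f.lab p).out = p.out := f.out_eq _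

theorem Hom.lab_map (f : VHom A B) (g : Y → Z) (hg : ∀ y, σ (g y) = τ y) (p : Lab A τ) :
    f.lab (p.map g hg) = (f.lab p).map g hg := rfl

theorem Hom.lab_sum (f : VHom A B) (w : Y → ℕ) (p : Lab A τ) : (f.lab p).sum w = p.sum w :=
  Equiv.sum_comp (f.perm p.head).symm fun i => w (p.arg i)

theorem VHom.comp_lab (g : VHom B C) (f : VHom A B) (p : Lab A τ) :
    (VHom.comp g f).lab p = g.lab (f.lab p) := rfl

theorem ident_lab (p : Lab A τ) : (Hom.ident A).lab p = p := rfl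

/-- As in the Yoneda lemma, the generic labelled symbol `Lab.gen A a` detects everything: the head
of its image is the value at `a`, and the labels of the image list the inverse permutation. -/
theorem VHom.ext_lab {f g : VHom A B}
    (h : ∀ (Y : Type) (τ : Y → O) (p : Lab A τ), f.lab p = g.lab p) : f = g := by
  obtain ⟨f, s, hf, hf'⟩ := f
  obtain ⟨g, t, hg, hg'⟩ := g
  obtain rfl : f = g := funext fun a => congrArg Lab.head (h _ _ (Lab.gen A a))
  obtain rfl : s = t := by
    funext a
    have h1 := h _ _ (Lab.gen A a)
    have h2 : (fun k => (s a).symm k) = fun k => (t a).symm k := by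
      simp only [Hom.lab, Lab.gen, Lab.mk.injEq, heq_eq_eq, true_and] at h1
      exact h1
    have h3 : (s a).symm = (t a).symm := Equiv.ext fun k => congrFun h2 k
    rw [← Equiv.symm_symm (s a), h3, Equiv.symm_symm]
  rfl

/-- The indicator function of `j`, taken as weight, counts the fibre of `l` over `j`. -/
theorem bijective_of_sum {k n : ℕ} (l : Fin k → Fin n)
    (h : ∀ w : Fin n → ℕ, ∑ i, w (l i) = ∑ j, w j) : Function.Bijective l := by
  have key : ∀ j, (Finset.univ.filter fun i => l i = j).card = 1 := fun j => by
    have := h fun x => if x = j then 1 else 0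
    simpa using this
  refine ⟨fun a b hab => ?_, fun j => ?_⟩
  · exact Finset.card_le_one.1 (key (l b)).le a (by simp [hab]) b (by simp)
  · obtain ⟨i, hi⟩ := Finset.card_pos.1 (by rw [key j]; exact one_pos)
    exact ⟨i, by simpa using hi⟩

/-- A natural family of maps of labelled symbols that preserves output types and the multiset of
the labels comes from a morphism. -/
theorem exists_hom_lab (θ : ∀ (Y : Type) (τ : Y → O), Lab A τ → Lab B τ)
    (out : ∀ (Y : Type) (τ : Y → O) (p : Lab A τ), (θ Y τ p).out = p.out)
    (nat : ∀ (Y Z : Type) (τ : Y → O) (σ : Z → O) (g : Y → Z) (hg : ∀ y, σ (g y) = τ y)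
      (p : Lab A τ), θ Z σ (p.map g hg) = (θ Y τ p).map g hg)
    (sum : ∀ (Y : Type) (τ : Y → O) (p : Lab A τ) (w : Y → ℕ), (θ Y τ p).sum w = p.sum w) :
    ∃ f : VHom A B, ∀ (Y : Type) (τ : Y → O) (p : Lab A τ), f.lab p = θ Y τ p := by
  have hb : ∀ a, Function.Bijective (θ _ _ (Lab.gen A a)).arg := fun a =>
    bijective_of_sum _ fun w => sum _ _ (Lab.gen A a) w
  refine ⟨Hom.ofSymm (fun a => (θ _ _ (Lab.gen A a)).head)
    (fun a => (Equiv.ofBijective _ (hb a)).symm) (fun a => out _ _ (Lab.gen A a))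
    (fun a k => ((θ _ _ (Lab.gen A a)).typed k).symm), fun Y τ p => ?_⟩
  -- Every labelled symbol is a relabelling of a generic one, so naturality determines `θ` from its
  -- values there.
  exact (nat _ _ _ τ p.arg p.typed (Lab.gen A p.head)).symm

theorem conj_symm_apply {P P' Q Q' : Type} (e : P ≃ Q) (θ : P ≃ P') (e' : P' ≃ Q') (x : P') :
    (e.symm.trans (θ.trans e')).symm (e' x) = e (θ.symm x) := by
  simp

theorem sigma_fin_eq {α : Type} (β : α → ℕ) {a b : α} (h : a = b) (k : Fin (β a)) :
    (⟨a, k⟩ : Σ a, Fin (β a)) = ⟨b, finCongr (congrArg β h) k⟩ := by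
  subst h; rfl

/-! ### The tensor product on labelled symbols -/

/-- Labelled symbols of `A ⊗ B` are symbols of `A` labelled by labelled symbols of `B`. -/
def tensorLab : Lab (tensor A B) τ ≃ Lab A (Lab.out : Lab B τ → O) where
  toFun p :=
    { head := p.head.head
      arg := fun i =>
        { head := p.head.arg i
          arg := fun j => p.arg (finSigmaFinEquiv ⟨i, j⟩)
          typed := fun j => (p.typed _).trans (tensor_inp A B p.head ⟨i, j⟩) }
      typed := p.head.typed }
  invFun q :=
    { head := ⟨q.head, fun i => (q.arg i).head, q.typed⟩
      arg := fun k => (q.arg (finSigmaFinEquiv.symm k).1).arg (finSigmaFinEquiv.symm k).2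
      typed := fun k => (q.arg _).typed _ }
  left_inv p := Lab.ext rfl fun i => congrArg p.arg (Equiv.apply_symm_apply finSigmaFinEquiv i)
  right_inv q := by
    refine Lab.ext rfl fun i => Lab.ext rfl fun j => ?_
    exact congrArg (fun r : (Σ i, Fin (B.ar (q.arg i).head)) => (q.arg r.1).arg r.2)
      (Equiv.symm_apply_apply finSigmaFinEquiv ⟨i, j⟩)

theorem tensorLab_sum (w : Y → ℕ) (p : Lab (tensor A B) τ) :
    (tensorLab p).sum (Lab.sum w) = p.sum w := by
  unfold Lab.sum
  rw [← Equiv.sum_comp finSigmaFinEquiv, Fintype.sum_sigma]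
  rfl

/-- Under `tensorLab`, `f ⊗ g` becomes the horizontal composite of natural transformations, and the
coherence isomorphisms treated below become the canonical ones for composition of functors. -/
theorem tensorHom_lab {A' B' : Sig O} (f : VHom A A') (g : VHom B B') (p : Lab (tensor A B) τ) :
    tensorLab (Hom.lab (tensorHom f g) p) = f.lab ((tensorLab p).map g.lab g.lab_out) := by
  refine Lab.ext rfl fun k => Lab.ext rfl fun j => ?_
  exact congrArg p.arg (conj_symm_apply finSigmaFinEquiv (block (f.perm p.head.head)
    (fun i => B.ar (p.head.arg i)) _ fun k => g.perm (p.head.arg ((f.perm p.head.head).symm k)))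
    finSigmaFinEquiv ⟨k, j⟩)

theorem assocHom_lab (p : Lab (tensor A (tensor B C)) τ) :
    tensorLab (tensorLab ((assocHom A B C).lab p)) =
      (tensorLab p).map tensorLab (fun _ => rfl) := by
  refine Lab.ext rfl fun i => Lab.ext rfl fun j => Lab.ext ?_ fun k => ?_
  · exact congrArg (fun r : (Σ i, Fin (B.ar (p.head.arg i).head)) => (p.head.arg r.1).arg r.2)
      (Equiv.symm_apply_apply finSigmaFinEquiv ⟨i, j⟩)
  · refine congrArg p.arg ((conj_symm_apply finSigmaFinEquiv
      ((Equiv.sigmaCongrRight fun _ => finSigmaFinEquiv.symm).trans <|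
      (Equiv.sigmaAssoc fun i j => Fin (C.ar ((p.head.arg i).arg j))).symm.trans
      (Equiv.sigmaCongrLeft
        (β := fun q : (Σ i, Fin (B.ar (p.head.arg i).head)) => Fin (C.ar ((p.head.arg q.1).arg q.2)))
        finSigmaFinEquiv.symm).symm) finSigmaFinEquiv ⟨finSigmaFinEquiv ⟨i, j⟩, k⟩).trans ?_)
    exact congrArg (fun r : (Σ q : (Σ i, Fin (B.ar (p.head.arg i).head)),
        Fin (C.ar ((p.head.arg q.1).arg q.2))) =>
          (finSigmaFinEquiv ⟨r.1.1, finSigmaFinEquiv ⟨r.1.2, r.2⟩⟩ :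
            Fin ((tensor A (tensor B C)).ar p.head)))
      (sigma_fin_eq (fun q : (Σ i, Fin (B.ar (p.head.arg i).head)) =>
        C.ar ((p.head.arg q.1).arg q.2)) (Equiv.symm_apply_apply finSigmaFinEquiv
          (⟨i, j⟩ : Σ i, Fin (B.ar (p.head.arg i).head))) k)

theorem leftUnitor_lab (p : Lab (tensor (unit O) A) τ) :
    (leftUnitor A).lab p = (tensorLab p).arg (0 : Fin 1) := by
  refine Lab.ext rfl fun k => ?_
  rfl

theorem rightUnitor_lab (p : Lab A τ) :
    tensorLab ((rightUnitor A).lab p) =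
      p.map (fun y => (⟨τ y, fun _ => y, fun _ => rfl⟩ : Lab (unit O) τ)) (fun _ => rfl) := by
  refine Lab.ext rfl fun i => Lab.ext ?_ fun j => ?_
  · exact (p.typed i).symm
  · exact congrArg p.arg ((conj_symm_apply (Equiv.refl _)
      (Equiv.sigmaUnique (Fin (A.ar p.head)) fun _ => Fin 1).symm finSigmaFinEquiv ⟨i, j⟩))

end

/-! ### The monad of a monoid -/

section Monad

variable {O Y Z : Type} {S : Sig O} (m : MonStr S) {τ : Y → O} {σ : Z → O}

/-- The multiplication of the monoid on labelled symbols. -/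
def mulT (q : Lab S (Lab.out : Lab S τ → O)) : Lab S τ := m.mul.lab (tensorLab.symm q)

/-- The unit of the monoid on labelled symbols. -/
def unitT (τ : Y → O) (y : Y) : Lab S τ := m.one.lab ⟨τ y, fun _ => y, fun _ => rfl⟩

theorem mulT_out (q : Lab S (Lab.out : Lab S τ → O)) : (mulT m q).out = q.out := m.mul.out_eq _

theorem unitT_out (y : Y) : (unitT m τ y).out = τ y := m.one.out_eq _

theorem mulT_sum (w : Y → ℕ) (q : Lab S (Lab.out : Lab S τ → O)) :
    (mulT m q).sum w = q.sum (Lab.sum w) := by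
  rw [mulT, Hom.lab_sum, ← tensorLab_sum, Equiv.apply_symm_apply]

theorem unitT_sum (w : Y → ℕ) (y : Y) : (unitT m τ y).sum w = w y := by
  rw [unitT, Hom.lab_sum]
  exact Fin.sum_univ_one _

theorem unitT_map (g : Y → Z) (hg : ∀ y, σ (g y) = τ y) (y : Y) :
    (unitT m τ y).map g hg = unitT m σ (g y) := by
  have : (⟨τ y, fun _ => g y, fun _ => hg y⟩ : Lab (unit O) σ) =
      ⟨σ (g y), fun _ => g y, fun _ => rfl⟩ := Lab.ext (hg y).symm fun _ => rfl
  exact congrArg m.one.lab this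

theorem mulT_unitT (q : Lab S τ) : mulT m (unitT m Lab.out q) = q := by
  let x : Lab (unit O) (Lab.out : Lab S τ → O) := ⟨q.out, fun _ => q, fun _ => rfl⟩
  have h := congrArg (fun f => Hom.lab f (tensorLab.symm x)) m.one_mul
  simp only [VHom.comp_lab, leftUnitor_lab] at h
  replace h := h.trans (congrArg (fun y : Lab (unit O) (Lab.out : Lab S τ → O) =>
    y.arg (0 : Fin 1)) (Equiv.apply_symm_apply tensorLab x))
  refine Eq.trans ?_ h
  refine congrArg m.mul.lab ?_
  rw [Equiv.symm_apply_eq, tensorHom_lab, Equiv.apply_symm_apply]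
  rfl

theorem mulT_map_unitT (q : Lab S τ) : mulT m (q.map (unitT m τ) (unitT_out m)) = q := by
  have h := congrArg (fun f => Hom.lab f q) m.mul_one
  simp only [VHom.comp_lab, ident_lab] at h
  refine Eq.trans (congrArg m.mul.lab ?_) h
  rw [Equiv.symm_apply_eq, tensorHom_lab, rightUnitor_lab]
  rfl

/-- Associativity of the monoid, evaluated at a labelled symbol of the triple tensor product, is
associativity of the monad. -/
theorem mulT_assoc (q : Lab S (Lab.out : Lab S (Lab.out : Lab S τ → O) → O)) :
    mulT m (mulT m q) = mulT m (q.map (mulT m) (mulT_out m)) := by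
  have h := congrArg (fun f => Hom.lab f (tensorLab.symm (q.map tensorLab.symm (fun _ => rfl))))
    m.assoc
  simp only [VHom.comp_lab] at h
  refine Eq.trans (congrArg m.mul.lab ?_) (h.trans (congrArg m.mul.lab ?_))
  · rw [Equiv.symm_apply_eq, tensorHom_lab]
    refine congrArg m.mul.lab ?_
    rw [Equiv.symm_apply_eq]
    refine Eq.trans ?_ (assocHom_lab _).symm
    rw [Equiv.apply_symm_apply]
    exact (Lab.map_id (fun y => Equiv.apply_symm_apply tensorLab y) (fun _ => rfl) q).symm
  · rw [Equiv.eq_symm_apply, tensorHom_lab, Equiv.apply_symm_apply]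
    rfl

end Monad

/-! ### Horizontal composites -/

section OD

variable {O : Type} {S : Sig O}

/-- Pairs of an element `b` of `B` and a family of elements of `C` that is indexed by the inputs of
the output type of `b` and has the corresponding output types. -/
structure OD {B C : Type} (outB : B → S.Sym) (outC : C → S.Sym) where
  fst : B
  snd : Lab S fun c => S.out (outC c)
  eq : snd.head = outB fst

namespace OD

variable {B C D B' C' : Type} {outB : B → S.Sym} {outC : C → S.Sym} {outD : D → S.Sym}
  {outB' : B' → S.Sym} {outC' : C' → S.Sym}

/-- The head of `snd` is tied to `fst` by a proposition, not by its type, so equality of composites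
is componentwise and needs no transport. -/
theorem ext {p q : OD outB outC} (h : p.fst = q.fst) (h' : p.snd = q.snd) : p = q := by
  obtain ⟨a, b, t⟩ := p
  obtain ⟨a', b', t'⟩ := q
  obtain rfl : a = a' := h
  obtain rfl : b = b' := h'
  rfl

theorem typed_cast (q : OD outB outC) (i : Fin (S.ar (outB q.fst))) :
    S.out (outC (q.snd.arg (Fin.cast (congrArg S.ar q.eq.symm) i))) = S.inp (outB q.fst) i := by
  obtain ⟨z, ⟨h, arg, ty⟩, e⟩ := q
  cases e
  exact ty i

/-- The output type of a composite. -/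
def out (m : MonStr S) (q : OD outB outC) : S.Sym :=
  m.mul.toFun ⟨q.snd.head, fun i => outC (q.snd.arg i), q.snd.typed⟩

theorem snd_out (m : MonStr S) (q : OD outB outC) : q.snd.out = S.out (q.out m) :=
  (m.mul.out_eq ⟨q.snd.head, fun i => outC (q.snd.arg i), q.snd.typed⟩).symm

theorem out_out (m : MonStr S) (q : OD outB outC) : S.out (q.out m) = S.out (outB q.fst) :=
  (m.mul.out_eq _).trans (congrArg S.out q.eq)

def map (f : B → B') (hf : ∀ b, outB' (f b) = outB b) (g : C → C') (hg : ∀ c, outC' (g c) = outC c)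
    (q : OD outB outC) : OD outB' outC' where
  fst := f q.fst
  snd := q.snd.map g fun c => congrArg S.out (hg c)
  eq := q.eq.trans (hf _).symm

theorem out_map (m : MonStr S) (f : B → B') (hf : ∀ b, outB' (f b) = outB b) (g : C → C')
    (hg : ∀ c, outC' (g c) = outC c) (q : OD outB outC) : (q.map f hf g hg).out m = q.out m :=
  congrArg m.mul.toFun (comp_eq _ _ rfl fun _ => hg _)

/-- Reassociation of triple composites. -/
def assoc (m : MonStr S) (q : OD outB (out m : OD outC outD → S.Sym)) :
    OD (out m : OD outB outC → S.Sym) outD where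
  fst := ⟨q.fst, q.snd.map fst fun c => (out_out m c).symm, q.eq⟩
  snd := mulT m (q.snd.map snd fun c => c.snd_out m)
  eq := congrArg m.mul.toFun (comp_eq _ _ rfl fun i => (q.snd.arg i).eq)

end OD

end OD

/-! ### The second tensor product on labelled symbols -/

section OdotLab

variable {O Y Z : Type} {S : Sig O} (m : MonStr S) {A B C A' B' : Sig S.Sym}
  {τ : Y → S.Sym} {σ : Z → S.Sym}

/-- The composite of a labelled symbol of `A` with labelled symbols of `B`. -/
def odotJoin (z : Lab A τ) (arg : Fin (S.ar z.out) → Lab B τ)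
    (ty : ∀ i, S.out (arg i).out = S.inp z.out i) : Lab (odot m A B) τ where
  head := ⟨z.head, fun i => (arg i).head, ty⟩
  arg := fun k => Sum.elim z.arg
    (fun q : (Σ i, Fin (B.ar (arg i).head)) => (arg q.1).arg q.2) ((hidx _ _).symm k)
  typed := fun k => by
    obtain ⟨x, rfl⟩ := (hidx _ _).surjective k
    refine Eq.trans ?_ (odot_inp m A B _ _).symm
    rw [Equiv.symm_apply_apply]
    rcases x with x | x
    · exact z.typed x
    · exact (arg _).typed x.2

/-- The parts of a labelled symbol of `A ⊙ B`. -/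
def odotSplit (p : Lab (odot m A B) τ) :
    OD (Lab.out : Lab A τ → S.Sym) (Lab.out : Lab B τ → S.Sym) where
  fst :=
    { head := p.head.head
      arg := fun i => p.arg (hidx _ _ (Sum.inl i))
      typed := fun i => (p.typed _).trans (odot_inp m A B p.head (Sum.inl i)) }
  snd :=
    { head := A.out p.head.head
      arg := fun i =>
        { head := p.head.arg i
          arg := fun j => p.arg (hidx _ _ (Sum.inr ⟨i, j⟩))
          typed := fun j => (p.typed _).trans (odot_inp m A B p.head (Sum.inr ⟨i, j⟩)) }
      typed := p.head.typed }
  eq := rfl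

theorem odotSplit_join (z : Lab A τ) (arg : Fin (S.ar z.out) → Lab B τ)
    (ty : ∀ i, S.out (arg i).out = S.inp z.out i) :
    odotSplit m (odotJoin m z arg ty) = ⟨z, ⟨z.out, arg, ty⟩, rfl⟩ := by
  refine OD.ext (Lab.ext rfl fun i => ?_) (Lab.ext rfl fun i => Lab.ext rfl fun j => ?_)
  · exact congrArg (Sum.elim z.arg
      (fun q : (Σ i, Fin (B.ar (arg i).head)) => (arg q.1).arg q.2))
      (Equiv.symm_apply_apply (hidx _ _) (Sum.inl i))
  · exact congrArg (Sum.elim z.arg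
      (fun q : (Σ i, Fin (B.ar (arg i).head)) => (arg q.1).arg q.2))
      (Equiv.symm_apply_apply (hidx _ _) (Sum.inr ⟨i, j⟩))

theorem odotJoin_split (p : Lab (odot m A B) τ) :
    odotJoin m (odotSplit m p).fst (odotSplit m p).snd.arg (odotSplit m p).snd.typed = p := by
  refine Lab.ext rfl fun k => ?_
  obtain ⟨x, rfl⟩ := (hidx _ _).surjective k
  refine Eq.trans (congrArg (Sum.elim (odotSplit m p).fst.arg
    (fun q : (Σ i, Fin (B.ar ((odotSplit m p).snd.arg i).head)) =>
      ((odotSplit m p).snd.arg q.1).arg q.2)) (Equiv.symm_apply_apply (hidx _ _) x)) ?_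
  rcases x with x | x <;> rfl

/-- Labelled symbols of `A ⊙ B` are composites of labelled symbols of `A` and `B`. -/
def odotLab : Lab (odot m A B) τ ≃ OD (Lab.out : Lab A τ → S.Sym) (Lab.out : Lab B τ → S.Sym) where
  toFun := odotSplit m
  invFun q := odotJoin m q.fst _ q.typed_cast
  left_inv p := odotJoin_split m p
  right_inv q := by
    obtain ⟨z, ⟨h, arg, ty⟩, e⟩ := q
    cases e
    exact odotSplit_join m z arg ty

theorem odotLab_out (p : Lab (odot m A B) τ) : (odotLab m p).out m = p.out := rfl

theorem odotLab_symm_out (q : OD (Lab.out : Lab A τ → S.Sym) (Lab.out : Lab B τ → S.Sym)) :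
    ((odotLab m).symm q).out = q.out m := by
  rw [← odotLab_out, Equiv.apply_symm_apply]

theorem odotLab_map (g : Y → Z) (hg : ∀ y, σ (g y) = τ y) (p : Lab (odot m A B) τ) :
    odotLab m (p.map g hg) =
      (odotLab m p).map (Lab.map g hg) (fun _ => rfl) (Lab.map g hg) (fun _ => rfl) := rfl

theorem odotLab_sum (w : Y → ℕ) (p : Lab (odot m A B) τ) :
    p.sum w = (odotLab m p).fst.sum w + (odotLab m p).snd.sum (Lab.sum w) := by
  unfold Lab.sum
  rw [← Equiv.sum_comp (hidx _ _), Fintype.sum_sum_type, Fintype.sum_sigma]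
  rfl

theorem odotHom_perm_symm (f : VHom A A') (g : VHom B B') (p : Comp (hor A) (hor B))
    (x : Fin (A'.ar (f.toFun p.head)) ⊕
      (Σ k, Fin (B'.ar (g.toFun (p.arg (((horHom f).perm p.head).symm k)))))) :
    ((odotHom m f g).perm p).symm (hidx _ _ x) =
      hidx _ _ (Sum.map (f.perm p.head).symm (fun q : (Σ k, Fin (B'.ar (g.toFun
        (p.arg (((horHom f).perm p.head).symm k))))) =>
          (⟨((horHom f).perm p.head).symm q.1, (g.perm _).symm q.2⟩ :
            Σ i, Fin (B.ar (p.arg i)))) x) := by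
  refine (conj_symm_apply (hidx _ _) (Equiv.sumCongr (f.perm p.head)
        (block ((horHom f).perm p.head) (fun i => B.ar (p.arg i))
          (fun k => B'.ar (g.toFun (p.arg (((horHom f).perm p.head).symm k))))
          (fun k => g.perm (p.arg (((horHom f).perm p.head).symm k))))) (hidx _ _) x).trans ?_
  rcases x with x | x <;> rfl

theorem odotHom_lab (f : VHom A A') (g : VHom B B') (p : Lab (odot m A B) τ) :
    odotLab m ((odotHom m f g).lab p) = (odotLab m p).map f.lab f.lab_out g.lab g.lab_out := by
  refine OD.ext (Lab.ext rfl fun i => ?_) (Lab.ext (f.out_eq _) fun i => Lab.ext rfl fun j => ?_)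
  · exact congrArg p.arg (odotHom_perm_symm m f g p.head (Sum.inl i))
  · exact congrArg p.arg (odotHom_perm_symm m f g p.head (Sum.inr ⟨i, j⟩))

theorem odotLeftUnitor_lab (z : Lab A τ) (q : Lab (odot m (odotUnit m) A) τ)
    (h : (odotLab m q).snd = unitT m (fun c : Lab A τ => S.out c.out) z) :
    (odotLeftUnitor m A).lab q = z := by
  have h1 : ∀ i, (odotLab m q).snd.arg i = z := by
    rw [h]
    exact fun _ => rfl
  refine Eq.trans ?_ (h1 (m.one.perm q.head.head (0 : Fin 1)))
  exact Lab.ext rfl fun k => rfl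

theorem odotRightUnitor_lab (z : Lab A τ) :
    odotLab m ((odotRightUnitor m A).lab z) =
      ⟨z, ⟨z.out, fun i => ⟨S.inp z.out i, Fin.elim0, fun i => i.elim0⟩,
        fun _ => m.one.out_eq _⟩, rfl⟩ := by
  refine OD.ext (Lab.ext rfl fun i => ?_) (Lab.ext rfl fun _ => Lab.ext rfl fun j => j.elim0)
  have : IsEmpty (Σ _ : Fin (S.ar z.out), Fin 0) := ⟨fun q => q.2.elim0⟩
  refine congrArg z.arg (conj_symm_apply (Equiv.refl _)
    (Equiv.sumEmpty (Fin (A.ar z.head)) (Σ _ : Fin (S.ar z.out), Fin 0)).symm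
    (hidx (A.ar z.head) fun _ : Fin (S.ar z.out) => 0) (Sum.inl i))

theorem odotAssoc_perm_symm (p : Comp (hor A) (hor (odot m B C)))
    (x : (Fin (A.ar p.head) ⊕ (Σ i, Fin (B.ar (p.arg i).head))) ⊕
      (Σ k, Fin (C.ar ((p.arg (assocIdx m p k).1).arg (assocIdx m p k).2)))) :
    ((odotAssoc m A B C).perm p).symm (hidx _ _ (Sum.map (hidx _ _) id x)) =
      hidx _ _ (Sum.elim (Sum.elim Sum.inl
        (fun q => Sum.inr ⟨q.1, hidx _ _ (Sum.inl q.2)⟩))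
        (fun q => Sum.inr ⟨(assocIdx m p q.1).1,
          hidx _ _ (Sum.inr ⟨(assocIdx m p q.1).2, q.2⟩)⟩) x) := by
  let θ := (Equiv.sumCongr (Equiv.refl (Fin (A.ar p.head))) <|
        (Equiv.sigmaSumDistrib (fun i => Fin (B.ar (p.arg i).head))
          (fun i => Σ j, Fin (C.ar ((p.arg i).arg j)))).trans <|
        Equiv.sumCongr (Equiv.refl _) <|
        (Equiv.sigmaAssoc fun i j => Fin (C.ar ((p.arg i).arg j))).symm.trans
        (Equiv.sigmaCongrLeft
          (β := fun q : (Σ i, Fin (S.ar (B.out (p.arg i).head))) =>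
            Fin (C.ar ((p.arg q.1).arg q.2))) (assocIdx m p)).symm).trans
      (Equiv.sumAssoc _ _ _).symm
  refine (conj_symm_apply ((Equiv.sumCongr (Equiv.refl _)
      (Equiv.sigmaCongrRight fun _ => hidx _ _)).trans (hidx _ _)) θ
      ((Equiv.sumCongr (hidx _ _) (Equiv.refl _)).trans (hidx _ _)) x).trans ?_
  rcases x with (x | x) | x <;> rfl

theorem distrib_perm_symm {X : Sig S.Sym} (p : Comp (hor (tensor A X)) (hor (tensor B X)))
    (x : Fin (A.ar p.head.head) ⊕ (Σ i, Fin (B.ar (p.arg i).head)))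
    (l : Fin (X.ar (distribArg p ((hidx _ _).symm (hidx _ _ x)))))
    (l' : Fin (X.ar (distribArg p x))) (h : (l : ℕ) = l') :
    ((distrib m A B X).perm p).symm (finSigmaFinEquiv ⟨hidx _ _ x, l⟩) =
      hidx _ _ (Sum.map finSigmaFinEquiv (Sigma.map id fun _ => finSigmaFinEquiv)
                ((distribPos p).symm ⟨x, l'⟩)) := by
  refine (conj_symm_apply ((Equiv.sumCongr finSigmaFinEquiv
      (Equiv.sigmaCongrRight fun _ => finSigmaFinEquiv)).trans (hidx _ _)) ((distribPos p).trans
      (Equiv.sigmaCongrLeft (β := fun x => Fin (X.ar (distribArg p x))) (hidx _ _).symm).symm)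
      finSigmaFinEquiv ⟨hidx _ _ x, l⟩).trans ?_
  have : (⟨(hidx _ _).symm (hidx _ _ x), l⟩ : Σ x, Fin (X.ar (distribArg p x))) = ⟨x, l'⟩ := by
    refine (sigma_fin_eq (fun x => X.ar (distribArg p x)) (Equiv.symm_apply_apply _ x) l).trans ?_
    exact congrArg (Sigma.mk x) (Fin.ext h)
  exact congrArg (fun y => hidx _ _ (Sum.map finSigmaFinEquiv
    (Sigma.map id fun _ => finSigmaFinEquiv) ((distribPos p).symm y) :
      Fin ((tensor A X).ar p.head) ⊕ Σ i, Fin ((tensor B X).ar (p.arg i)))) this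

/-- The arguments `c_{γ⁻¹(i,j)}` of the associativity isomorphism are the labels that `mulT`
produces in `OD.assoc`; this is the only place where `γ` has to be matched by hand. -/
theorem odotAssoc_lab (p : Lab (odot m A (odot m B C)) τ) :
    (odotLab m ((odotAssoc m A B C).lab p)).map (odotLab m) (fun _ => rfl) id (fun _ => rfl) =
      ((odotLab m p).map id (fun _ => rfl) (odotLab m) (fun _ => rfl)).assoc m := by
  refine OD.ext (OD.ext (Lab.ext rfl fun i => ?_)
    (Lab.ext rfl fun i => Lab.ext rfl fun j => ?_)) (Lab.ext rfl fun i => Lab.ext rfl fun j => ?_)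
  · exact congrArg p.arg (odotAssoc_perm_symm m p.head (Sum.inl (Sum.inl i)))
  · exact congrArg p.arg (odotAssoc_perm_symm m p.head (Sum.inl (Sum.inr ⟨i, j⟩)))
  · exact congrArg p.arg (odotAssoc_perm_symm m p.head (Sum.inr ⟨i, j⟩))

theorem distrib_lab {X : Sig S.Sym} (p : Lab (odot m (tensor A X) (tensor B X)) τ) :
    odotLab m (tensorLab ((distrib m A B X).lab p)) =
      (odotLab m p).map tensorLab (fun _ => rfl) tensorLab (fun _ => rfl) := by
  refine OD.ext (Lab.ext rfl fun i => Lab.ext ?_ fun j => ?_)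
    (Lab.ext rfl fun i => Lab.ext rfl fun j => Lab.ext ?_ fun k => ?_)
  · exact congrArg (distribArg p.head) (Equiv.symm_apply_apply (hidx _ _) (Sum.inl i))
  · exact congrArg p.arg (distrib_perm_symm m p.head (Sum.inl i) j _ rfl)
  · exact congrArg (distribArg p.head) (Equiv.symm_apply_apply (hidx _ _) (Sum.inr ⟨i, j⟩))
  · exact congrArg p.arg (distrib_perm_symm m p.head (Sum.inr ⟨i, j⟩) k _ rfl)

end OdotLab

/-! ### Operads over a monoid -/

section Operad

variable {O : Type} {S : Sig O} (m : MonStr S)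

/-- The symbol `s`, every input being labelled by its type. -/
def genO (s : S.Sym) : Lab S (id : O → O) := ⟨s, S.inp s, fun _ => rfl⟩

/-- Labels taken from the types themselves carry no information. Hence laws of the monad over `id`
amount to laws about symbols, read off at the heads. -/
theorem lab_id_eq (p : Lab S (id : O → O)) : p = genO p.head := Lab.ext rfl fun i => p.typed i

theorem OD.out_assoc {B C D : Type} {outB : B → S.Sym} {outC : C → S.Sym} {outD : D → S.Sym}
    (q : OD outB (OD.out m : OD outC outD → S.Sym)) : (q.assoc m).out m = q.out m :=
  congrArg Lab.head (mulT_assoc m ((q.snd.map OD.snd fun c => c.snd_out m).map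
      (Lab.map (fun d => (genO (outD d) : Lab S (id : O → O))) fun _ => rfl) fun _ => rfl))

/-- Monoids for horizontal composition in the category of sets over the set of symbols. -/
structure Operad {B : Type} (out : B → S.Sym) where
  mul : OD out out → B
  out_mul : ∀ q, out (mul q) = q.out m
  one : O → B
  out_one : ∀ o, out (one o) = m.one.toFun o
  one_mul : ∀ b, mul ⟨one (S.out (out b)), unitT m _ b, (out_one _).symm⟩ = b
  mul_one : ∀ b, mul ⟨b, ⟨out b, fun i => one (S.inp (out b) i),
    fun _ => (congrArg S.out (out_one _)).trans (m.one.out_eq _)⟩, rfl⟩ = b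
  assoc : ∀ q : OD out (OD.out m : OD out out → S.Sym),
    mul ((q.assoc m).map mul out_mul id fun _ => rfl) =
      mul (q.map id (fun _ => rfl) mul out_mul)

variable {m}

structure IsOperadHom {B C : Type} {outB : B → S.Sym} {outC : C → S.Sym} (a : Operad m outB)
    (b : Operad m outC) (f : B → C) (hf : ∀ x, outC (f x) = outB x) : Prop where
  mul : ∀ q, f (a.mul q) = b.mul (q.map f hf f hf)
  one : ∀ o, f (a.one o) = b.one o

end Operad

/-! ### Trees -/

/-- Trees of symbols of `S`, with nodes labelled in `Y`, not necessarily well typed. -/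
inductive Raw {O : Type} (S : Sig O) (Y : Type)
  | nil (o : O) : Raw S Y
  | node (s : S.Sym) (y : Y) (ts : Fin (S.ar s) → Raw S Y) : Raw S Y

namespace Raw

variable {O Y Z : Type} {S : Sig O}

/-- The output type. -/
def hout : Raw S Y → O
  | nil o => o
  | node s _ _ => S.out s

/-- Well typed trees, the label of a node being a lift of its symbol. -/
def WF (τ : Y → S.Sym) : Raw S Y → Prop
  | nil _ => True
  | node s y ts => s = τ y ∧ ∀ i, (ts i).WF τ ∧ (ts i).hout = S.inp s i

/-- The composite of the symbols of a tree. -/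
def val (m : MonStr S) {τ : Y → S.Sym} : (r : Raw S Y) → r.WF τ → {s : S.Sym // S.out s = r.hout}
  | nil o, _ => ⟨m.one.toFun o, m.one.out_eq o⟩
  | node s _ ts, h => ⟨m.mul.toFun ⟨s, fun i => (val m (ts i) (h.2 i).1).1,
      fun i => (val m (ts i) (h.2 i).1).2.trans (h.2 i).2⟩, m.mul.out_eq _⟩

end Raw

/-- Well typed trees with nodes labelled in `Y`. -/
def Tree {O Y : Type} {S : Sig O} (τ : Y → S.Sym) : Type := {r : Raw S Y // r.WF τ}

namespace Tree

variable {O Y C : Type} {S : Sig O} {m : MonStr S} {τ : Y → S.Sym} {outC : C → S.Sym}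

variable (m) in
/-- The composite of the symbols of a tree. -/
def out (t : Tree τ) : S.Sym := (t.1.val m t.2).1

theorem out_out (t : Tree τ) : S.out (t.out m) = t.1.hout := (t.1.val m t.2).2

def nil (o : O) : Tree τ := ⟨Raw.nil o, trivial⟩

/-- A label at the root with a family of trees over the inputs of its symbol is a horizontal
composite, so that operations on `OD` apply to roots as well. -/
def node (q : OD τ (out m : Tree τ → S.Sym)) : Tree τ :=
  ⟨Raw.node q.snd.head q.fst fun i => (q.snd.arg i).1,
    q.eq, fun i => ⟨(q.snd.arg i).2, (q.snd.arg i).out_out.symm.trans (q.snd.typed i)⟩⟩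

theorem out_nil (o : O) : (nil o : Tree τ).out m = m.one.toFun o := rfl

theorem out_node (q : OD τ (out m : Tree τ → S.Sym)) : (node q).out m = q.out m := rfl

theorem ind (m : MonStr S) {P : Tree τ → Prop} (nil : ∀ o, P (nil o))
    (node : ∀ q : OD τ (out m : Tree τ → S.Sym), (∀ i, P (q.snd.arg i)) → P (node q)) :
    ∀ t, P t := by
  rintro ⟨r, h⟩
  induction r with
  | nil o => exact nil o
  | node s y ts ih =>
    exact node ⟨y, ⟨s, fun i => ⟨ts i, (h.2 i).1⟩, fun i => (out_out _).trans (h.2 i).2⟩, h.1⟩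
      fun i => ih i _

end Tree

/-! ### Grafting of trees -/

section Pieces

variable {O C : Type} {S : Sig O} (m : MonStr S) {σ : C → O}

/-- A labelled composite, as a symbol labelled by labelled symbols. -/
def pieces (p : Comp S S) (arg : Fin (S.ar (m.mul.toFun p)) → C)
    (ty : ∀ i, σ (arg i) = S.inp (m.mul.toFun p) i) : Lab S (Lab.out : Lab S σ → O) where
  head := p.head
  arg := fun i =>
    { head := p.arg i
      arg := fun j => arg (m.mul.perm p (finSigmaFinEquiv ⟨i, j⟩))
      typed := fun j =>
        (ty _).trans ((m.mul.inp_eq p _).trans (tensor_inp S S p ⟨i, j⟩)) }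
  typed := p.typed

/-- Labels on the inputs of a composite can be pulled back along the amalgamation permutation to its
components, and multiplication restores them. -/
theorem mulT_pieces (p : Comp S S) (arg : Fin (S.ar (m.mul.toFun p)) → C)
    (ty : ∀ i, σ (arg i) = S.inp (m.mul.toFun p) i) :
    mulT m (pieces m p arg ty) = ⟨m.mul.toFun p, arg, ty⟩ := by
  refine Lab.ext rfl fun i => congrArg arg ?_
  exact (congrArg _ (Equiv.apply_symm_apply finSigmaFinEquiv ((m.mul.perm p).symm i))).trans
    (Equiv.apply_symm_apply (m.mul.perm p) i)

/-- A unit symbol has one input, hence one label, and that label determines it. -/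
theorem unitT_eq (κ : Lab S σ) (o : O) (h : κ.head = m.one.toFun o) :
    ∃ c, σ c = o ∧ κ = unitT m σ c := by
  obtain ⟨hd, arg, ty⟩ := κ
  obtain rfl : hd = _ := h
  have h1 : σ (arg (m.one.perm o (0 : Fin 1))) = o := (ty _).trans (m.one.inp_eq o (0 : Fin 1))
  refine ⟨_, h1, Lab.ext (congrArg m.one.toFun h1.symm) fun i => congrArg arg ?_⟩
  obtain ⟨j, rfl⟩ := (m.one.perm o).surjective i
  exact congrArg _ (Subsingleton.elim (α := Fin 1) _ _)

end Pieces

namespace Tree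

variable {O Y C : Type} {S : Sig O} {m : MonStr S} {τ : Y → S.Sym} {outC : C → S.Sym}

/-- Induction on composites of trees with families of elements of `C`. -/
theorem odInd {P : OD (out m : Tree τ → S.Sym) outC → Prop}
    (nil : ∀ c, P ⟨nil (S.out (outC c)), unitT m _ c, rfl⟩)
    (node : ∀ q : OD τ (OD.out m : OD (out m : Tree τ → S.Sym) outC → S.Sym),
      (∀ i, P (q.snd.arg i)) → P ((q.assoc m).map node out_node id fun _ => rfl)) :
    ∀ q, P q := by
  rintro ⟨t, κ, e⟩
  induction t using Tree.ind m generalizing κ with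
  | nil o =>
    obtain ⟨c, rfl, rfl⟩ := unitT_eq m κ o e
    exact nil c
  | node q ih =>
    obtain ⟨hd, arg, ty⟩ := κ
    dsimp only at e
    subst e
    let p : Comp S S := ⟨q.snd.head, fun i => (q.snd.arg i).out m, q.snd.typed⟩
    -- The family attached to the whole tree is split among the subtrees at the root; `OD.assoc`
    -- reassembles it.
    let κ := pieces m (σ := fun c => S.out (outC c)) p arg ty
    let q' : OD τ (OD.out m : OD (out m : Tree τ → S.Sym) outC → S.Sym) :=
      ⟨q.fst, ⟨q.snd.head, fun i => ⟨q.snd.arg i, κ.arg i, rfl⟩,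
        fun i => (m.mul.out_eq _).trans (κ.typed i)⟩, q.eq⟩
    have := node q' fun i => ih i _ _
    convert this using 1
    exact OD.ext rfl (mulT_pieces m (σ := fun c => S.out (outC c)) p arg ty).symm

/-- The trees to be grafted are indexed by the inputs of the composite symbol. At a node `pieces`
hands each subtree its share, through the amalgamation permutation; at an empty tree the single
argument is the result. The output type is carried along to type the parent node. -/
def graftAux : (r : Raw S Y) → (h : r.WF τ) → (arg : Fin (S.ar (r.val m h).1) → Tree τ) →
    (∀ i, S.out ((arg i).out m) = S.inp (r.val m h).1 i) →
      {r' : Raw S Y // r'.WF τ ∧ r'.hout = r.hout}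
  | .nil o, _, arg, ty => ⟨(arg (m.one.perm o (0 : Fin 1))).1, (arg _).2,
      (out_out _).symm.trans ((ty _).trans (m.one.inp_eq o (0 : Fin 1)))⟩
  | .node s y ts, h, arg, ty =>
    let p : Comp S S := ⟨s, fun i => ((ts i).val m (h.2 i).1).1,
      fun i => ((ts i).val m (h.2 i).1).2.trans (h.2 i).2⟩
    ⟨.node s y fun i => (graftAux (ts i) (h.2 i).1 (((pieces m (σ := fun t : Tree τ => S.out (t.out m)) p arg ty).arg i).arg)
        ((pieces m (σ := fun t : Tree τ => S.out (t.out m)) p arg ty).arg i).typed).1,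
      ⟨h.1, fun i => ⟨(graftAux (ts i) (h.2 i).1 _ _).2.1,
        (graftAux (ts i) (h.2 i).1 _ _).2.2.trans (h.2 i).2⟩⟩, rfl⟩

/-- Grafting of trees on the inputs of a tree. -/
def graft (q : OD (out m : Tree τ → S.Sym) (out m : Tree τ → S.Sym)) : Tree τ :=
  ⟨_, (graftAux q.fst.1 q.fst.2 _ q.typed_cast).2.1⟩

theorem graft_out_out (q : OD (out m : Tree τ → S.Sym) (out m : Tree τ → S.Sym)) :
    S.out ((graft q).out m) = S.out (q.out m) := by
  rw [out_out, OD.out_out, out_out]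
  exact (graftAux q.fst.1 q.fst.2 _ q.typed_cast).2.2

theorem graft_nil (t : Tree τ) :
    graft ⟨nil (S.out (t.out m)), unitT m (fun t : Tree τ => S.out (t.out m)) t, rfl⟩ = t := rfl

theorem graft_node_aux (q : OD τ (OD.out m : OD (out m : Tree τ → S.Sym) (out m) → S.Sym)) :
    graft ((q.assoc m).map node out_node id fun _ => rfl) =
      node ⟨q.fst, q.snd.map graft graft_out_out, q.eq⟩ := by
  obtain ⟨y, ⟨s, arg, ty⟩, e⟩ := q
  -- Taking the family apart allows the heads to be replaced by the composites of the subtrees,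
  -- after which both sides are given by the same recursion.
  obtain ⟨t, h, a, hty, he, rfl⟩ : ∃ (t : Fin (S.ar s) → Tree τ) (h : Fin (S.ar s) → S.Sym)
      (a : ∀ i, Fin (S.ar (h i)) → Tree τ)
      (hty : ∀ i j, S.out ((a i j).out m) = S.inp (h i) j) (he : ∀ i, h i = (t i).out m),
      arg = fun i => ⟨t i, ⟨h i, a i, hty i⟩, he i⟩ :=
    ⟨fun i => (arg i).fst, fun i => (arg i).snd.head, fun i => (arg i).snd.arg,
      fun i => (arg i).snd.typed, fun i => (arg i).eq, rfl⟩
  obtain rfl : h = fun i => (t i).out m := funext he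
  have key : ∀ (i) (a' : Fin (S.ar ((t i).out m)) → Tree τ)
      (ty' : ∀ j, S.out ((a' j).out m) = S.inp ((t i).out m) j), a' = a i →
      (graftAux (t i).1 (t i).2 a' ty').1 = (graftAux (t i).1 (t i).2 (a i) (hty i)).1 := by
    rintro i _ ty' rfl
    rfl
  refine Subtype.ext (congrArg (Raw.node s y) (funext fun i => key i _ _ (funext fun j => ?_)))
  let p : Comp S S := ⟨s, fun i => (t i).out m, fun i => (m.mul.out_eq _).symm.trans (ty i)⟩
  -- `OD.assoc` distributes along `γ` what `pieces` collects along its inverse; the two cancel.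
  have : finSigmaFinEquiv.symm ((m.mul.perm p).symm (m.mul.perm p (finSigmaFinEquiv ⟨i, j⟩))) =
      ⟨i, j⟩ := by simp
  exact congrArg (fun r : (Σ i, Fin (S.ar ((t i).out m))) => a r.1 r.2) this

/-- For an empty tree this is the unit law of the monoid, and at a root it is associativity. -/
theorem out_graft (q : OD (out m : Tree τ → S.Sym) (out m : Tree τ → S.Sym)) :
    (graft q).out m = q.out m := by
  induction q using odInd with
  | nil c =>
    rw [graft_nil]
    exact (congrArg Lab.head (mulT_unitT m (genO (c.out m)))).symm
  | node q ih =>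
    rw [graft_node_aux, OD.out_map, OD.out_assoc, out_node]
    exact congrArg m.mul.toFun (comp_eq _ _ rfl ih)

theorem graft_node (q : OD τ (OD.out m : OD (out m : Tree τ → S.Sym) (out m) → S.Sym)) :
    graft ((q.assoc m).map node out_node id fun _ => rfl) =
      node (q.map id (fun _ => rfl) graft out_graft) := graft_node_aux q

end Tree

/-! ### The operad of trees and its freeness -/

namespace Tree

variable {O Y C : Type} {S : Sig O} {m : MonStr S} {τ : Y → S.Sym} {outC : C → S.Sym}

theorem out_nil_out (o : O) : S.out ((nil o : Tree τ).out m) = o := m.one.out_eq o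

theorem graft_eq_of_nil (q : OD (out m : Tree τ → S.Sym) (out m : Tree τ → S.Sym)) (t : Tree τ)
    (h : q.fst = nil (S.out (t.out m)))
    (h' : q.snd = unitT m (fun t : Tree τ => S.out (t.out m)) t) : graft q = t := by
  obtain rfl : q = ⟨nil (S.out (t.out m)), unitT m _ t, rfl⟩ := OD.ext h h'
  exact graft_nil t

/-- The symbol `s` with trees without nodes as labels. -/
def nilLab (m : MonStr S) (τ : Y → S.Sym) (s : S.Sym) :
    Lab S fun t : Tree τ => S.out (t.out m) :=
  (genO s).map nil out_nil_out

theorem mulT_nilLab (κ : Lab S fun t : Tree τ => S.out (t.out m)) :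
    mulT m (κ.map (fun t : Tree τ => nilLab m τ (t.out m)) fun _ => rfl) =
      nilLab m τ (m.mul.toFun ⟨κ.head, fun i => (κ.arg i).out m, κ.typed⟩) := by
  exact congrArg (Lab.map nil out_nil_out) (lab_id_eq (mulT m
    (κ.map (fun t : Tree τ => (genO (t.out m) : Lab S (id : O → O))) fun _ => rfl)))

theorem graft_nilLab (t : Tree τ) : graft ⟨t, nilLab m τ (t.out m), rfl⟩ = t := by
  induction t using Tree.ind m with
  | nil o =>
    refine graft_eq_of_nil _ _ (congrArg nil (out_nil_out o).symm) ?_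
    exact Lab.ext (congrArg m.one.toFun (out_nil_out o).symm) fun i => congrArg nil (by
      obtain ⟨j, rfl⟩ := (m.one.perm o).surjective i
      exact m.one.inp_eq o j)
  | node q ih =>
    let q' : OD τ (OD.out m : OD (out m : Tree τ → S.Sym) (out m : Tree τ → S.Sym) → S.Sym) :=
      ⟨q.fst, q.snd.map (fun t => ⟨t, nilLab m τ (t.out m), rfl⟩)
        (fun t => m.mul.out_eq _), q.eq⟩
    have h := graft_node q'
    refine Eq.trans (congrArg graft (OD.ext (q := (q'.assoc m).map node out_node id fun _ => rfl)
      rfl (mulT_nilLab q.snd).symm)) (h.trans ?_)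
    exact congrArg node (OD.ext rfl (Lab.ext rfl ih))

/-- Grafting passes through the root (`graft_node`), so induction on the lowest tree reduces the
claim to the subtrees; the regrouping of the uppermost trees is `mulT_assoc`. -/
theorem graft_assoc (q : OD (out m : Tree τ → S.Sym)
    (OD.out m : OD (out m : Tree τ → S.Sym) (out m : Tree τ → S.Sym) → S.Sym)) :
    graft ((q.assoc m).map graft out_graft id fun _ => rfl) =
      graft (q.map id (fun _ => rfl) graft out_graft) := by
  induction q using odInd with
  | nil c =>
    have h1 := graft_eq_of_nil ((⟨nil (S.out (c.out m)), unitT m _ c, rfl⟩ :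
        OD (out m : Tree τ → S.Sym) (OD.out m : OD (out m : Tree τ → S.Sym)
          (out m : Tree τ → S.Sym) → S.Sym)).assoc m).fst c.fst
      (congrArg nil (OD.out_out m c)) (unitT_map m OD.fst (fun c => (OD.out_out m c).symm) c)
    have h2 : mulT m ((unitT m (fun c : OD (out m : Tree τ → S.Sym) (out m : Tree τ → S.Sym) =>
        S.out (c.out m)) c).map OD.snd fun c => c.snd_out m) = c.snd := by
      rw [unitT_map]
      exact mulT_unitT m c.snd
    have h3 : ((⟨nil (S.out (c.out m)), unitT m _ c, rfl⟩ :
        OD (out m : Tree τ → S.Sym) (OD.out m : OD (out m : Tree τ → S.Sym)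
          (out m : Tree τ → S.Sym) → S.Sym)).assoc m).map graft out_graft id (fun _ => rfl) = c :=
      OD.ext h1 h2
    rw [h3]
    symm
    refine graft_eq_of_nil _ _ (congrArg (fun s => nil (S.out s)) (out_graft c).symm)
      (unitT_map m graft graft_out_out c)
  | node q ih =>
    have h0 := graft_node ⟨q.fst, q.snd.map (fun c => (c.assoc m).fst)
      (fun c => (OD.out_out m _).trans (OD.out_out m c).symm), q.eq⟩
    have h1 := graft_node (q.map id (fun _ => rfl) (fun c => (c.assoc m).map graft out_graft id
      fun _ => rfl) fun c => (OD.out_map m _ _ _ _ _).trans (OD.out_assoc m c))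
    have h2 := graft_node (q.map id (fun _ => rfl) (fun c => c.map id (fun _ => rfl) graft out_graft)
      fun c => OD.out_map m _ _ _ _ _)
    refine Eq.trans (congrArg graft (OD.ext ?_ ?_)) (h1.trans (Eq.trans ?_ h2.symm))
    · exact h0
    · exact mulT_assoc m (q.snd.map (fun c => c.snd.map OD.snd fun d => d.snd_out m)
        fun c => c.snd_out m)
    · exact congrArg node (OD.ext rfl (Lab.ext rfl ih))

variable (m τ) in
/-- Trees form an operad. -/
def operad : Operad m (out m : Tree τ → S.Sym) where
  mul := graft
  out_mul := out_graft
  one := nil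
  out_one := out_nil
  one_mul := graft_nil
  mul_one := graft_nilLab
  assoc := graft_assoc

variable (m) in
/-- The tree with one node. -/
def single (y : Y) : Tree τ := node ⟨y, nilLab m τ (τ y), rfl⟩

theorem out_single (y : Y) : (single m y : Tree τ).out m = τ y := by
  have h := congrArg Lab.head (mulT_map_unitT m (genO (τ y)))
  exact h

/-- One-node trees generate all trees under grafting; uniqueness of extensions rests on this. -/
theorem node_eq (q : OD τ (out m : Tree τ → S.Sym)) :
    node q = graft ⟨single m q.fst, q.snd, q.eq.trans (out_single _).symm⟩ := by
  let q' : OD τ (OD.out m : OD (out m : Tree τ → S.Sym) (out m : Tree τ → S.Sym) → S.Sym) :=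
    ⟨q.fst, q.snd.map (fun t => ⟨nil (S.out (t.out m)), unitT m _ t, rfl⟩)
      (fun t => (m.mul.out_eq _).trans (out_nil_out (τ := τ) _)), q.eq⟩
  refine Eq.trans (graft_node q').symm (congrArg graft (OD.ext ?_ (mulT_map_unitT m q.snd)))
  refine congrArg node (OD.ext rfl (Lab.ext q.eq fun i => congrArg nil ?_))
  exact (q.snd.typed i).trans (inp_cast _ _ q.eq i).symm

variable {B : Type} {outB : B → S.Sym} (b : Operad m outB) (f : Y → B) (hf : ∀ y, outB (f y) = τ y)

def liftAux : (r : Raw S Y) → r.WF τ → {x : B // S.out (outB x) = r.hout}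
  | .nil o, _ => ⟨b.one o, (congrArg S.out (b.out_one o)).trans (m.one.out_eq o)⟩
  | .node s y ts, h => ⟨b.mul ⟨f y, ⟨s, fun i => (liftAux (ts i) (h.2 i).1).1,
      fun i => (liftAux (ts i) (h.2 i).1).2.trans (h.2 i).2⟩, h.1.trans (hf y).symm⟩,
      (congrArg S.out (b.out_mul _)).trans (m.mul.out_eq _)⟩

/-- The extension of a map to an operad. -/
def lift (t : Tree τ) : B := (liftAux b f hf t.1 t.2).1

theorem lift_out_out (t : Tree τ) : S.out (outB (lift b f hf t)) = S.out (t.out m) :=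
  (liftAux b f hf t.1 t.2).2.trans t.out_out.symm

theorem lift_nil (o : O) : lift b f hf (nil o) = b.one o := rfl

theorem lift_node_aux (q : OD τ (out m : Tree τ → S.Sym)) : lift b f hf (node q) =
    b.mul ⟨f q.fst, q.snd.map (lift b f hf) (lift_out_out b f hf), q.eq.trans (hf _).symm⟩ := rfl

theorem out_lift (t : Tree τ) : outB (lift b f hf t) = t.out m := by
  induction t using Tree.ind m with
  | nil o => exact b.out_one o
  | node q ih =>
    rw [lift_node_aux, b.out_mul]
    exact congrArg m.mul.toFun (comp_eq _ _ rfl ih)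

theorem lift_node (q : OD τ (out m : Tree τ → S.Sym)) :
    lift b f hf (node q) = b.mul (q.map f hf (lift b f hf) (out_lift b f hf)) := rfl

/-- By induction on the lower tree: the empty tree uses the left unit law of `b`, a root its
associativity. -/
theorem lift_graft (q : OD (out m : Tree τ → S.Sym) (out m : Tree τ → S.Sym)) :
    lift b f hf (graft q) =
      b.mul (q.map (lift b f hf) (out_lift b f hf) (lift b f hf) (out_lift b f hf)) := by
  induction q using odInd with
  | nil c =>
    refine (b.one_mul _).symm.trans (congrArg b.mul (OD.ext ?_
      (unitT_map m (lift b f hf) (fun y => congrArg S.out (out_lift b f hf y)) c).symm))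
    exact congrArg (fun s => b.one (S.out s)) (out_lift b f hf c)
  | node q ih =>
    let q' : OD outB (OD.out m : OD outB outB → S.Sym) := q.map f hf
      (OD.map (lift b f hf) (out_lift b f hf) (lift b f hf) (out_lift b f hf))
      (OD.out_map m _ _ _ _)
    rw [graft_node, lift_node]
    have h : (q.map id (fun _ => rfl) graft out_graft).map f hf (lift b f hf) (out_lift b f hf) =
        q'.map id (fun _ => rfl) b.mul b.out_mul := OD.ext rfl (Lab.ext rfl ih)
    exact (congrArg b.mul h).trans (b.assoc q').symm

theorem lift_isOperadHom : IsOperadHom (operad m τ) b (lift b f hf) (out_lift b f hf) :=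
  ⟨lift_graft b f hf, lift_nil b f hf⟩

theorem lift_single (y : Y) : lift b f hf (single m y) = f y := by
  refine Eq.trans (congrArg b.mul ?_) (b.mul_one (f y))
  exact OD.ext rfl (Lab.ext (hf y).symm fun i => congrArg b.one (inp_cast _ _ (hf y).symm i).symm)

theorem eq_lift (g : Tree τ → B) (hg : ∀ t, outB (g t) = t.out m)
    (h : IsOperadHom (operad m τ) b g hg) (h' : ∀ y, g (single m y) = f y) (t : Tree τ) :
    g t = lift b f hf t := by
  induction t using Tree.ind m with
  | nil o => exact h.one o
  | node q ih =>
    rw [lift_node, node_eq]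
    exact (h.mul _).trans (congrArg b.mul (OD.ext (h' _) (Lab.ext rfl ih)))

end Tree

/-! ### Nodes of a tree and their labels -/

namespace Raw

variable {O Y Z V : Type} {S : Sig O}

/-- The positions of the nodes. -/
def Pos : Raw S Y → Type
  | nil _ => Empty
  | node _ _ ts => Unit ⊕ Σ i, (ts i).Pos

instance instFintypePos : (r : Raw S Y) → Fintype r.Pos
  | nil _ => inferInstanceAs (Fintype Empty)
  | node _ _ ts =>
    letI := fun i => instFintypePos (ts i)
    inferInstanceAs (Fintype (Unit ⊕ Σ i, (ts i).Pos))

/-- The label of a node. -/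
def lbl : (r : Raw S Y) → r.Pos → Y
  | nil _ => Empty.elim
  | node _ y ts => Sum.elim (fun _ => y) fun p => (ts p.1).lbl p.2

/-- The same tree with other labels. -/
def relabel : (r : Raw S Y) → (r.Pos → Z) → Raw S Z
  | nil o, _ => nil o
  | node s _ ts, l => node s (l (Sum.inl ())) fun i => (ts i).relabel fun p => l (Sum.inr ⟨i, p⟩)

def map (g : Y → Z) : Raw S Y → Raw S Z
  | nil o => nil o
  | node s y ts => node s (g y) fun i => (ts i).map g

/-- The sum of the weights of the labels. -/
def sum (w : Y → ℕ) : Raw S Y → ℕ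
  | nil _ => 0
  | node _ y ts => w y + ∑ i, (ts i).sum w

theorem sum_relabel (w : Z → ℕ) (r : Raw S Y) (l : r.Pos → Z) :
    (r.relabel l).sum w = ∑ p, w (l p) := by
  induction r with
  | nil o => exact (Finset.sum_empty (ι := Empty)).symm
  | node s y ts ih =>
    have h : (∑ p : (node s y ts).Pos, w (l p)) =
        ∑ p : Unit ⊕ Σ i, (ts i).Pos, w (l p) := rfl
    rw [h, Fintype.sum_sum_type, Fintype.sum_sigma]
    exact congrArg₂ _ (Fintype.sum_unique fun x : Unit => w (l (Sum.inl x))).symm (Finset.sum_congr rfl fun i _ => ih i _)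

theorem hout_relabel (r : Raw S Y) (l : r.Pos → Z) : (r.relabel l).hout = r.hout := by
  cases r <;> rfl

theorem hout_map (g : Y → Z) (r : Raw S Y) : (r.map g).hout = r.hout := by
  cases r <;> rfl

theorem map_relabel (g : Z → V) (r : Raw S Y) (l : r.Pos → Z) :
    (r.relabel l).map g = r.relabel fun p => g (l p) := by
  induction r with
  | nil o => rfl
  | node s y ts ih => exact congrArg (node s _) (funext fun i => ih i _)

theorem relabel_lbl (r : Raw S Y) : r.relabel r.lbl = r := by
  induction r with
  | nil o => rfl
  | node s y ts ih => exact congrArg (node s _) (funext fun i => ih i)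

theorem relabel_injective (r : Raw S Y) {l l' : r.Pos → Z} (h : r.relabel l = r.relabel l') :
    l = l' := by
  induction r with
  | nil o => exact funext fun p => p.elim
  | node s y ts ih =>
    simp only [relabel, node.injEq, heq_eq_eq, true_and] at h
    funext p
    rcases p with ⟨⟩ | ⟨i, p⟩
    · exact h.1
    · exact congrFun (ih i (congrFun h.2 i)) p

theorem wf_relabel (τ : Y → S.Sym) (r : Raw S S.Sym) (h : r.WF id) (l : r.Pos → Y)
    (hl : ∀ p, τ (l p) = r.lbl p) : (r.relabel l).WF τ := by
  induction r with
  | nil o => trivial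
  | node s y ts ih =>
    exact ⟨h.1.trans (hl (Sum.inl ())).symm, fun i =>
      ⟨ih i (h.2 i).1 _ fun p => hl (Sum.inr ⟨i, p⟩), (hout_relabel _ _).trans (h.2 i).2⟩⟩

theorem wf_map {σ : Z → S.Sym} {τ : Y → S.Sym} (g : Y → Z) (hg : ∀ y, σ (g y) = τ y)
    (r : Raw S Y) (h : r.WF τ) : (r.map g).WF σ := by
  induction r with
  | nil o => trivial
  | node s y ts ih =>
    exact ⟨h.1.trans (hg y).symm, fun i => ⟨ih i (h.2 i).1, (hout_map _ _).trans (h.2 i).2⟩⟩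

/-- A labelled tree is its underlying tree of symbols with a labelling of the positions. Together
with `relabel_injective` this identifies `Tree τ` with the labelled symbols of `treeSig`. -/
theorem exists_relabel_eq (g : Y → Z) (r : Raw S Y) :
    ∃ l : (r.map g).Pos → Y, (r.map g).relabel l = r ∧ ∀ p, g (l p) = (r.map g).lbl p := by
  induction r with
  | nil o => exact ⟨Empty.elim, rfl, fun p => p.elim⟩
  | node s y ts ih =>
    choose l h1 h2 using ih
    exact ⟨Sum.elim (fun _ => y) fun p => l p.1 p.2, congrArg (node s y) (funext h1),
      fun p => by rcases p with p | p <;> [rfl; exact h2 _ _]⟩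

theorem val_map (m : MonStr S) {σ : Z → S.Sym} {τ : Y → S.Sym} (g : Y → Z)
    (r : Raw S Y) (h : r.WF τ) (h' : (r.map g).WF σ) :
    ((r.map g).val m h').1 = (r.val m h).1 := by
  induction r with
  | nil o => rfl
  | node s y ts ih => exact congrArg m.mul.toFun (comp_eq _ _ rfl fun i => ih i _ _)

end Raw

namespace Tree

variable {O Y Z : Type} {S : Sig O} {m : MonStr S} {τ : Y → S.Sym} {σ : Z → S.Sym}

/-- Change of labels. -/
def map (g : Y → Z) (hg : ∀ y, σ (g y) = τ y) (t : Tree τ) : Tree σ :=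
  ⟨t.1.map g, t.1.wf_map g hg t.2⟩

theorem out_map (g : Y → Z) (hg : ∀ y, σ (g y) = τ y) (t : Tree τ) :
    (t.map g hg).out m = t.out m := t.1.val_map m g t.2 _

/-- A change of labels is the extension of `y ↦ single (g y)`, hence a homomorphism. -/
theorem map_isOperadHom (g : Y → Z) (hg : ∀ y, σ (g y) = τ y) :
    IsOperadHom (operad m τ) (operad m σ) (map g hg) (out_map g hg) := by
  have h : map g hg = lift (operad m σ) (fun y => single m (g y))
      (fun y => (out_single (m := m) (g y)).trans (hg y)) := by
    funext t
    induction t using Tree.ind m with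
    | nil o => rfl
    | node q ih =>
      have h1 : (node q).map g hg = node (q.map g hg (map g hg) (out_map g hg)) := rfl
      rw [lift_node_aux, h1, node_eq]
      exact congrArg graft (OD.ext rfl (Lab.ext rfl ih))
  have h2 := lift_isOperadHom (operad m σ) (fun y => single m (g y))
      (fun y => (out_single (m := m) (g y)).trans (hg y))
  exact ⟨fun q => by simpa only [← h] using h2.mul q, fun _ => rfl⟩

theorem map_single (g : Y → Z) (hg : ∀ y, σ (g y) = τ y) (y : Y) :
    (single m y : Tree τ).map g hg = single m (g y) := by
  have h : ∀ s s', s = s' → (nilLab m τ s).map (map g hg) (fun t => congrArg S.out (out_map g hg t))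
      = nilLab m σ s' := by
    rintro s _ rfl
    rfl
  have h1 : (single m y : Tree τ).map g hg = node (OD.map g hg (map g hg) (out_map g hg)
    ⟨y, nilLab m τ (τ y), rfl⟩) := rfl
  exact h1.trans (congrArg node (OD.ext rfl (h _ _ (hg y).symm)))

/-- The sum of the weights of the labels. -/
def sum (w : Y → ℕ) (t : Tree τ) : ℕ := t.1.sum w

/-- A weight that is additive under composition is determined on generators. This supplies the
preservation of multisets of labels that `exists_hom_lab` asks for, both for flattening and for
extensions. -/
theorem sum_lift {B : Type} {outB : B → S.Sym} (b : Operad m outB) (f : Y → B)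
    (hf : ∀ y, outB (f y) = τ y) (w : Y → ℕ) (W : B → ℕ) (h : ∀ y, W (f y) = w y)
    (hone : ∀ o, W (b.one o) = 0) (hmul : ∀ q, W (b.mul q) = W q.fst + q.snd.sum W) (t : Tree τ) :
    W (lift b f hf t) = sum w t := by
  induction t using Tree.ind m with
  | nil o => exact hone o
  | node q ih =>
    rw [lift_node, hmul]
    exact congrArg₂ _ (h _) (Finset.sum_congr rfl fun i _ => ih i)

theorem sum_graft (w : Y → ℕ) (q : OD (out m : Tree τ → S.Sym) (out m : Tree τ → S.Sym)) :
    sum w (graft q) = sum w q.fst + q.snd.sum (sum w) := by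
  induction q using odInd with
  | nil c =>
    rw [graft_nil, unitT_sum]
    exact (zero_add _).symm
  | node q ih =>
    have h : ((q.assoc m).map node out_node id fun _ => rfl).snd.sum (sum w) =
        q.snd.sum fun c => c.snd.sum (sum w) := mulT_sum m (sum w) _
    rw [graft_node, h]
    have h1 : sum w (node (q.map id (fun _ => rfl) graft out_graft)) =
        w q.fst + q.snd.sum fun c => sum w (graft c) := rfl
    have h2 : sum w ((q.assoc m).map node out_node id fun _ => rfl).fst =
        w q.fst + q.snd.sum fun c => sum w c.fst := rfl
    rw [h1, h2, add_assoc]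
    refine congrArg _ (Eq.trans ?_ Finset.sum_add_distrib)
    exact Finset.sum_congr rfl fun i _ => ih i

end Tree

/-! ### The signature of trees -/

section TreeSig

variable {O Y Z : Type} {S : Sig O} (m : MonStr S) {τ : Y → S.Sym} {σ : Z → S.Sym}

/-- Trees, as symbols with their nodes as inputs. -/
noncomputable def treeSig : Sig S.Sym where
  Sym := Tree (id : S.Sym → S.Sym)
  typ := fun t =>
    { ar := Fintype.card t.1.Pos
      out := t.out m
      inp := fun i => t.1.lbl ((Fintype.equivFin t.1.Pos).symm i) }

/-- The enumeration of nodes chosen in `treeSig` is arbitrary and is used up here: only labels at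
positions remain. -/
noncomputable def treeLabFun (p : Lab (treeSig m) τ) : Tree τ :=
  ⟨p.head.1.relabel fun x => p.arg (Fintype.equivFin p.head.1.Pos x),
    Raw.wf_relabel τ _ p.head.2 _ fun x => (p.typed _).trans
      (congrArg p.head.1.lbl (Equiv.symm_apply_apply _ x))⟩

theorem treeLabFun_map (g : Y → Z) (hg : ∀ y, σ (g y) = τ y) (p : Lab (treeSig m) τ) :
    treeLabFun m (p.map g hg) = (treeLabFun m p).map g hg :=
  Subtype.ext (Raw.map_relabel g _ _).symm

theorem treeLabFun_head (p : Lab (treeSig m) τ) :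
    (treeLabFun m p).map τ (fun _ => rfl) = p.head := by
  refine Subtype.ext ((Raw.map_relabel τ _ _).trans (Eq.trans ?_ (Raw.relabel_lbl p.head.1)))
  exact congrArg _ (funext fun x => (p.typed _).trans
    (congrArg p.head.1.lbl (Equiv.symm_apply_apply _ x)))

theorem treeLabFun_bijective : Function.Bijective (treeLabFun m : Lab (treeSig m) τ → Tree τ) := by
  refine ⟨fun p p' h => ?_, fun t => ?_⟩
  · have h1 : p.head = p'.head := by rw [← treeLabFun_head, h, treeLabFun_head]
    obtain ⟨t, arg, ty⟩ := p
    obtain ⟨t', arg', ty'⟩ := p'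
    obtain rfl : t = t' := h1
    have h2 := Raw.relabel_injective _ (congrArg Subtype.val h)
    obtain rfl : arg = arg' := by
      funext i
      obtain ⟨x, rfl⟩ := (Fintype.equivFin t.1.Pos).surjective i
      exact congrFun h2 x
    rfl
  · obtain ⟨l, h1, h2⟩ := t.1.exists_relabel_eq τ
    refine ⟨⟨t.map τ fun _ => rfl, fun i => l ((Fintype.equivFin _).symm i),
      fun i => h2 _⟩, Subtype.ext (Eq.trans ?_ h1)⟩
    exact congrArg _ (funext fun x => congrArg l (Equiv.symm_apply_apply _ x))

/-- The labelled symbols of `treeSig` are the trees with labelled nodes. -/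
noncomputable def treeLab : Lab (treeSig m) τ ≃ Tree τ :=
  Equiv.ofBijective _ (treeLabFun_bijective m)

theorem treeLab_map (g : Y → Z) (hg : ∀ y, σ (g y) = τ y) (p : Lab (treeSig m) τ) :
    treeLab m (p.map g hg) = (treeLab m p).map g hg := treeLabFun_map m g hg p

theorem treeLab_out (p : Lab (treeSig m) τ) : (treeLab m p).out m = p.out := by
  refine (Tree.out_map (m := m) (σ := (id : S.Sym → S.Sym)) τ (fun _ => rfl)
    (treeLabFun m p)).symm.trans ?_
  exact congrArg (Tree.out m) (treeLabFun_head m p)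

theorem treeLab_sum (w : Y → ℕ) (p : Lab (treeSig m) τ) :
    (treeLab m p).sum w = p.sum w := by
  refine (Raw.sum_relabel w _ _).trans ?_
  exact Equiv.sum_comp (Fintype.equivFin p.head.1.Pos) fun i => w (p.arg i)

end TreeSig

/-! ### Homomorphisms and transport of operads -/

section

variable {O : Type} {S : Sig O} {m : MonStr S}

theorem OD.map_map {B C B' C' B'' C'' : Type} {outB : B → S.Sym} {outC : C → S.Sym}
    {outB' : B' → S.Sym} {outC' : C' → S.Sym} {outB'' : B'' → S.Sym} {outC'' : C'' → S.Sym}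
    (f : B → B') (hf : ∀ b, outB' (f b) = outB b) (g : C → C') (hg : ∀ c, outC' (g c) = outC c)
    (f' : B' → B'') (hf' : ∀ b, outB'' (f' b) = outB' b) (g' : C' → C'')
    (hg' : ∀ c, outC'' (g' c) = outC' c) (q : OD outB outC) :
    (q.map f hf g hg).map f' hf' g' hg' = q.map (fun b => f' (f b)) (fun b => (hf' _).trans (hf b))
      (fun c => g' (g c)) (fun c => (hg' _).trans (hg c)) := rfl

theorem OD.map_id {B C : Type} {outB : B → S.Sym} {outC : C → S.Sym} {f : B → B} {g : C → C}
    (h : ∀ b, f b = b) (h' : ∀ c, g c = c)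
    (hf : ∀ b, outB (f b) = outB b) (hg : ∀ c, outC (g c) = outC c) (q : OD outB outC) :
    q.map f hf g hg = q := OD.ext (h _) (Lab.ext rfl fun _ => h' _)

theorem IsOperadHom.comp {B C D : Type} {outB : B → S.Sym} {outC : C → S.Sym} {outD : D → S.Sym}
    {a : Operad m outB} {b : Operad m outC} {c : Operad m outD} {f : B → C} {g : C → D}
    {hf : ∀ x, outC (f x) = outB x} {hg : ∀ x, outD (g x) = outC x}
    (h' : IsOperadHom b c g hg) (h : IsOperadHom a b f hf) :
    IsOperadHom a c (fun x => g (f x)) fun x => (hg _).trans (hf x) :=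
  ⟨fun q => by rw [h.mul, h'.mul, OD.map_map], fun o => by rw [h.one, h'.one]⟩

theorem IsOperadHom.id {B : Type} {outB : B → S.Sym} (a : Operad m outB) {f : B → B}
    (h : ∀ x, f x = x) (hf : ∀ x, outB (f x) = outB x) : IsOperadHom a a f hf :=
  ⟨fun q => by rw [h, OD.map_id h h], fun o => h _⟩

/-- The composite of an element with units. -/
abbrev Operad.withOnes {B : Type} {outB : B → S.Sym} (a : Operad m outB) (x : B) : OD outB outB :=
  ⟨x, ⟨outB x, fun i => a.one (S.inp (outB x) i),
    fun _ => (congrArg S.out (a.out_one _)).trans (m.one.out_eq _)⟩, rfl⟩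

/-- Transport of an operad structure along a bijection. -/
def Operad.transport {B C : Type} {outB : B → S.Sym} {outC : C → S.Sym} (a : Operad m outC)
    (e : B ≃ C) (he : ∀ x, outC (e x) = outB x) : Operad m outB where
  mul q := e.symm (a.mul (q.map e he e he))
  out_mul q := by rw [← he, Equiv.apply_symm_apply, a.out_mul, OD.out_map]
  one o := e.symm (a.one o)
  out_one o := by rw [← he, Equiv.apply_symm_apply, a.out_one]
  one_mul x := by
    rw [Equiv.symm_apply_eq]
    refine Eq.trans (congrArg a.mul (OD.ext ?_ ?_)) (a.one_mul (e x))
    · exact (Equiv.apply_symm_apply e _).trans (congrArg (fun s => a.one (S.out s)) (he x).symm)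
    · exact unitT_map m e (fun y => congrArg S.out (he y)) x
  mul_one x := by
    rw [Equiv.symm_apply_eq]
    refine Eq.trans (congrArg a.mul (OD.ext (q := a.withOnes (e x)) rfl ?_)) (a.mul_one (e x))
    refine Lab.ext (he x).symm fun i => (Equiv.apply_symm_apply e _).trans (congrArg a.one ?_)
    exact (inp_cast _ _ (he x).symm i).symm
  assoc q := by
    let q' : OD outC (OD.out m : OD outC outC → S.Sym) :=
      q.map e he (OD.map e he e he) (OD.out_map m e he e he)
    refine congrArg e.symm (Eq.trans (congrArg a.mul
      (OD.ext (q := (q'.assoc m).map a.mul a.out_mul id fun _ => rfl) ?_ rfl)) ((a.assoc q').trans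
      (congrArg a.mul (OD.ext (p := q'.map id (fun _ => rfl) a.mul a.out_mul) rfl ?_))))
    · exact Equiv.apply_symm_apply e _
    · exact Lab.ext rfl fun i => (Equiv.apply_symm_apply e _).symm

theorem Operad.transport_isOperadHom {B C : Type} {outB : B → S.Sym} {outC : C → S.Sym}
    (a : Operad m outC) (e : B ≃ C) (he : ∀ x, outC (e x) = outB x) :
    IsOperadHom (a.transport e he) a e he :=
  ⟨fun _ => Equiv.apply_symm_apply e _, fun _ => Equiv.apply_symm_apply e _⟩

theorem IsOperadHom.symm {B C : Type} {outB : B → S.Sym} {outC : C → S.Sym} {a : Operad m outB}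
    {b : Operad m outC} (e : B ≃ C) (he : ∀ x, outC (e x) = outB x) (h : IsOperadHom a b e he) :
    IsOperadHom b a e.symm fun x => by rw [← he, Equiv.apply_symm_apply] := by
  refine ⟨fun q => ?_, fun o => ?_⟩
  · rw [Equiv.symm_apply_eq, h.mul, OD.map_map, OD.map_id] <;> simp
  · rw [Equiv.symm_apply_eq, h.one]

end

/-! ### Monoids for the second tensor product as natural families of operads -/

section LabOperad

variable {O Y Z : Type} {S : Sig O} (m : MonStr S) {A B : Sig S.Sym}
  {τ : Y → S.Sym} {σ : Z → S.Sym}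

/-- The symbols of the unit have no inputs to be labelled. -/
def nullary (τ : Y → S.Sym) (o : O) : Lab (odotUnit m) τ := ⟨o, Fin.elim0, fun i => i.elim0⟩

theorem eq_nullary (p : Lab (odotUnit m) τ) : p = nullary m τ p.head :=
  Lab.ext rfl fun i => i.elim0

variable {m}

/-- The labelled symbols of a monoid form an operad. -/
def labOperad (b : HMonStr m B) (τ : Y → S.Sym) : Operad m (Lab.out : Lab B τ → S.Sym) where
  mul q := b.mul.lab ((odotLab m).symm q)
  out_mul q := (Hom.lab_out _ _).trans (odotLab_symm_out m q)
  one o := b.one.lab (nullary m τ o)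
  out_one o := Hom.lab_out _ _
  one_mul z := by
    let q : OD (Lab.out : Lab (odotUnit m) τ → S.Sym) (Lab.out : Lab B τ → S.Sym) :=
      ⟨nullary m τ (S.out z.out), unitT m _ z, rfl⟩
    have h := congrArg (fun f => Hom.lab f ((odotLab m).symm q)) b.one_mul
    simp only [VHom.comp_lab] at h
    rw [odotLeftUnitor_lab m z _ (by rw [Equiv.apply_symm_apply])] at h
    refine Eq.trans (congrArg b.mul.lab ?_) h
    rw [Equiv.symm_apply_eq, odotHom_lab, Equiv.apply_symm_apply]
    rfl
  mul_one z := by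
    have h := congrArg (fun f => Hom.lab f z) b.mul_one
    simp only [VHom.comp_lab, ident_lab] at h
    refine Eq.trans (congrArg b.mul.lab ?_) h
    rw [Equiv.symm_apply_eq, odotHom_lab, odotRightUnitor_lab]
    rfl
  assoc q := by
    let q' : OD (Lab.out : Lab B τ → S.Sym) (Lab.out : Lab (odot m B B) τ → S.Sym) :=
      q.map id (fun _ => rfl) (odotLab m).symm (odotLab_symm_out m)
    have h := congrArg (fun f => Hom.lab f ((odotLab m).symm q')) b.assoc
    simp only [VHom.comp_lab] at h
    have h0 : q'.map id (fun _ => rfl) (odotLab m) (fun _ => rfl) = q :=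
      OD.ext rfl (Lab.ext rfl fun i => Equiv.apply_symm_apply _ _)
    have h1 := odotAssoc_lab m ((odotLab m).symm q')
    rw [Equiv.apply_symm_apply, h0] at h1
    refine Eq.trans (congrArg b.mul.lab ?_) (h.trans (congrArg b.mul.lab ?_))
    · rw [Equiv.symm_apply_eq, odotHom_lab, ← h1]
      exact OD.ext (congrArg b.mul.lab (Equiv.symm_apply_apply _ _)) rfl
    · rw [Equiv.eq_symm_apply, odotHom_lab, Equiv.apply_symm_apply]
      rfl

theorem labOperad_mul (b : HMonStr m B) (p : Lab (odot m B B) τ) :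
    b.mul.lab p = (labOperad b τ).mul (odotLab m p) := by
  simp [labOperad]

theorem IsHMonHom.lab {a : HMonStr m A} {b : HMonStr m B} {f : VHom A B} (h : IsHMonHom m a b f)
    (τ : Y → S.Sym) : IsOperadHom (labOperad a τ) (labOperad b τ) f.lab f.lab_out := by
  refine ⟨fun q => ?_, fun o => ?_⟩
  · have h1 := congrArg (fun f => Hom.lab f ((odotLab m).symm q)) h.mul
    simp only [VHom.comp_lab] at h1
    refine h1.trans ?_
    rw [labOperad_mul, odotHom_lab, Equiv.apply_symm_apply]
  · exact congrArg (fun f => Hom.lab f (nullary m τ o)) h.one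

/-- By `VHom.ext_lab` the conditions on a homomorphism can be tested on labelled symbols. -/
theorem isHMonHom_of_lab {a : HMonStr m A} {b : HMonStr m B} {f : VHom A B}
    (h : ∀ (Y : Type) (τ : Y → S.Sym),
      IsOperadHom (labOperad a τ) (labOperad b τ) f.lab f.lab_out) : IsHMonHom m a b f := by
  refine ⟨VHom.ext_lab fun Y τ p => ?_, VHom.ext_lab fun Y τ p => ?_⟩
  · rw [VHom.comp_lab, VHom.comp_lab, labOperad_mul, (h Y τ).mul, labOperad_mul, odotHom_lab]
  · rw [eq_nullary m p]
    exact (h Y τ).one _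

theorem labOperad_map_isOperadHom (b : HMonStr m B) (g : Y → Z) (hg : ∀ y, σ (g y) = τ y) :
    IsOperadHom (labOperad b τ) (labOperad b σ) (Lab.map g hg) (fun _ => rfl) := by
  refine ⟨fun q => ?_, fun o => ?_⟩
  · refine (Hom.lab_map _ g hg _).symm.trans ?_
    refine congrArg b.mul.lab ?_
    rw [Equiv.eq_symm_apply, odotLab_map, Equiv.apply_symm_apply]
    rfl
  · refine (Hom.lab_map _ g hg _).symm.trans (congrArg b.one.lab (eq_nullary m _))

theorem labOperad_sum_mul (b : HMonStr m B) (w : Y → ℕ)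
    (q : OD (Lab.out : Lab B τ → S.Sym) (Lab.out : Lab B τ → S.Sym)) :
    ((labOperad b τ).mul q).sum w = q.fst.sum w + q.snd.sum (Lab.sum w) := by
  have h : (labOperad b τ).mul q = b.mul.lab ((odotLab m).symm q) := rfl
  rw [h, Hom.lab_sum, odotLab_sum m, Equiv.apply_symm_apply]

theorem labOperad_sum_one (b : HMonStr m B) (w : Y → ℕ) (o : O) :
    ((labOperad b τ).one o).sum w = 0 := Hom.lab_sum _ _ _

/-- A monoid structure from a family of operad structures on the labelled symbols. -/
def HMonStr.ofOperad (mul : VHom (odot m B B) B) (one : VHom (odotUnit m) B)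
    (b : ∀ (Y : Type) (τ : Y → S.Sym), Operad m (Lab.out : Lab B τ → S.Sym))
    (hmul : ∀ (Y : Type) (τ : Y → S.Sym) (p : Lab (odot m B B) τ),
      mul.lab p = (b Y τ).mul (odotLab m p))
    (hone : ∀ (Y : Type) (τ : Y → S.Sym) (o : O), one.lab (nullary m τ o) = (b Y τ).one o) :
    HMonStr m B where
  mul := mul
  one := one
  one_mul := VHom.ext_lab fun Y τ p => by
    -- A labelled symbol of `I_⊙ ⊙ B` is a unit composed with a single labelled symbol `z` of `B`.
    obtain ⟨z, hz, h⟩ := unitT_eq m (odotLab m p).snd _ (odotLab m p).eq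
    rw [odotLeftUnitor_lab m z p h, VHom.comp_lab, hmul, odotHom_lab]
    refine Eq.trans (congrArg (b Y τ).mul (OD.ext (q := ⟨(b Y τ).one (S.out z.out),
      unitT m _ z, ((b Y τ).out_one _).symm⟩) ?_ ?_)) ((b Y τ).one_mul z)
    · refine Eq.trans (congrArg one.lab ?_) (hone Y τ _)
      rw [hz]
      exact eq_nullary m _
    · exact h
  mul_one := VHom.ext_lab fun Y τ p => by
    rw [VHom.comp_lab, VHom.comp_lab, hmul, odotHom_lab, odotRightUnitor_lab]
    refine Eq.trans (congrArg (b Y τ).mul (OD.ext (q := (b Y τ).withOnes p) rfl ?_))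
      ((b Y τ).mul_one p)
    exact Lab.ext rfl fun i => hone _ _ _
  assoc := VHom.ext_lab fun Y τ p => by
    rw [VHom.comp_lab, VHom.comp_lab, VHom.comp_lab, hmul, hmul, odotHom_lab, odotHom_lab]
    let q : OD (Lab.out : Lab B τ → S.Sym)
        (OD.out m : OD (Lab.out : Lab B τ → S.Sym) (Lab.out : Lab B τ → S.Sym) → S.Sym) :=
      (odotLab m p).map id (fun _ => rfl) (odotLab m) (fun _ => rfl)
    refine Eq.trans (congrArg (b Y τ).mul (OD.ext
      (q := (q.assoc m).map (b Y τ).mul (b Y τ).out_mul id fun _ => rfl) ?_ ?_))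
      (((b Y τ).assoc q).trans (congrArg (b Y τ).mul (OD.ext rfl (Lab.ext rfl fun i =>
        (hmul Y τ _).symm))))
    · rw [← odotAssoc_lab]
      exact hmul Y τ _
    · rw [← odotAssoc_lab]
      rfl

end LabOperad

/-! ### The web monoid -/

section

variable {O Y Z : Type} {S : Sig O} (m : MonStr S) {A B : Sig S.Sym}
  {τ : Y → S.Sym} {σ : Z → S.Sym}

theorem Operad.ext {m : MonStr S} {B : Type} {outB : B → S.Sym} {a b : Operad m outB}
    (h : ∀ q, a.mul q = b.mul q) (h' : ∀ o, a.one o = b.one o) : a = b := by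
  obtain ⟨_, _, _, _, _, _, _⟩ := a
  obtain ⟨_, _, _, _, _, _, _⟩ := b
  obtain rfl := funext h
  obtain rfl := funext h'
  rfl

/-- The operad of labelled trees. -/
noncomputable def treeOperad (τ : Y → S.Sym) :
    Operad m (Lab.out : Lab (treeSig m) τ → S.Sym) :=
  (Tree.operad m τ).transport (treeLab m) (treeLab_out m)

theorem treeLab_isOperadHom :
    IsOperadHom (treeOperad m τ) (Tree.operad m τ) (treeLab m) (treeLab_out m) :=
  Operad.transport_isOperadHom _ _ _

/-- The labelled tree with one node. -/
noncomputable def treeSingle (τ : Y → S.Sym) (y : Y) : Lab (treeSig m) τ :=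
  (treeLab m).symm (Tree.single m y)

theorem treeSingle_out (y : Y) : (treeSingle m τ y).out = τ y := by
  rw [← treeLab_out, treeSingle, Equiv.apply_symm_apply, Tree.out_single]

theorem treeSingle_map (g : Y → Z) (hg : ∀ y, σ (g y) = τ y) (y : Y) :
    (treeSingle m τ y).map g hg = treeSingle m σ (g y) := by
  rw [treeSingle, treeSingle, Equiv.eq_symm_apply, treeLab_map, Equiv.apply_symm_apply,
    Tree.map_single]

theorem treeSingle_sum (w : Y → ℕ) (y : Y) : (treeSingle m τ y).sum w = w y := by
  rw [← treeLab_sum, treeSingle, Equiv.apply_symm_apply]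
  have h : Tree.sum w (Tree.single m y : Tree τ) = w y + ∑ _i : Fin (S.ar (τ y)), 0 := rfl
  rw [h, Finset.sum_const_zero, add_zero]

theorem treeOperad_sum_mul (w : Y → ℕ)
    (q : OD (Lab.out : Lab (treeSig m) τ → S.Sym) (Lab.out : Lab (treeSig m) τ → S.Sym)) :
    ((treeOperad m τ).mul q).sum w = q.fst.sum w + q.snd.sum (Lab.sum w) := by
  rw [← treeLab_sum, (treeLab_isOperadHom m).mul]
  refine (Tree.sum_graft w _).trans (congrArg₂ _ (treeLab_sum m w _) ?_)
  exact Finset.sum_congr rfl fun i _ => treeLab_sum m w _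

theorem treeOperad_sum_one (w : Y → ℕ) (o : O) : ((treeOperad m τ).one o).sum w = 0 := by
  rw [← treeLab_sum, (treeLab_isOperadHom m).one]
  rfl

theorem treeOperad_map_isOperadHom (g : Y → Z) (hg : ∀ y, σ (g y) = τ y) :
    IsOperadHom (treeOperad m τ) (treeOperad m σ) (Lab.map g hg) (fun _ => rfl) := by
  refine ⟨fun q => (treeLab m).injective ?_, fun o => (treeLab m).injective ?_⟩
  · rw [treeLab_map, (treeLab_isOperadHom m).mul, (treeLab_isOperadHom m).mul,
      (Tree.map_isOperadHom g hg).mul]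
    refine congrArg _ (OD.ext ?_ (Lab.ext rfl fun i => ?_))
    · exact (treeLab_map m g hg _).symm
    · exact (treeLab_map m g hg _).symm
  · rw [treeLab_map, (treeLab_isOperadHom m).one, (treeLab_isOperadHom m).one,
      (Tree.map_isOperadHom g hg).one]

section Extend

variable {m} {X : Type} {outX : X → S.Sym} (b : Operad m outX) (f : Y → X)
  (hf : ∀ y, outX (f y) = τ y)

/-- The extension of a map to a homomorphism on labelled trees. -/
noncomputable def extend (p : Lab (treeSig m) τ) : X := Tree.lift b f hf (treeLab m p)

theorem extend_out (p : Lab (treeSig m) τ) : outX (extend b f hf p) = p.out :=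
  (Tree.out_lift b f hf _).trans (treeLab_out m p)

theorem extend_isOperadHom :
    IsOperadHom (treeOperad m τ) b (extend b f hf) (extend_out b f hf) :=
  (Tree.lift_isOperadHom b f hf).comp (treeLab_isOperadHom m)

theorem extend_treeSingle (y : Y) : extend b f hf (treeSingle m τ y) = f y := by
  rw [extend, treeSingle, Equiv.apply_symm_apply, Tree.lift_single]

theorem eq_extend {g : Lab (treeSig m) τ → X} {hg : ∀ p, outX (g p) = p.out}
    (h : IsOperadHom (treeOperad m τ) b g hg) (h' : ∀ y, g (treeSingle m τ y) = f y)
    (p : Lab (treeSig m) τ) : g p = extend b f hf p := by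
  have h1 := Tree.eq_lift b f hf (fun t => g ((treeLab m).symm t)) _
    (h.comp (IsOperadHom.symm (treeLab m) _ (treeLab_isOperadHom m))) h' (treeLab m p)
  rwa [Equiv.symm_apply_apply] at h1

/-- Uniqueness of extensions. It reduces naturality and the monad laws of flattening to one-node
trees. -/
theorem hom_ext {g g' : Lab (treeSig m) τ → X} {hg : ∀ p, outX (g p) = p.out}
    {hg' : ∀ p, outX (g' p) = p.out}
    (h : IsOperadHom (treeOperad m τ) b g hg) (h' : IsOperadHom (treeOperad m τ) b g' hg')
    (hs : ∀ y, g (treeSingle m τ y) = g' (treeSingle m τ y))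
    (p : Lab (treeSig m) τ) : g p = g' p := by
  have hf : ∀ y, outX (g' (treeSingle m τ y)) = τ y :=
    fun y => (hg' _).trans (treeSingle_out m y)
  rw [eq_extend b _ hf h hs p, eq_extend b _ hf h' (fun _ => rfl) p]

end Extend

/-- Flattening of trees of trees. -/
noncomputable def flat (τ : Y → S.Sym)
    (p : Lab (treeSig m) (Lab.out : Lab (treeSig m) τ → S.Sym)) : Lab (treeSig m) τ :=
  extend (treeOperad m τ) id (fun _ => rfl) p

theorem flat_out (p : Lab (treeSig m) (Lab.out : Lab (treeSig m) τ → S.Sym)) :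
    (flat m τ p).out = p.out := extend_out _ _ _ _

theorem flat_isOperadHom (τ : Y → S.Sym) :
    IsOperadHom (treeOperad m (Lab.out : Lab (treeSig m) τ → S.Sym)) (treeOperad m τ) (flat m τ)
      (flat_out m) := extend_isOperadHom _ _ _

theorem flat_treeSingle (p : Lab (treeSig m) τ) : flat m τ (treeSingle m _ p) = p :=
  extend_treeSingle _ _ _ _

theorem flat_map (g : Y → Z) (hg : ∀ y, σ (g y) = τ y)
    (p : Lab (treeSig m) (Lab.out : Lab (treeSig m) τ → S.Sym)) :
    flat m σ (p.map (Lab.map g hg) fun _ => rfl) = (flat m τ p).map g hg := by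
  refine hom_ext (treeOperad m σ)
    ((flat_isOperadHom m σ).comp (treeOperad_map_isOperadHom m (Lab.map g hg) fun _ => rfl))
    ((treeOperad_map_isOperadHom m g hg).comp (flat_isOperadHom m τ)) (fun y => ?_) p
  rw [treeSingle_map, flat_treeSingle]
  exact congrArg (Lab.map g hg) (flat_treeSingle m y).symm

theorem flat_map_treeSingle (p : Lab (treeSig m) τ) :
    flat m τ (p.map (treeSingle m τ) (treeSingle_out m)) = p := by
  refine hom_ext (treeOperad m τ)
    ((flat_isOperadHom m τ).comp (treeOperad_map_isOperadHom m (treeSingle m τ) (treeSingle_out m)))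
    (IsOperadHom.id (treeOperad m τ) (fun _ => rfl) (f := id) (fun _ => rfl)) (fun y => ?_) p
  rw [treeSingle_map, flat_treeSingle]
  rfl

/-- Both sides are operad homomorphisms, and on a one-node tree both flatten its label. -/
theorem flat_flat (p : Lab (treeSig m)
    (Lab.out : Lab (treeSig m) (Lab.out : Lab (treeSig m) τ → S.Sym) → S.Sym)) :
    flat m τ (flat m _ p) = flat m τ (p.map (flat m τ) (flat_out m)) := by
  refine hom_ext (treeOperad m τ) ((flat_isOperadHom m τ).comp (flat_isOperadHom m _))
    ((flat_isOperadHom m τ).comp (treeOperad_map_isOperadHom m (flat m τ) (flat_out m)))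
    (fun y => ?_) p
  rw [treeSingle_map, flat_treeSingle, flat_treeSingle]

theorem flat_sum (w : Y → ℕ) (p : Lab (treeSig m) (Lab.out : Lab (treeSig m) τ → S.Sym)) :
    (flat m τ p).sum w = p.sum (Lab.sum w) := by
  rw [← treeLab_sum m (Lab.sum w)]
  exact Tree.sum_lift _ _ _ _ _ (fun _ => rfl) (treeOperad_sum_one m w) (treeOperad_sum_mul m w) _

theorem exists_treeMul : ∃ f : VHom (odot m (treeSig m) (treeSig m)) (treeSig m),
    ∀ (Y : Type) (τ : Y → S.Sym) (p : Lab (odot m (treeSig m) (treeSig m)) τ),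
      f.lab p = (treeOperad m τ).mul (odotLab m p) :=
  exists_hom_lab (fun _ τ p => (treeOperad m τ).mul (odotLab m p))
    (fun _ τ _ => (treeOperad m τ).out_mul _)
    (fun _ _ _ _ g hg p => ((treeOperad_map_isOperadHom m g hg).mul (odotLab m p)).symm)
    (fun _ _ p w => (treeOperad_sum_mul m w _).trans (odotLab_sum m w p).symm)

theorem exists_treeOne : ∃ f : VHom (odotUnit m) (treeSig m),
    ∀ (Y : Type) (τ : Y → S.Sym) (p : Lab (odotUnit m) τ), f.lab p = (treeOperad m τ).one p.head :=
  exists_hom_lab (A := odotUnit m) (fun _ τ p => (treeOperad m τ).one p.head)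
    (fun _ τ _ => (treeOperad m τ).out_one _)
    (fun _ _ _ _ g hg p => ((treeOperad_map_isOperadHom m g hg).one p.head).symm)
    (fun _ _ _ w => treeOperad_sum_one m w _)

theorem exists_treeUnit : ∃ f : VHom (unit S.Sym) (treeSig m),
    ∀ (Y : Type) (τ : Y → S.Sym) (p : Lab (unit S.Sym) τ),
      f.lab p = treeSingle m τ (p.arg (0 : Fin 1)) :=
  exists_hom_lab (A := unit S.Sym) (fun _ τ p => treeSingle m τ (p.arg (0 : Fin 1)))
    (fun _ _ p => (treeSingle_out m _).trans (p.typed _))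
    (fun _ _ _ _ g hg p => (treeSingle_map m g hg (p.arg (0 : Fin 1))).symm)
    (fun _ _ p w => (treeSingle_sum m w _).trans (Fin.sum_univ_one fun i : Fin 1 => w (p.arg i)).symm)

theorem exists_treeFlat : ∃ f : VHom (tensor (treeSig m) (treeSig m)) (treeSig m),
    ∀ (Y : Type) (τ : Y → S.Sym) (p : Lab (tensor (treeSig m) (treeSig m)) τ),
      f.lab p = flat m τ (tensorLab p) :=
  exists_hom_lab (fun _ τ p => flat m τ (tensorLab p))
    (fun _ _ _ => flat_out m _)
    (fun _ _ _ _ g hg p => flat_map m g hg (tensorLab p))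
    (fun _ _ p w => (flat_sum m w _).trans (tensorLab_sum w p))

/-- The free monoid of trees. -/
noncomputable def treeFree : HMonStr m (treeSig m) :=
  HMonStr.ofOperad (exists_treeMul m).choose (exists_treeOne m).choose
    (fun _ τ => treeOperad m τ) (exists_treeMul m).choose_spec
    (fun Y τ _ => (exists_treeOne m).choose_spec Y τ _)

theorem labOperad_treeFree (τ : Y → S.Sym) : labOperad (treeFree m) τ = treeOperad m τ := by
  refine Operad.ext (fun q => ?_) (fun o => (exists_treeOne m).choose_spec Y τ _)
  refine ((exists_treeMul m).choose_spec Y τ _).trans ?_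
  rw [Equiv.apply_symm_apply]

/-- The monoid of trees under substitution. -/
noncomputable def treeWeb : MonStr (treeSig m) where
  mul := (exists_treeFlat m).choose
  one := (exists_treeUnit m).choose
  one_mul := VHom.ext_lab fun Y τ p => by
    rw [VHom.comp_lab, (exists_treeFlat m).choose_spec, tensorHom_lab,
      (exists_treeUnit m).choose_spec, flat_treeSingle, leftUnitor_lab]
    rfl
  mul_one := VHom.ext_lab fun Y τ p => by
    rw [VHom.comp_lab, VHom.comp_lab, (exists_treeFlat m).choose_spec, tensorHom_lab,
      rightUnitor_lab]
    refine Eq.trans (congrArg (flat m τ) ?_) (flat_map_treeSingle m p)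
    exact Lab.ext rfl fun i => (exists_treeUnit m).choose_spec _ _ _
  assoc := VHom.ext_lab fun Y τ p => by
    have hw := (exists_treeFlat m).choose_spec
    rw [VHom.comp_lab, VHom.comp_lab, VHom.comp_lab, hw, hw, tensorHom_lab, tensorHom_lab]
    refine Eq.trans (congrArg (flat m τ) (hw _ _ (tensorLab
      ((assocHom (treeSig m) (treeSig m) (treeSig m)).lab p)))) ?_
    rw [assocHom_lab, flat_flat]
    exact congrArg (flat m τ) (Lab.ext rfl fun i => (hw _ _ _).symm)

/-- A morphism `f` on `I_⊗` amounts to generators `e` in the operads of labelled symbols of `B`.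
Their extensions to trees are natural by uniqueness and preserve weights by `Tree.sum_lift`, hence
come from a morphism. -/
theorem treeFree_isFree : IsFreeHMon m (treeFree m) (treeWeb m).one := by
  intro B b f
  let e : ∀ (Y : Type) (τ : Y → S.Sym) (y : Y), Lab B τ :=
    fun Y τ y => f.lab ⟨τ y, fun _ => y, fun _ => rfl⟩
  have he : ∀ (Y : Type) (τ : Y → S.Sym) (y : Y), (e Y τ y).out = τ y := fun Y τ y => f.lab_out _
  have heg : ∀ (Y Z : Type) (τ : Y → S.Sym) (σ : Z → S.Sym) (g : Y → Z)
      (hg : ∀ y, σ (g y) = τ y) (y : Y), (e Y τ y).map g hg = e Z σ (g y) := by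
    intro Y Z τ σ g hg y
    have h : (⟨τ y, fun _ => g y, fun _ => hg y⟩ : Lab (unit S.Sym) σ) =
      ⟨σ (g y), fun _ => g y, fun _ => rfl⟩ := Lab.ext (hg y).symm fun _ => rfl
    exact congrArg f.lab h
  have hone : ∀ (Y : Type) (τ : Y → S.Sym) (p : Lab (unit S.Sym) τ),
      p = ⟨τ (p.arg (0 : Fin 1)), fun _ => p.arg (0 : Fin 1), fun _ => rfl⟩ := fun Y τ p =>
    Lab.ext (p.typed _).symm fun i => congrArg p.arg (Subsingleton.elim (α := Fin 1) _ _)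
  obtain ⟨g, hg⟩ := exists_hom_lab (A := treeSig m) (B := B)
    (fun Y τ p => extend (labOperad b τ) (e Y τ) (he Y τ) p)
    (fun Y τ p => extend_out _ _ _ _)
    (fun Y Z τ σ g hg p => by
      refine hom_ext (labOperad b σ)
        ((extend_isOperadHom _ _ _).comp (treeOperad_map_isOperadHom m g hg))
        ((labOperad_map_isOperadHom b g hg).comp (extend_isOperadHom _ _ _)) (fun y => ?_) p
      rw [treeSingle_map, extend_treeSingle, extend_treeSingle, heg])
    (fun Y τ p w => by
      rw [← treeLab_sum m w]
      exact Tree.sum_lift _ _ _ _ _ (fun y => (f.lab_sum _ _).trans (Fin.sum_univ_one _))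
        (labOperad_sum_one b w) (labOperad_sum_mul b w) _)
  refine ⟨g, ⟨isHMonHom_of_lab fun Y τ => ?_, VHom.ext_lab fun Y τ p => ?_⟩, ?_⟩
  · rw [labOperad_treeFree]
    have h := extend_isOperadHom (labOperad b τ) (e Y τ) (he Y τ)
    have h1 : g.lab = extend (labOperad b τ) (e Y τ) (he Y τ) := funext (hg Y τ)
    exact ⟨fun q => by simpa only [← h1] using h.mul q, fun o => by simpa only [← h1] using h.one o⟩
  · rw [VHom.comp_lab, hg]
    refine (congrArg _ ((exists_treeUnit m).choose_spec Y τ p)).trans ?_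
    rw [extend_treeSingle]
    exact congrArg f.lab (hone Y τ p).symm
  · rintro g' ⟨h1, rfl⟩
    refine VHom.ext_lab fun Y τ p => (Eq.trans ?_ (hg Y τ p).symm)
    have h2 := h1.lab τ
    rw [labOperad_treeFree] at h2
    refine eq_extend _ _ _ h2 (fun y => ?_) p
    exact congrArg g'.lab ((exists_treeUnit m).choose_spec Y τ ⟨τ y, fun _ => y, fun _ => rfl⟩).symm

/-- On labelled symbols `φ` becomes the identity (`distrib_lab`), and what remains is that `flat`
respects grafting. -/
theorem tree_main : (treeFree m).mul.comp (odotHom m (treeWeb m).mul (treeWeb m).mul) =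
    ((treeWeb m).mul.comp (tensorHom (treeFree m).mul (Hom.ident (treeSig m)))).comp
      (distrib m (treeSig m) (treeSig m) (treeSig m)) := by
  refine VHom.ext_lab fun Y τ p => ?_
  have hm : ∀ (Y : Type) (τ : Y → S.Sym) (p), (treeFree m).mul.lab p =
      (treeOperad m τ).mul (odotLab m p) := (exists_treeMul m).choose_spec
  have hw : ∀ (Y : Type) (τ : Y → S.Sym) (p), (treeWeb m).mul.lab p = flat m τ (tensorLab p) :=
    (exists_treeFlat m).choose_spec
  rw [VHom.comp_lab, VHom.comp_lab, VHom.comp_lab, hm, hw, odotHom_lab, tensorHom_lab]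
  have h1 : (tensorLab ((distrib m (treeSig m) (treeSig m) (treeSig m)).lab p)).map
      (Hom.ident (treeSig m)).lab (fun _ => rfl) =
        tensorLab ((distrib m (treeSig m) (treeSig m) (treeSig m)).lab p) := rfl
  refine Eq.trans ?_ (congrArg (fun x => flat m τ ((treeFree m).mul.lab x)) h1).symm
  rw [hm, (flat_isOperadHom m τ).mul, distrib_lab]
  exact congrArg _ (OD.ext (hw _ _ _) (Lab.ext rfl fun i => hw _ _ _))

theorem exists_webMonoid : Nonempty (WebMonoid m) :=
  ⟨⟨treeSig m, treeFree m, treeWeb m, treeFree_isFree m, tree_main m⟩⟩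

end

/-! ### Amalgamation orders -/

section Precedes

variable {O Q Y : Type} {A : Sig O} {N : Sig Q} {u : O → Q} {τ : Y → O}

/-- The label `s` precedes the label `s'` in the order of the inputs of the image of `p`. -/
def Precedes (f : Hom u A N) (p : Lab A τ) (s s' : Y) : Prop :=
  ∃ i j, p.arg i = s ∧ p.arg j = s' ∧ (f.perm p.head i : ℕ) < f.perm p.head j

theorem Hom.perm_val_eq {B : Sig Q} {f g : Hom u A B} (h : f = g) (a : A.Sym)
    (i : Fin (A.ar a)) : (f.perm a i : ℕ) = g.perm a i := by
  subst h; rfl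

theorem finSigmaFinEquiv_lt {k : ℕ} {n : Fin k → ℕ} (x y : Σ i, Fin (n i)) (h : x.1 < y.1) :
    (finSigmaFinEquiv x : ℕ) < finSigmaFinEquiv y := by
  -- Extension by zero turns the offsets of the blocks into sums over initial segments of `ℕ`.
  let g : ℕ → ℕ := fun j => if h : j < k then n ⟨j, h⟩ else 0
  have hg : ∀ a : Fin k, ∑ i : Fin a, n (Fin.castLE a.2.le i) = ∑ j ∈ Finset.range a, g j := by
    intro a
    rw [← Fin.sum_univ_eq_sum_range]
    refine Finset.sum_congr rfl fun i _ => ?_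
    have : g i = n ⟨i, i.2.trans a.2⟩ := dif_pos _
    exact this.symm
  rw [finSigmaFinEquiv_apply, finSigmaFinEquiv_apply, hg, hg]
  have h1 : ∑ j ∈ Finset.range x.1, g j + g x.1 ≤ ∑ j ∈ Finset.range y.1, g j := by
    rw [← Finset.sum_range_succ]
    exact Finset.sum_le_sum_of_subset (Finset.range_mono h)
  have h2 : (x.2 : ℕ) < g x.1 := by
    have : g x.1 = n x.1 := dif_pos x.1.2
    rw [this]
    exact x.2.2
  omega

theorem block_fst {m m' : ℕ} (σ : Fin m ≃ Fin m') (n : Fin m → ℕ) (n' : Fin m' → ℕ)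
    (ρ : ∀ k, Fin (n (σ.symm k)) ≃ Fin (n' k)) (x : Σ i, Fin (n i)) :
    (block σ n n' ρ x).1 = σ x.1 := by
  obtain ⟨z, rfl⟩ := (block σ n n' ρ).symm.surjective x
  rw [Equiv.apply_symm_apply]
  exact (Equiv.apply_symm_apply σ z.1).symm

theorem conj_apply {P P' R R' : Type} (e : P ≃ R) (θ : P ≃ P') (e' : P' ≃ R') (x : P) :
    (e.symm.trans (θ.trans e')) (e x) = e' (θ x) := by
  simp

/-- This is where standard amalgamation enters: composition in `N` places the blocks side by side,
so if `P` precedes `P'`, every label of `P` precedes every label of `P'`. -/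
theorem Precedes.mulT {m : MonStr A} {n : MonStr N} (hn : n.Standard) {f : Hom u A N}
    (hf : IsMonHom m n f) {q : Lab A (Lab.out : Lab A τ → O)} {P P' : Lab A τ}
    (h : Precedes f q P P') {k : Fin (A.ar P.head)} {l : Fin (A.ar P'.head)} :
    Precedes f (mulT m q) (P.arg k) (P'.arg l) := by
  obtain ⟨i, j, rfl, rfl, h⟩ := h
  let p : Comp A A := ⟨q.head, fun i => (q.arg i).head, q.typed⟩
  have harg : ∀ x : (Σ i, Fin (A.ar (q.arg i).head)),
      (Web.mulT m q).arg (m.mul.perm p (finSigmaFinEquiv x)) = (q.arg x.1).arg x.2 := fun x => by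
    have : finSigmaFinEquiv.symm ((m.mul.perm p).symm (m.mul.perm p (finSigmaFinEquiv x))) = x := by
      simp
    exact congrArg (fun r : (Σ i, Fin (A.ar (q.arg i).head)) => (q.arg r.1).arg r.2) this
  -- Since `f` is a homomorphism and the multiplication of `N` is strict, the place in the image is
  -- lexicographic, with the block index permuted by `f`.
  have hval : ∀ x : (Σ i, Fin (A.ar (q.arg i).head)), ∃ z : (Σ k, Fin (N.ar (f.toFun (p.arg
      ((f.perm q.head).symm k))))), z.1 = f.perm q.head x.1 ∧
        (f.perm _ (m.mul.perm p (finSigmaFinEquiv x)) : ℕ) = finSigmaFinEquiv z := fun x => by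
    have h1 := Hom.perm_val_eq hf.mul p (finSigmaFinEquiv x)
    have h2 := hn _ ((tensorHom f f).perm p (finSigmaFinEquiv x))
    refine ⟨_, block_fst _ _ _ _ x, (h1.trans h2).trans (congrArg Fin.val (conj_apply
      finSigmaFinEquiv (block (f.perm p.head) (fun i => A.ar (p.arg i)) _
        fun k => f.perm (p.arg ((f.perm p.head).symm k))) finSigmaFinEquiv x))⟩
  obtain ⟨y, hy, hy'⟩ := hval ⟨i, k⟩
  obtain ⟨z, hz, hz'⟩ := hval ⟨j, l⟩
  refine ⟨_, _, harg ⟨i, k⟩, harg ⟨j, l⟩, ?_⟩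
  refine lt_of_eq_of_lt hy' (lt_of_lt_of_eq (finSigmaFinEquiv_lt _ _ ?_) hz'.symm)
  rw [hy, hz]
  exact h

theorem exists_arg_eq [DecidableEq Y] {p : Lab A τ} {s : Y}
    (h : p.sum (fun y => if y = s then 1 else 0) ≠ 0) : ∃ i, p.arg i = s := by
  by_contra hc
  push Not at hc
  exact h (Finset.sum_eq_zero fun i _ => if_neg (hc i))

theorem arg_inj [DecidableEq Y] {p : Lab A τ} {s : Y}
    (h : p.sum (fun y => if y = s then 1 else 0) ≤ 1) {i j} (hi : p.arg i = s) (hj : p.arg j = s) :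
    i = j := by
  have h1 : (Finset.univ.filter fun i => p.arg i = s).card ≤ 1 := by
    simpa [Lab.sum] using h
  exact Finset.card_le_one.1 h1 i (by simp [hi]) j (by simp [hj])

theorem precedes_or_precedes (f : Hom u A N) {p : Lab A τ} {s s' : Y} (hs : s ≠ s')
    (h : ∀ w, p.sum w = w s + w s') : Precedes f p s s' ∨ Precedes f p s' s := by
  classical
  obtain ⟨i, hi⟩ := exists_arg_eq (p := p) (s := s) (by simp [h])
  obtain ⟨j, hj⟩ := exists_arg_eq (p := p) (s := s') (by simp [h])
  have hij : (f.perm p.head i : ℕ) ≠ f.perm p.head j := fun e => hs (by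
    rw [← hi, ← hj, (f.perm p.head).injective (Fin.ext e)])
  rcases lt_or_gt_of_ne hij with h' | h'
  · exact Or.inl ⟨i, j, hi, hj, h'⟩
  · exact Or.inr ⟨j, i, hj, hi, h'⟩

/-- Each label occurs at most once, so its position is unique. -/
theorem Precedes.asymm (f : Hom u A N) {p : Lab A τ} {s₁ s₂ s₃ : Y} (h12 : s₁ ≠ s₂) (h13 : s₁ ≠ s₃)
    (h23 : s₂ ≠ s₃) (h : ∀ w, p.sum w = w s₁ + w s₂ + w s₃) {s s' : Y} (h1 : Precedes f p s s')
    (h2 : Precedes f p s' s) : False := by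
  classical
  have hle : ∀ s, p.sum (fun y => if y = s then 1 else 0) ≤ 1 := fun s => by
    rw [h]
    split_ifs <;> simp_all
  obtain ⟨i, j, hi, hj, hij⟩ := h1
  obtain ⟨j', i', hj', hi', hij'⟩ := h2
  rw [arg_inj (hle _) hj' hj, arg_inj (hle _) hi' hi] at hij'
  exact lt_asymm hij hij'

/-- Substitution of `t` for the label `b`. -/
noncomputable def subst [DecidableEq O] (m : MonStr A) (b : O) (t p : Lab A (id : O → O))
    (ht : t.out = b) : Lab A (id : O → O) :=
  mulT m (p.map (fun s => if s = b then t else unitT m id s) fun s => by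
    split_ifs with h
    · exact ht.trans h.symm
    · exact unitT_out m s)

theorem subst_sum [DecidableEq O] (m : MonStr A) (b : O) (t p : Lab A (id : O → O))
    (ht : t.out = b) (w : O → ℕ) :
    (subst m b t p ht).sum w = p.sum fun s => if s = b then t.sum w else w s := by
  rw [subst, mulT_sum, Lab.sum_map]
  refine congrArg (fun w => p.sum w) (funext fun s => ?_)
  split_ifs
  · rfl
  · exact unitT_sum m w s

/-- The label `s` is replaced by its unit, a block consisting of `s` alone, while `b` is replaced by
the block `t`. -/
theorem Precedes.subst_left [DecidableEq O] {m : MonStr A} {n : MonStr N} (hn : n.Standard)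
    {f : Hom u A N} (hf : IsMonHom m n f) {b : O} {t p : Lab A (id : O → O)} (ht : t.out = b)
    {s s' : O} (hs : s ≠ b) (h : Precedes f p b s) (h' : ∃ i, t.arg i = s') :
    Precedes f (subst m b t p ht) s' s := by
  obtain ⟨i, j, hi, hj, hij⟩ := h
  obtain ⟨k, rfl⟩ := h'
  have h1 : Precedes f (p.map (fun s => if s = b then t else unitT m id s) fun s => by
    split_ifs with h
    · exact ht.trans h.symm
    · exact unitT_out m s) t (unitT m id s) :=
    ⟨i, j, by simp [Lab.map, hi], by simp [Lab.map, hj, hs], hij⟩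
  exact h1.mulT hn hf (l := m.one.perm _ (0 : Fin 1))

theorem Precedes.subst_right [DecidableEq O] {m : MonStr A} {n : MonStr N} (hn : n.Standard)
    {f : Hom u A N} (hf : IsMonHom m n f) {b : O} {t p : Lab A (id : O → O)} (ht : t.out = b)
    {s s' : O} (hs : s ≠ b) (h : Precedes f p s b) (h' : ∃ i, t.arg i = s') :
    Precedes f (subst m b t p ht) s s' := by
  obtain ⟨i, j, hi, hj, hij⟩ := h
  obtain ⟨k, rfl⟩ := h'
  have h1 : Precedes f (p.map (fun s => if s = b then t else unitT m id s) fun s => by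
    split_ifs with h
    · exact ht.trans h.symm
    · exact unitT_out m s) (unitT m id s) t :=
    ⟨i, j, by simp [Lab.map, hi, hs], by simp [Lab.map, hj], hij⟩
  exact h1.mulT hn hf (k := m.one.perm _ (0 : Fin 1))

/-- Two symbols `t`, `t'` with inputs `b`, `s` and `b`, `s'` that yield the same symbol when they are
substituted for `b` in each other cannot have `b` in the same place. -/
theorem subst_conflict [DecidableEq O] {m : MonStr A} {n : MonStr N} (hn : n.Standard)
    {f : Hom u A N} (hf : IsMonHom m n f) {b s s' : O} (hs : s ≠ b) (hs' : s' ≠ b) (hss : s ≠ s')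
    {t t' : Lab A (id : O → O)} (ht : t.out = b) (ht' : t'.out = b)
    (hsum : ∀ w, t.sum w = w b + w s) (hsum' : ∀ w, t'.sum w = w b + w s')
    (h : subst m b t' t ht' = subst m b t t' ht) :
    ¬ (Precedes f t b s ∧ Precedes f t' b s') ∧ ¬ (Precedes f t s b ∧ Precedes f t' s' b) := by
  have e : ∃ i, t.arg i = s := exists_arg_eq (by simp [hsum])
  have e' : ∃ i, t'.arg i = s' := exists_arg_eq (by simp [hsum'])
  have h3 : ∀ w, (subst m b t' t ht').sum w = w b + w s' + w s := fun w => by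
    rw [subst_sum, hsum, if_pos rfl, if_neg hs, hsum']
  refine ⟨fun ⟨h1, h2⟩ => ?_, fun ⟨h1, h2⟩ => ?_⟩
  · exact Precedes.asymm f hs'.symm hs.symm hss.symm h3 (h1.subst_left hn hf ht' hs e')
      (h ▸ h2.subst_left hn hf ht hs' e)
  · exact Precedes.asymm f hs'.symm hs.symm hss.symm h3 (h1.subst_right hn hf ht' hs e')
      (h ▸ h2.subst_right hn hf ht hs' e)

end Precedes

/-! ### Grafting on inputs of given types -/

section Graft

variable {O : Type} {S : Sig O} {m : MonStr S} {B C : Type} {outB : B → S.Sym} {outC : C → S.Sym}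

theorem inp_one (m : MonStr S) (o : O) (i : Fin (S.ar (m.one.toFun o))) :
    S.inp (m.one.toFun o) i = o := m.one.inp_symm o i

theorem genO_one_sum (m : MonStr S) (o : O) (w : O → ℕ) : (genO (m.one.toFun o)).sum w = w o := by
  have h := lab_id_eq (unitT m (id : O → O) o)
  have h' : genO (m.one.toFun o) = unitT m (id : O → O) o := h.symm
  rw [h', unitT_sum]

/-- The composite of `a` with the element `φ o` at every input of type `o`. -/
def Operad.graft (b : Operad m outB) (a : B) (φ : O → B) (hφ : ∀ o, S.out (outB (φ o)) = o) : B :=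
  b.mul ⟨a, (genO (outB a)).map φ hφ, rfl⟩

theorem Operad.out_one_out (b : Operad m outB) (o : O) : S.out (outB (b.one o)) = o :=
  (congrArg S.out (b.out_one o)).trans (m.one.out_eq o)

theorem Operad.out_graft_out (b : Operad m outB) (a : B) (φ : O → B)
    (hφ : ∀ o, S.out (outB (φ o)) = o) : S.out (outB (b.graft a φ hφ)) = S.out (outB a) :=
  (congrArg S.out (b.out_mul _)).trans (OD.out_out m _)

theorem Operad.graft_congr (b : Operad m outB) (a : B) {φ φ' : O → B}
    (hφ : ∀ o, S.out (outB (φ o)) = o) (hφ' : ∀ o, S.out (outB (φ' o)) = o)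
    (h : ∀ i, φ (S.inp (outB a) i) = φ' (S.inp (outB a) i)) :
    b.graft a φ hφ = b.graft a φ' hφ' :=
  congrArg b.mul (OD.ext rfl (Lab.ext rfl h))

theorem Operad.out_graft_congr (b : Operad m outB) {a a' : B} {φ φ' : O → B}
    (hφ : ∀ o, S.out (outB (φ o)) = o) (hφ' : ∀ o, S.out (outB (φ' o)) = o)
    (ha : outB a = outB a') (h : ∀ o, outB (φ o) = outB (φ' o)) :
    outB (b.graft a φ hφ) = outB (b.graft a' φ' hφ') := by
  rw [Operad.graft, Operad.graft, b.out_mul, b.out_mul]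
  refine congrArg m.mul.toFun (comp_eq _ _ ha fun i => (h _).trans ?_)
  exact congrArg (fun o => outB (φ' o)) (inp_cast _ _ ha i).symm

theorem Operad.graft_one (b : Operad m outB) (a : B) : b.graft a b.one b.out_one_out = a :=
  b.mul_one a

theorem Operad.one_graft (b : Operad m outB) (o : O) (φ : O → B)
    (hφ : ∀ o, S.out (outB (φ o)) = o) : b.graft (b.one o) φ hφ = φ o := by
  refine Eq.trans (congrArg b.mul (OD.ext (q := ⟨b.one (S.out (outB (φ o))), unitT m _ (φ o),
    (b.out_one _).symm⟩) ?_ ?_)) (b.one_mul (φ o))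
  · exact congrArg b.one (hφ o).symm
  · refine Lab.ext ?_ fun i => ?_
    · exact (b.out_one o).trans (congrArg m.one.toFun (hφ o).symm)
    · refine congrArg φ ((inp_cast _ _ (b.out_one o) i).symm.trans ?_)
      exact inp_one m o _

/-- With arguments indexed by types instead of positions, associativity takes a form without `γ`:
the inputs of the composite are labelled by their types, which `lab_id_eq` recognizes. -/
theorem Operad.graft_graft (b : Operad m outB) (a : B) (φ ψ : O → B)
    (hφ : ∀ o, S.out (outB (φ o)) = o) (hψ : ∀ o, S.out (outB (ψ o)) = o) :
    b.graft (b.graft a φ hφ) ψ hψ = b.graft a (fun o => b.graft (φ o) ψ hψ)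
      (fun o => (b.out_graft_out _ _ _).trans (hφ o)) := by
  let q : OD outB (OD.out m : OD outB outB → S.Sym) :=
    ⟨a, (genO (outB a)).map (fun o => ⟨φ o, (genO (outB (φ o))).map ψ hψ, rfl⟩)
      (fun o => (OD.out_out m _).trans (hφ o)), rfl⟩
  refine Eq.trans (congrArg b.mul (OD.ext (q := (q.assoc m).map b.mul b.out_mul id fun _ => rfl)
    rfl ?_)) (b.assoc q)
  let r : Lab S (Lab.out : Lab S (id : O → O) → O) :=
    (genO (outB a)).map (fun o => genO (outB (φ o))) hφ
  have h : (mulT m r).map (σ := fun x => S.out (outB x)) ψ hψ = (genO (mulT m r).head).map ψ hψ :=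
    congrArg (fun p : Lab S (id : O → O) => p.map (σ := fun x => S.out (outB x)) ψ hψ) (lab_id_eq _)
  refine Eq.trans ?_ h.symm
  exact congrArg (fun s => (genO s : Lab S (id : O → O)).map (σ := fun x => S.out (outB x)) ψ hψ)
    (b.out_mul _)

theorem IsOperadHom.graft {b : Operad m outB} {c : Operad m outC} {f : B → C}
    {hf : ∀ x, outC (f x) = outB x} (h : IsOperadHom b c f hf) (a : B) (φ : O → B)
    (hφ : ∀ o, S.out (outB (φ o)) = o) :
    f (b.graft a φ hφ) = c.graft (f a) (fun o => f (φ o))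
      (fun o => (congrArg S.out (hf _)).trans (hφ o)) := by
  refine (h.mul _).trans (congrArg c.mul (OD.ext rfl ?_))
  exact congrArg (fun s => Lab.map (fun o => f (φ o)) (fun o => (congrArg S.out (hf _)).trans (hφ o))
    (genO s)) (hf a).symm

end Graft

/-! ### Web monoids without standard amalgamation -/

section Obstruction

variable {O Y : Type} {S : Sig O} {m : MonStr S} (W : WebMonoid m)

/-- Compatibility with composition is the main diagram. Units have no vertical inputs, so
relabelling by generators leaves them unchanged and the unit law of the web multiplication shows
that they are preserved. -/
theorem WebMonoid.mulT_isOperadHom (τ : Y → S.Sym) :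
    IsOperadHom (labOperad W.free (Lab.out : Lab W.F τ → S.Sym)) (labOperad W.free τ)
      (mulT W.web) (mulT_out W.web) := by
  have main : ∀ q : OD (Lab.out : Lab W.F (Lab.out : Lab W.F τ → S.Sym) → S.Sym) Lab.out,
      mulT W.web ((labOperad W.free _).mul q) = (labOperad W.free τ).mul
        (q.map (mulT W.web) (mulT_out W.web) (mulT W.web) (mulT_out W.web)) := fun q => by
    have h := congrArg (fun f => Hom.lab f ((odotLab m).symm (q.map tensorLab.symm (fun _ => rfl)
      tensorLab.symm fun _ => rfl))) W.main
    simp only [VHom.comp_lab] at h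
    rw [labOperad_mul, odotHom_lab, Equiv.apply_symm_apply] at h
    refine Eq.trans (congrArg W.web.mul.lab ?_) h.symm
    rw [Equiv.symm_apply_eq, tensorHom_lab]
    refine congrArg W.free.mul.lab ?_
    rw [Equiv.symm_apply_eq]
    refine Eq.trans ?_ (distrib_lab m _).symm
    rw [Equiv.apply_symm_apply]
    exact OD.ext (Equiv.apply_symm_apply _ _).symm
      (Lab.ext rfl fun i => (Equiv.apply_symm_apply _ _).symm)
  refine ⟨main, fun o => ?_⟩
  have h := mulT_map_unitT W.web ((labOperad W.free τ).one o)
  refine Eq.trans (congrArg (mulT W.web) ?_) h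
  exact ((labOperad_map_isOperadHom W.free (unitT W.web τ) (unitT_out W.web)).one o).symm

theorem labOperad_graft_sum (h : HMonStr m W.F) {τ : Y → S.Sym} (a : Lab W.F τ) (φ : O → Lab W.F τ)
    (hφ : ∀ o, S.out (φ o).out = o) (w : Y → ℕ) :
    ((labOperad h τ).graft a φ hφ).sum w = a.sum w + (genO a.out).sum fun o => (φ o).sum w :=
  labOperad_sum_mul h w _

theorem WebMonoid.subst_isOperadHom [DecidableEq S.Sym] (b : S.Sym)
    (t : Lab W.F (id : S.Sym → S.Sym)) (ht : t.out = b) :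
    IsOperadHom (labOperad W.free id) (labOperad W.free id) (fun p => subst W.web b t p ht)
      (fun _ => mulT_out W.web _) :=
  (W.mulT_isOperadHom id).comp (labOperad_map_isOperadHom W.free _ _)

theorem subst_unitT {O : Type} [DecidableEq O] {A : Sig O} (n : MonStr A) (b : O)
    (t : Lab A (id : O → O)) (ht : t.out = b) (s : O) :
    subst n b t (unitT n id s) ht = if s = b then t else unitT n id s := by
  rw [subst, unitT_map, mulT_unitT]

/-- The web monoid of a monoid with a binary symbol whose three types are distinct has no
homomorphism to a monoid with standard amalgamation. -/
theorem WebMonoid.not_isMonHom_of_standard {Q : Type} {N : Sig Q} {n : MonStr N} (hn : n.Standard)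
    {u : S.Sym → Q} {f : Hom u W.F N} (hf : IsMonHom W.web n f) (b : S.Sym) {x y : O}
    (hxy : x ≠ y) (hx : S.out b ≠ x) (hy : S.out b ≠ y)
    (hb : ∀ w, (genO b).sum w = w x + w y) : False := by
  classical
  let P := labOperad W.free (id : S.Sym → S.Sym)
  let η := unitT W.web (id : S.Sym → S.Sym)
  let υ := m.one.toFun
  have hη : ∀ s, (η s).out = s := unitT_out W.web
  have hυ : ∀ o, S.out (υ o) = o := m.one.out_eq
  have hυi : Function.Injective υ := fun o o' h => by rw [← hυ o, h, hυ]
  -- The constant weight `1` compares arities: identities are unary and `b` is binary.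
  have hbυ : ∀ o, υ o ≠ b := fun o h => by
    have h1 := hb fun _ => 1
    rw [← h, genO_one_sum] at h1
    exact absurd h1 (by norm_num)
  have hP : ∀ o, (P.one o).out = υ o := P.out_one
  -- units of the web monoid inserted at the inputs of type `c`
  let φ : O → O → Lab W.F (id : S.Sym → S.Sym) := fun c o => if o = c then η (υ c) else P.one o
  -- The generator of type `υ c` and the `⊙`-unit at `c` have the same output type, so inserting the
  -- former does not change output types.
  have hφ' : ∀ c o, (φ c o).out = υ o := fun c o => by
    by_cases h : o = c
    · rw [h]
      simp only [φ, if_true, hη]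
    · simp only [φ, if_neg h, hP]
  have hφ : ∀ c o, S.out (φ c o).out = o := fun c o => by rw [hφ', hυ]
  -- For `c = x, y` this is the generator `b` with a unit generator on its input of type `c`; it has
  -- inputs `b`, `υ c` and output type `b`.
  let t : O → Lab W.F (id : S.Sym → S.Sym) := fun c => P.graft (η b) (φ c) (hφ c)
  have ht : ∀ c, (t c).out = b := fun c => by
    rw [P.out_graft_congr (hφ c) P.out_one_out (a' := η b) rfl fun o => (hφ' c o).trans (hP o).symm,
      P.graft_one, hη]
  have hφs : ∀ c o w, (φ c o).sum w = if o = c then w (υ c) else 0 := fun c o w => by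
    by_cases h : o = c
    · simp only [φ, if_pos h]
      exact unitT_sum W.web w _
    · simp only [φ, if_neg h]
      exact labOperad_sum_one W.free w o
  have hts : ∀ c, c = x ∨ c = y → ∀ w, (t c).sum w = w b + w (υ c) := fun c hc w => by
    rw [labOperad_graft_sum, unitT_sum, hη, hb, hφs, hφs]
    rcases hc with rfl | rfl
    · rw [if_pos rfl, if_neg hxy.symm, add_zero]
    · rw [if_pos rfl, if_neg hxy, zero_add]
  let z := S.out b
  let ψ : Lab W.F (id : S.Sym → S.Sym) → O → Lab W.F (id : S.Sym → S.Sym) :=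
    fun p o => if o = z then p else P.one o
  have hψ : ∀ p, p.out = b → ∀ o, S.out (ψ p o).out = o := fun p hp o => by
    by_cases h : o = z
    · rw [h]
      simp only [ψ, if_true, hp, z]
    · simp only [ψ, if_neg h, hP, hυ]
  let r : ∀ p : Lab W.F (id : S.Sym → S.Sym), p.out = b → Lab W.F (id : S.Sym → S.Sym) :=
    fun p hp => P.graft (η (υ z)) (ψ p) (hψ p hp)
  have hr : ∀ p hp, (r p hp).out = b := fun p hp => by
    rw [P.out_graft_congr (hψ p hp) (hψ p hp) (a' := P.one z) ((hη _).trans (hP z).symm)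
      fun _ => rfl, P.one_graft]
    simpa only [ψ, if_pos rfl] using hp
  -- The third symbol: the unit generator is placed at the output `z` of `b`.
  let t' := r (η b) (hη b)
  have hts' : ∀ w, t'.sum w = w b + w (υ z) := fun w => by
    rw [labOperad_graft_sum, unitT_sum, hη, genO_one_sum, add_comm]
    simp only [ψ, if_pos rfl]
    rw [unitT_sum]
  -- substitution
  have hone : ∀ p hp o, subst W.web b p (P.one o) hp = P.one o := fun p hp o =>
    (W.subst_isOperadHom b p hp).one o
  have hsb : ∀ p hp, subst W.web b p (η b) hp = p := fun p hp => by
    rw [subst_unitT, if_pos rfl]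
  have hsυ : ∀ p hp o, subst W.web b p (η (υ o)) hp = η (υ o) := fun p hp o => by
    rw [subst_unitT, if_neg (hbυ o)]
  have hsφ : ∀ p hp c o, subst W.web b p (φ c o) hp = φ c o := fun p hp c o => by
    by_cases h : o = c
    · simp only [φ, if_pos h, hsυ]
    · simp only [φ, if_neg h, hone]
  have hst : ∀ p hp c, subst W.web b p (t c) hp = P.graft p (φ c) (hφ c) := fun p hp c => by
    refine ((W.subst_isOperadHom b p hp).graft _ _ _).trans ?_
    simp only [hsb, hsφ]
    rfl
  have hsr : ∀ p hp, subst W.web b p t' hp = r p hp := fun p hp => by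
    refine ((W.subst_isOperadHom b p hp).graft _ _ _).trans ?_
    simp only [hsυ]
    refine P.graft_congr _ _ _ fun i => ?_
    by_cases h : S.inp (η (υ z)).out i = z
    · simp only [ψ, if_pos h, hsb]
    · simp only [ψ, if_neg h, hone]
  have inp_η : ∀ o i, S.inp (η (υ o)).out i = o := fun o i => by
    have : ∀ s, s = υ o → ∀ i, S.inp s i = o := by
      rintro s rfl i
      exact inp_one m o i
    exact this _ (hη _) i
  -- The horizontal input of the generator of type `υ c` has type `c`, so insertion at a different
  -- type `d` does not affect it.
  have hφφ : ∀ c d, c ≠ d → ∀ o, P.graft (φ c o) (φ d) (hφ d) = if o = c then η (υ c) else φ d o :=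
    fun c d h o => by
      by_cases ho : o = c
      · simp only [φ, if_pos ho]
        refine (P.graft_congr _ _ P.out_one_out fun i => ?_).trans (P.graft_one _)
        rw [inp_η, if_neg h]
      · simp only [φ, if_neg ho]
        exact P.one_graft _ _ (hφ d)
  -- Both sides are `b` with unit generators on both inputs.
  have hxy' : subst W.web b (t y) (t x) (ht y) = subst W.web b (t x) (t y) (ht x) := by
    rw [hst, hst, P.graft_graft, P.graft_graft]
    refine P.graft_congr _ _ _ fun i => ?_
    rw [hφφ _ _ hxy, hφφ _ _ hxy.symm]
    simp only [φ]
    split_ifs with h1 h2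
    · exact absurd (h1.symm.trans h2) hxy.symm
    · rfl
    · rfl
    · rfl
  -- Insertions at an input and at the output of `b` commute by associativity of grafting.
  have hcz : ∀ c, subst W.web b t' (t c) (hr (η b) (hη b)) = subst W.web b (t c) t' (ht c) := fun c => by
    rw [hst, hsr, P.graft_graft]
    refine P.graft_congr _ _ _ fun i => ?_
    rw [inp_η]
    simp only [ψ, if_pos rfl]
    rfl
  have hne : ∀ {c d : O}, c ≠ d → υ c ≠ υ d := fun h => hυi.ne h
  obtain ⟨a1, a2⟩ := subst_conflict hn hf (hbυ x) (hbυ y) (hne hxy) (ht x) (ht y)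
    (hts x (Or.inl rfl)) (hts y (Or.inr rfl)) hxy'
  obtain ⟨b1, b2⟩ := subst_conflict hn hf (hbυ x) (hbυ z) (hne (Ne.symm hx)) (ht x) (hr (η b) (hη b))
    (hts x (Or.inl rfl)) hts' (hcz x)
  obtain ⟨c1, c2⟩ := subst_conflict hn hf (hbυ y) (hbυ z) (hne (Ne.symm hy)) (ht y) (hr (η b) (hη b))
    (hts y (Or.inr rfl)) hts' (hcz y)
  have o1 := precedes_or_precedes f (hbυ x).symm (hts x (Or.inl rfl))
  have o2 := precedes_or_precedes f (hbυ y).symm (hts y (Or.inr rfl))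
  have o3 := precedes_or_precedes f (hbυ z).symm hts'
  -- Pigeonhole: `b` is first or last in each of three symbols, so two of them agree, contrary to
  -- one of the conflicts.
  rcases o1 with o1 | o1
  · rcases o2 with o2 | o2
    · exact a1 ⟨o1, o2⟩
    · rcases o3 with o3 | o3
      · exact b1 ⟨o1, o3⟩
      · exact c2 ⟨o2, o3⟩
  · rcases o2 with o2 | o2
    · rcases o3 with o3 | o3
      · exact c1 ⟨o2, o3⟩
      · exact b2 ⟨o1, o3⟩
    · exact a2 ⟨o1, o2⟩

end Obstruction

/-! ### The example -/

section Sums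

variable {O : Type} {A B : Sig O}

/-- Indicator weights show that corresponding fibres have the same size; bijections between the
fibres are glued. -/
theorem exists_equiv_of_sum {k n : ℕ} (l : Fin k → O) (l' : Fin n → O)
    (h : ∀ w : O → ℕ, ∑ j, w (l' j) = ∑ i, w (l i)) : ∃ e : Fin k ≃ Fin n, ∀ i, l' (e i) = l i := by
  classical
  have hc : ∀ o, Fintype.card {i // l i = o} = Fintype.card {j // l' j = o} := fun o => by
    have := h fun x => if x = o then 1 else 0
    rw [Fintype.card_subtype, Fintype.card_subtype]
    simpa using this.symm
  let e : Fin k ≃ Fin n := (Equiv.sigmaFiberEquiv l).symm.trans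
    ((Equiv.sigmaCongrRight fun o => Fintype.equivOfCardEq (hc o)).trans (Equiv.sigmaFiberEquiv l'))
  exact ⟨e, fun i => (Fintype.equivOfCardEq (hc (l i)) ⟨i, rfl⟩).2⟩

/-- A map of symbols that preserves the output type and the multiset of the input types underlies
a morphism. -/
theorem exists_hom_of_sum (f : A.Sym → B.Sym) (out : ∀ a, B.out (f a) = A.out a)
    (sum : ∀ a w, (genO (f a)).sum w = (genO a).sum w) : ∃ g : VHom A B, g.toFun = f := by
  choose e he using fun a => exists_equiv_of_sum (A.inp a) (B.inp (f a)) (sum a)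
  exact ⟨⟨f, e, out, he⟩, rfl⟩

/-- When the input types of each target symbol are distinct, the typing condition determines the
permutations. -/
theorem VHom.ext_of_injective (hB : ∀ b, Function.Injective (B.inp b)) {f g : VHom A B}
    (h : ∀ a, f.toFun a = g.toFun a) : f = g := by
  obtain ⟨f, s, hf, hf'⟩ := f
  obtain ⟨g, t, hg, hg'⟩ := g
  obtain rfl : f = g := funext h
  obtain rfl : s = t := funext fun a => Equiv.ext fun i => hB _ ((hf' a i).trans (hg' a i).symm)
  rfl

theorem genO_tensor_sum (p : Comp A B) (w : O → ℕ) :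
    (genO p : Lab (tensor A B) id).sum w = ∑ i, (genO (p.arg i)).sum w := by
  rw [← tensorLab_sum]
  exact Finset.sum_congr rfl fun i _ => Finset.sum_congr rfl fun j _ =>
    congrArg w (tensor_inp A B p ⟨i, j⟩)

end Sums

namespace ExSym

/-- The rank of a symbol; composites have the maximal rank of the components. -/
def rank : ExSym → ℕ
  | identity _ => 0
  | unary _ => 1
  | binary => 2

/-- The symbol with given rank and output type. -/
def ofRank (x : Shape) : ℕ → ExSym
  | 0 => identity x
  | 1 => unary x
  | _ => binary

theorem rank_le (s : ExSym) : s.rank ≤ 2 := by cases s <;> simp [rank]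

theorem rank_ofRank (x : Shape) {n : ℕ} (h : n ≤ 2) : (ofRank x n).rank = n := by
  interval_cases n <;> rfl

theorem eq_binary {s : ExSym} (h : 2 ≤ s.rank) : s = binary := by
  cases s <;> simp_all [rank]

variable {d : Fin 3 → Shape}

theorem ext_rank {s t : ExSym} (ho : (exSig d).out s = (exSig d).out t) (h : s.rank = t.rank) :
    s = t := by
  cases s <;> cases t <;> first
    | rfl
    | simp [rank] at h; done
    | exact congrArg unary ho
    | exact congrArg identity ho

theorem out_ofRank {x : Shape} {n : ℕ} (h : 2 ≤ n → d 0 = x) : (exSig d).out (ofRank x n) = x := by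
  match n with
  | 0 => rfl
  | 1 => rfl
  | n + 2 => exact h (by omega)

theorem sum_of_ne_binary {s : ExSym} (h : s ≠ binary) (w : Shape → ℕ) :
    (genO s : Lab (exSig d) id).sum w = w ((exSig d).out s) := by
  cases s with
  | binary => exact absurd rfl h
  | unary x => exact Fin.sum_univ_one _
  | identity x => exact Fin.sum_univ_one _

theorem sum_binary (w : Shape → ℕ) :
    (genO binary : Lab (exSig d) id).sum w = w (d 1) + w (d 2) := Fin.sum_univ_two _

theorem inp_injective (hd : Function.Injective d) (s : ExSym) :
    Function.Injective ((exSig d).inp s) := by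
  cases s with
  | binary => exact hd.comp (Fin.succ_injective 2)
  | unary x => exact fun i j _ => Subsingleton.elim (α := Fin 1) i j
  | identity x => exact fun i j _ => Subsingleton.elim (α := Fin 1) i j

theorem arg_ne_binary (hd : Function.Injective d) {p : Comp (exSig d) (exSig d)}
    (h : p.head = binary) (i) : p.arg i ≠ binary := by
  obtain ⟨a, b, t⟩ := p
  subst h
  intro h
  have h1 := t i
  rw [show b i = binary from h] at h1
  exact Fin.succ_ne_zero _ (hd h1).symm

theorem exists_arg_of_ne_binary {p : Comp (exSig d) (exSig d)} (h : p.head ≠ binary) :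
    ∃ i : Fin ((exSig d).ar p.head), ∀ j, j = i := by
  obtain ⟨a, b, t⟩ := p
  cases a with
  | binary => exact absurd rfl h
  | unary x => exact ⟨(0 : Fin 1), fun j => Subsingleton.elim (α := Fin 1) _ _⟩
  | identity x => exact ⟨(0 : Fin 1), fun j => Subsingleton.elim (α := Fin 1) _ _⟩

end ExSym

open ExSym

/-! ### Monoid structures on the example -/

section

variable {d : Fin 3 → Shape}

/-- The composition of the symbols of the example. -/
def exComp (p : Comp (exSig d) (exSig d)) : ExSym :=
  ofRank ((exSig d).out p.head) (max (rank p.head) (Finset.univ.sup fun i => rank (p.arg i)))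

theorem rank_exComp_le (p : Comp (exSig d) (exSig d)) (n : ℕ) :
    (exComp p).rank ≤ n ↔ rank p.head ≤ n ∧ ∀ i, rank (p.arg i) ≤ n := by
  rw [exComp, rank_ofRank]
  · simp
  · exact max_le (rank_le _) (Finset.sup_le fun i _ => rank_le _)

theorem inp_of_ne_binary {s : ExSym} (h : s ≠ binary) (i : Fin ((exSig d).ar s)) :
    (exSig d).inp s i = (exSig d).out s := by
  cases s with
  | binary => exact absurd rfl h
  | unary x => rfl
  | identity x => rfl

/-- Only rank two needs an argument: then `b` is the head, or it sits on a unary head, whose output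
type must be that of `b`. -/
theorem exComp_out (p : Comp (exSig d) (exSig d)) :
    (exSig d).out (exComp p) = (exSig d).out p.head := by
  refine out_ofRank fun h => ?_
  rcases le_max_iff.1 h with h | h
  · rw [eq_binary h]
    rfl
  · obtain ⟨i, -, hi⟩ := (Finset.le_sup_iff (by norm_num)).1 h
    have h1 := p.typed i
    rw [eq_binary hi] at h1
    by_cases h2 : p.head = binary
    · rw [h2]
      rfl
    · exact h1.trans (inp_of_ne_binary h2 i)

/-- Since `b` cannot be an argument of itself, a composite contains it at most once and all its
other components are unary with equal input and output types. -/
theorem exComp_sum (hd : Function.Injective d) (p : Comp (exSig d) (exSig d)) (w : Shape → ℕ) :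
    (genO (exComp p) : Lab (exSig d) id).sum w = ∑ i, (genO (p.arg i)).sum w := by
  have hb : ∀ {s}, rank s ≤ (exComp p).rank → s = binary → exComp p = binary := by
    rintro s h rfl
    exact eq_binary h
  obtain ⟨h1, h2⟩ := (rank_exComp_le p _).1 le_rfl
  by_cases h : p.head = binary
  · have h3 : ∀ i, (genO (p.arg i)).sum w = w ((exSig d).inp p.head i) := fun i => by
      rw [sum_of_ne_binary (arg_ne_binary hd h i), p.typed]
    rw [hb h1 h, Finset.sum_congr rfl fun i _ => h3 i]
    exact congrArg (fun s => (genO s : Lab (exSig d) id).sum w) h.symm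
  · obtain ⟨i, hi⟩ := exists_arg_of_ne_binary h
    rw [Fintype.sum_eq_single i fun j hj => absurd (hi j) hj]
    by_cases h' : p.arg i = binary
    · rw [hb (h2 i) h', h']
    · have h3 : exComp p ≠ binary := fun h4 => by
        have : (exComp p).rank ≤ 1 := (rank_exComp_le p 1).2 ⟨?_, fun j => ?_⟩
        · rw [h4] at this
          exact absurd this (by decide)
        · by_contra hc
          exact h (eq_binary (by omega))
        · by_contra hc
          rw [hi j] at hc
          exact h' (eq_binary (by omega))
      rw [sum_of_ne_binary h3, sum_of_ne_binary h', exComp_out, p.typed, inp_of_ne_binary h]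

theorem exists_exMon (hd : Function.Injective d) :
    ∃ m : MonStr (exSig d), ∀ x, m.one.toFun x = identity x := by
  obtain ⟨μ, hμ⟩ := exists_hom_of_sum (A := tensor (exSig d) (exSig d)) (B := exSig d) exComp
    exComp_out fun p w => (exComp_sum hd p w).trans (genO_tensor_sum p w).symm
  obtain ⟨e, he⟩ := exists_hom_of_sum (A := unit Shape) (B := exSig d) identity
    (fun _ => rfl) fun _ _ => rfl
  have hμo : ∀ p, (exSig d).out (μ.toFun p) = (exSig d).out p.head := μ.out_eq
  have hr : ∀ p n, rank (μ.toFun p) ≤ n ↔ rank p.head ≤ n ∧ ∀ i, rank (p.arg i) ≤ n := by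
    rw [hμ]
    exact rank_exComp_le
  have h0 : ∀ x, rank (e.toFun x) = 0 := fun x => by
    rw [he]
    rfl
  -- A symbol is determined by its output type and rank, so the monoid laws reduce to those of the
  -- maximum, tested on upper bounds.
  refine ⟨⟨μ, e, VHom.ext_of_injective (inp_injective hd) fun p => ?_,
    VHom.ext_of_injective (inp_injective hd) fun a => ?_,
    VHom.ext_of_injective (inp_injective hd) fun p => ?_⟩, fun x => by rw [he]⟩
  · refine ext_rank (d := d) ((Hom.out_eq _ p).trans (Hom.out_eq _ p).symm)
      (eq_of_forall_ge_iff fun n => (hr _ n).trans ⟨fun h => ?_, fun h => ⟨?_, fun i => ?_⟩⟩)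
    · have h1 := h.2 (e.perm p.head (0 : Fin 1))
      exact (congrArg (fun i => rank (p.arg i))
        ((e.perm p.head).symm_apply_apply (0 : Fin 1))).symm.le.trans h1
    · exact (h0 _).le.trans (Nat.zero_le n)
    · exact (congrArg (fun i => rank (p.arg i)) (Subsingleton.elim (α := Fin 1) _ _)).le.trans h
  · refine ext_rank (d := d) (Hom.out_eq _ a)
      (eq_of_forall_ge_iff fun n => (hr _ n).trans ⟨fun h => h.1, fun h => ⟨h, fun i => ?_⟩⟩)
    exact (h0 _).le.trans (Nat.zero_le n)
  · let q : Comp (exSig d) (exSig d) := ⟨p.head, fun i => (p.arg i).head, p.typed⟩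
    let arg : (Σ i, Fin ((exSig d).ar (p.arg i).head)) → ExSym := fun x => (p.arg x.1).arg x.2
    refine ext_rank (d := d) ((Hom.out_eq _ p).trans (Hom.out_eq _ p).symm)
      (eq_of_forall_ge_iff fun n => (hr _ n).trans (Iff.trans ?_ (hr _ n).symm))
    constructor
    · intro h
      have h1 := (hr q n).1 h.1
      refine ⟨h1.1, fun i => (hr _ n).2 ⟨h1.2 i, fun j => ?_⟩⟩
      have h2 : rank (arg (finSigmaFinEquiv.symm ((μ.perm q).symm
          (μ.perm q (finSigmaFinEquiv ⟨i, j⟩))))) ≤ n := h.2 _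
      rwa [Equiv.symm_apply_apply, Equiv.symm_apply_apply] at h2
    · intro h
      have h1 := fun i => (hr _ n).1 (h.2 i)
      exact ⟨(hr q n).2 ⟨h.1, fun i => (h1 i).1⟩, fun k => (h1 _).2 _⟩

/-- The `k`-th input of a composite with two inputs. -/
theorem exTensor_inp (hd : Function.Injective d) (p : Comp (exSig d) (exSig d))
    (h : (tensor (exSig d) (exSig d)).ar p = 2)
    (k : Fin ((tensor (exSig d) (exSig d)).ar p)) :
    ∃ l : Fin 2, (l : ℕ) = k ∧ (tensor (exSig d) (exSig d)).inp p k = d l.succ := by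
  obtain ⟨⟨i, j⟩, rfl⟩ := finSigmaFinEquiv.surjective k
  rw [tensor_inp]
  rw [finSigmaFinEquiv_apply]
  have hone : p.head ≠ binary → ∃ l : Fin 2,
      (l : ℕ) = ∑ r : Fin (i : ℕ), (exSig d).ar (p.arg (Fin.castLE i.2.le r)) + j ∧
        (exSig d).inp (p.arg i) j = d l.succ := fun hp => by
    obtain ⟨i', hi'⟩ := exists_arg_of_ne_binary hp
    obtain rfl := hi' i
    have hi : ∀ r : Fin (i : ℕ), False := fun r => by
      have := congrArg Fin.val (hi' (Fin.castLE i.2.le r))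
      exact absurd this r.2.ne
    have h1 : (exSig d).ar (p.arg i) = 2 :=
      (Fintype.sum_eq_single i fun j hj => absurd (hi' j) hj).symm.trans h
    rw [Finset.sum_eq_zero fun r _ => (hi r).elim, zero_add]
    generalize p.arg i = s at h1 j
    cases s with
    | binary => exact ⟨j, rfl, rfl⟩
    | unary x => exact absurd (show (1 : ℕ) = 2 from h1) (by decide)
    | identity x => exact absurd (show (1 : ℕ) = 2 from h1) (by decide)
  by_cases hp : p.head = binary
  · have h1 : ∀ s, s ≠ binary → (exSig d).ar s = 1 := fun s hs => by
      cases s <;> first | rfl | exact absurd rfl hs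
    have h2 := fun i => h1 _ (arg_ne_binary hd hp i)
    have hj := j.2.trans_eq (h2 i)
    rw [Finset.sum_congr rfl fun r _ => h2 _, inp_of_ne_binary (arg_ne_binary hd hp i), p.typed]
    have h3 : (j : ℕ) = 0 := by omega
    rw [h3]
    simp only [Finset.sum_const, Finset.card_univ, Fintype.card_fin, smul_eq_mul, mul_one, add_zero]
    clear h3 hj h2 hone j h
    obtain ⟨a, b, t⟩ := p
    subst hp
    exact ⟨i, rfl, rfl⟩
  · exact hone hp

/-- A permutation of one input is trivial. With two inputs the image is `b`, the composite has the
types `d 1`, `d 2` in this order (`exTensor_inp`), and injectivity leaves only the identity. -/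
theorem exMon_standard (hd : Function.Injective d) (m : MonStr (exSig d)) : m.Standard := by
  intro p k
  have key : ∀ s, s = m.mul.toFun p → ∀ (σ : Fin ((tensor (exSig d) (exSig d)).ar p) ≃
      Fin ((exSig d).ar s)), (∀ i, (exSig d).inp s (σ i) =
        (tensor (exSig d) (exSig d)).inp p i) → (σ k : ℕ) = k := by
    intro s _ σ hσ
    have hc : (tensor (exSig d) (exSig d)).ar p = (exSig d).ar s := by
      simpa using Fintype.card_congr σ
    have hone : (exSig d).ar s = 1 → (σ k : ℕ) = k := fun h => by omega
    cases s with
    | binary =>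
      obtain ⟨l, hl, h⟩ := exTensor_inp hd p hc k
      have h1 : d (σ k).succ = d l.succ := (hσ k).trans h
      rw [← hl]
      exact congrArg Fin.val (Fin.succ_injective _ (hd h1))
    | unary x => exact hone rfl
    | identity x => exact hone rfl
  exact key _ rfl (m.mul.perm p) (m.mul.inp_eq p)

theorem exMon_not_monIso (hd : Function.Injective d) {m : MonStr (exSig d)} (W : WebMonoid m)
    {Q : Type} {N : Sig Q} {n : MonStr N} (hn : n.Standard) : ¬ MonIso W.web n := by
  rintro ⟨_, _, f, _, hf, _⟩
  exact W.not_isMonHom_of_standard hn hf binary (hd.ne (by decide : (1 : Fin 3) ≠ 2))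
    (hd.ne (by decide : (0 : Fin 3) ≠ 1)) (hd.ne (by decide : (0 : Fin 3) ≠ 2)) sum_binary

end

/-! ### An opetopic set -/

section Chaotic

/-- The signature of all pairs of types, as unary symbols. -/
abbrev chaotic (X : Type) : Sig X where
  Sym := X × X
  typ := fun p => { ar := 1, out := p.1, inp := fun _ => p.2 }

variable {O Q X : Type}

/-- A symbol of `A` with an image here is unary, and a pair is determined by its two types. All
equations between morphisms to `chaotic X` follow. -/
theorem chaotic_hom_ext {u : O → X} {A : Sig O} (f g : Hom u A (chaotic X)) : f = g := by
  obtain ⟨f, s, hf, hf'⟩ := f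
  obtain ⟨g, t, hg, hg'⟩ := g
  have hA : ∀ a, Subsingleton (Fin (A.ar a)) := fun a =>
    (show Fin (A.ar a) ≃ Fin 1 from s a).subsingleton
  obtain rfl : f = g := funext fun a => Prod.ext ((hf a).trans (hg a).symm) <|
    (hf' a ((s a).symm (0 : Fin 1))).trans
      ((congrArg (fun i => u (A.inp a i)) (Subsingleton.elim _ _)).trans
        (hg' a ((t a).symm (0 : Fin 1))).symm)
  obtain rfl : s = t := by
    funext a
    refine Equiv.ext fun i => ?_
    exact Subsingleton.elim (α := Fin 1) (s a i) (t a i)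
  rfl

/-- The monoid of all pairs of types, that is, the category with a unique morphism between any
two objects. -/
def chaoticMon (X : Type) : MonStr (chaotic X) where
  mul :=
    { toFun := fun p => (p.head.1, (p.arg (0 : Fin 1)).2)
      perm := fun _ => finCongr (Fin.sum_univ_one fun _ => 1)
      out_eq := fun _ => rfl
      inp_eq := fun p _ => congrArg (fun j => (p.arg j).2) (Subsingleton.elim (α := Fin 1) _ _) }
  one :=
    { toFun := fun x => (x, x)
      perm := fun _ => Equiv.refl _
      out_eq := fun _ => rfl
      inp_eq := fun _ _ => rfl }
  one_mul := chaotic_hom_ext _ _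
  mul_one := chaotic_hom_ext _ _
  assoc := chaotic_hom_ext _ _

def chaoticBase (X : Type) : Hom (fun _ : X => ()) (chaotic X) (unit Unit) where
  toFun := fun _ => ()
  perm := fun _ => Equiv.refl _
  out_eq := fun _ => rfl
  inp_eq := fun _ _ => rfl

theorem chaoticBase_isProne (X : Type) :
    IsProne (chaoticMon X) (unitMon Unit) (chaoticBase X) := by
  refine ⟨⟨hom_unit_eq _ _, hom_unit_eq _ _⟩, fun R C l w g _ => ?_⟩
  -- The symbols of `C` are unary because of `g`; the lift is forced to be the pair of output and
  -- input type.
  refine ⟨⟨fun c => (w (C.out c), w (C.inp c ((g.perm c).symm (0 : Fin 1)))), g.perm,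
    fun _ => rfl, fun c i => congrArg (fun j => w (C.inp c j)) ?_⟩, ⟨⟨chaotic_hom_ext _ _,
      chaotic_hom_ext _ _⟩, hom_unit_eq _ _⟩, fun _ _ => chaotic_hom_ext _ _⟩
  rw [Equiv.symm_apply_eq]
  exact Subsingleton.elim (α := Fin 1) _ _

theorem isProne_ident {A : Sig O} (m : MonStr A) : IsProne m m (Hom.ident A) := by
  have h : tensorHom (Hom.ident A) (Hom.ident A) = Hom.ident (tensor A A) :=
    VHom.ext_lab fun Y τ p => tensorLab.injective (tensorHom_lab _ _ _)
  exact ⟨⟨(congrArg (VHom.comp m.mul) h).symm, rfl⟩, fun R C l w g hg =>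
    ⟨g, ⟨hg, rfl⟩, fun _ h => h.2⟩⟩

end Chaotic

/-- A set of types with a monoid over it. -/
structure Stage where
  O : Type
  A : Sig O
  mon : MonStr A

noncomputable def Stage.web (s : Stage) : WebMonoid s.mon := Classical.choice (exists_webMonoid s.mon)

noncomputable def Stage.next (s : Stage) : Stage := ⟨s.A.Sym, s.web.F, s.web.web⟩

/-- The iterated web monoids of a monoid. -/
noncomputable def stage (s : Stage) : ℕ → Stage
  | 0 => s
  | n + 1 => (stage s n).next

/-- The opetopic set whose pasting diagrams of dimension `0` are all pairs in `X`, and whose cells of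
positive dimension are all pasting diagrams. -/
noncomputable def chaoticOpetopic (X : Type) : OpetopicSet where
  X n := (stage ⟨X, chaotic X, chaoticMon X⟩ n).O
  typ n := (stage ⟨X, chaotic X, chaoticMon X⟩ n).A.typ
  S n := (stage ⟨X, chaotic X, chaoticMon X⟩ n).A
  mon n := (stage ⟨X, chaotic X, chaoticMon X⟩ n).mon
  cell n := Hom.ident (stage ⟨X, chaotic X, chaoticMon X⟩ n).A
  cell_strict _ _ _ := rfl
  W n := (stage ⟨X, chaotic X, chaoticMon X⟩ n).web
  base := chaoticBase X
  base_prone := chaoticBase_isProne X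
  step n := Hom.ident (stage ⟨X, chaotic X, chaoticMon X⟩ n).web.F
  step_prone n := isProne_ident (stage ⟨X, chaotic X, chaoticMon X⟩ n).web.web

/-- The web monoid of the chaotic category contains the paths of length two. -/
theorem exists_path {X : Type} (W : WebMonoid (chaoticMon X)) (x y z : X) :
    ∃ b : W.F.Sym, W.F.out b = (x, z) ∧ ∀ w, (genO b).sum w = w (x, y) + w (y, z) := by
  classical
  let P := labOperad W.free (id : X × X → X × X)
  let η := unitT W.web (id : X × X → X × X)
  have hη : ∀ s, (η s).out = s := unitT_out W.web
  -- The path is the generator `(x, y)` with the generator `(y, z)` composed at its input `y`.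
  let φ : X → Lab W.F (id : X × X → X × X) := fun o => if o = y then η (y, z) else P.one o
  have hφy : φ y = η (y, z) := if_pos rfl
  have hφ : ∀ o, (chaotic X).out (φ o).out = o := fun o => by
    by_cases h : o = y
    · rw [h, hφy, hη]
    · simp only [φ, if_neg h]
      exact P.out_one_out o
  let t := P.graft (η (x, y)) φ hφ
  have hg : ∀ s, s = (x, y) → (chaoticMon X).mul.toFun ⟨s, fun i => (φ ((chaotic X).inp s i)).out,
      fun _ => hφ _⟩ = (x, z) := by
    rintro s rfl
    exact Prod.ext rfl ((congrArg (fun t : Lab W.F (id : X × X → X × X) => t.out.2) hφy).trans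
      (show (η (y, z)).out.2 = z from congrArg Prod.snd (hη (y, z))))
  refine ⟨t.head, (P.out_mul _).trans (hg _ (hη _)), fun w => ?_⟩
  have h1 : genO t.head = t := (lab_id_eq t).symm
  have h2 : ∀ s, s = (x, y) → ∀ w : X → ℕ, (genO s : Lab (chaotic X) id).sum w = w y := by
    rintro s rfl w
    exact Fin.sum_univ_one _
  rw [h1, labOperad_graft_sum, h2 _ (hη _), hφy, unitT_sum, unitT_sum]

theorem chaoticOpetopic_not_monIso {Q : Type} {N : Sig Q} {n : MonStr N} (hn : n.Standard) :
    ¬ MonIso ((chaoticOpetopic Shape).mon 2) n := by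
  rintro ⟨_, _, f, _, hf, _⟩
  let s : Stage := ⟨Shape, chaotic Shape, chaoticMon Shape⟩
  -- `s.web` is the monoid in dimension one; three different objects make the three pairs that type
  -- the path distinct, and the obstruction then concerns dimension two.
  obtain ⟨b, hb, hs⟩ := exists_path s.web .circle .square .triangle
  have h1 : (Shape.circle, Shape.square) ≠ (.square, .triangle) := by simp
  have h2 : (Shape.circle, Shape.triangle) ≠ (.circle, .square) := by simp
  have h3 : (Shape.circle, Shape.triangle) ≠ (.square, .triangle) := by simp
  exact s.next.web.not_isMonHom_of_standard hn hf b h1 (hb.trans_ne h2) (hb.trans_ne h3) hs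

end Web

theorem mainTheorem9 :
    (∀ d : Fin 3 → Web.Shape, Function.Injective d →
      (∃ m : Web.MonStr (Web.exSig d), ∀ x, m.one.toFun x = Web.ExSym.identity x) ∧
      ∀ m : Web.MonStr (Web.exSig d),
        m.Standard ∧ Nonempty (Web.WebMonoid m) ∧
        ∀ (W : Web.WebMonoid m) (Q : Type) (N : Web.Sig Q) (n : Web.MonStr N),
          n.Standard → ¬ Web.MonIso W.web n) ∧
    ∃ (X : Web.OpetopicSet) (k : ℕ),
      ∀ (Q : Type) (N : Web.Sig Q) (n : Web.MonStr N),
        n.Standard → ¬ Web.MonIso (X.mon k) n :=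
  ⟨fun _ hd => ⟨Web.exists_exMon hd, fun m => ⟨Web.exMon_standard hd m, Web.exists_webMonoid m,
    fun W _ _ _ hn => Web.exMon_not_monIso hd W hn⟩⟩,
    Web.chaoticOpetopic Web.Shape, 2, fun _ _ _ hn => Web.chaoticOpetopic_not_monIso hn⟩
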